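/- **Setting.** Let $D_R=\{z\in\mathbb C:|z|<R\}$, let $P_1,\dots,P_m$ be polynomials and $\varphi_0,\dots,\varphi_{m-1}\in\mathcal O(D_R)$. Consider $$\partial_t^m u=\sum_{j=1}^m\partial_t^{m-j}P_j(\partial_z)u,\qquad \partial_t^ju(0,z)=\varphi_j(z)\quad(0\le j<m),\tag{1}$$ and let $\hat u(t,z)=\sum_{n\ge0}a_n(z)t^n$, $a_n\in\mathcal O(D_R)$, be its formal power series solution. The variable $t$ lives on the universal covering $\tilde{\mathbb C}$ of $\mathbb C\setminus\{0\}$; a sector $S(d,\alpha,r)$ is $\{t: |\arg t-d|<\alpha/2,\ 0<|t|<r\}$, and $S(d,\alpha)=S(d,\alpha,\infty)$. *Summability.* Let $k>0$. The series $\hat u$ is $k$-summable in the direction $d\in\mathbb R$ if for some disc $D_\rho$, $0<\rho\le R$, and some $\varepsilon>0$: (A) $\sup_{z\in D_\rho}|a_n(z)|\le AB^n(n!)^{1/k}$ for all $n$, with constants $A,B>0$; (B) the modified Borel transform $g(s,z)=\sum_n \frac{n!\,a_n(z)}{\Gamma(1+n(1+1/k))}s^n$ continues holomorphically to $S(d,\varepsilon)\times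 D_\rho$, and for every $\alpha<\varepsilon$ satisfies $|g(s,z)|\le C_1e^{C_2|s|^k}$ on $S(d,\alpha)\times D_\rho$ with constants $C_1,C_2>0$. Its $k$-sum $u^d=\mathcal S_{k,d}\hat u$ is the analytic continuation of the function given near $\arg t=d$, for small $|t|$, by $$u^d(t,z)=t^{-\kappa}\int_{e^{id}\mathbb R_+}g(s,z)\,C_{(k+1)/k}\big((s/t)^{\kappa}\big)\,ds^{\kappa},\qquad \kappa=\tfrac{k}{1+k},\quad C_\alpha(\tau)=\sum_{n\ge0}\frac{(-\tau)^n}{n!\,\Gamma(1-\frac{n+1}{\alpha})}.$$ Directions in which $\hat u$ is not $k$-summable are singular; $\hat u$ is $k$-summable if there are only finitely many of them modulo $2\pi$. A Stokes line is a set $\mathcal L_\phi=\{\arg t=\phi\}$ with $\phi$ singular and all other directions near $\phi$ nonsingular; the anti-Stokes lines are then $\mathcal L_{\phi\pm\pi/(2k)}$. *Maximal families.* For $q\in\mathbb Q_+$ let $W$ be the Riemann surface of $t^{1/q}$, that is $\tilde{\mathbb C}$ with $t$ and $te^{2q\pi i}$ identified, and $W_r=\{t\in W:0<|t|<r\}$.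 A sector on $W$ is a one-to-one image of a sector of $\tilde{\mathbb C}$, or some $W_r$ (with opening $2q\pi$). An actual solution of (1) on $V\times D_\rho$ is a $u\in\mathcal O(V\times D_\rho)$ that satisfies the equation and $\lim_{t\to0,\,t\in V}\partial_t^ju(t,z)=\varphi_j(z)$ for $0\le j<m$ (read on the preimage of $V$ in $\tilde{\mathbb C}$). Let $V$ be a sector on $W$ with opening greater than $\pi/k$. A finite family $\{u_i\}$, $u_i\in\mathcal O(V_i\times D_\rho)$, is a maximal family of solutions of (1) on $V\times D_\rho$ if - each $V_i\subseteq V$ is a sector with opening greater than $\pi/k$, and the $V_i$ cover $V$; - each $u_i$ is an actual solution on $V_i\times D_\rho$; - if $i\ne j$ and $V_i\cap V_j\neq\emptyset$, then $u_i\not\equiv u_j$ on $(V_i\cap V_j)\times D_\rho$; - if $\tilde V\subseteq V$ is a sector, $\tilde u\in\mathcal O(\tilde V\times D_\rho)$ is an actual solution, and $\tilde u=\mathcal S_{k,d}\hat u$ for some nonsingular direction $d$ whose ray lies in $\tilde V$ near $0$, then for some $i$ we have $\tilde V\cap V_i\ne\emptyset$ and $\tilde u\equiv u_i$ on $(\tilde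 V\cap V_i)\times D_\rho$. **Theorem.** Let $\hat u$ be $k$-summable. Assume that there is a smallest $q\in\mathbb Q_+$ such that $\hat u(te^{2q\pi i},z)=\hat u(t,z)$ as formal power series (automatic if $q\in\mathbb N$) and such that, for every nonsingular direction $d$, the $k$-sum $u^d$ continues analytically to $\{t\in\tilde{\mathbb C}:|t|<r_d\}\times D_{\rho_d}$ for some $r_d,\rho_d>0$ and satisfies $u^d(te^{2q\pi i},z)=u^d(t,z)$ there. Suppose that the singular directions of $\hat u$ are exactly the numbers $d_i+2q\pi l$ with $1\le i\le n$ and $l\in\mathbb Z$, where $n\ge1$ and $0\le d_1<\dots<d_n<2q\pi$, and put $d_{n+1}=d_1+2q\pi$. Then, modulo $2q\pi$, the Stokes lines for $\hat u$ are exactly the sets $\mathcal L_{d_i}$, and the anti-Stokes lines are exactly the sets $\mathcal L_{d_i\pm\pi/(2k)}$, $i=1,\dots,n$. Moreover, for each $i$ the $k$-sums $\mathcal S_{k,\theta}\hat u$ with $\theta\in(d_i,d_{i+1})$ define one function $u_i$, and for every sufficiently small $\varepsilon>0$ there are $r>0$ and $\rho\in(0,R]$ such that $u_i\in\mathcal O(V_i(\varepsilon,r)\times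 D_\rho)$ for all $i$, where $$V_i(\varepsilon,r)=\Big\{t\in W:\ 0<|t|<r,\ \arg t\in\big(d_i-\tfrac{\pi}{2k}+\tfrac{\varepsilon}{2},\,d_{i+1}+\tfrac{\pi}{2k}-\tfrac{\varepsilon}{2}\big)\bmod 2q\pi\Big\},$$ and $\{u_1,\dots,u_n\}$ is a maximal family of solutions of (1) on $W_r\times D_\rho$. -/

import Mathlib

noncomputable section

open Complex Filter Topology

namespace StokesPDE

/-! ### Sectors

A point `t` of the universal covering of `ℂ ∖ {0}` is represented by its logarithm `w`, so that
`t = exp w`, `|t| = exp (re w)` and `arg t = im w`; holomorphy in `t` is holomorphy in `w`, and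
the rotation `t ↦ t e^{iα}` is `w ↦ w + iα`. -/

/-- The points of the universal covering of `ℂ ∖ {0}` with `|t| < r`. -/
def puncturedDisc (r : ℝ) : Set ℂ := {w | Real.exp w.re < r}

/-- The unbounded sector `S(d, α)`. -/
def unboundedSector (d α : ℝ) : Set ℂ := {w | d - α / 2 < w.im ∧ w.im < d + α / 2}

/-- The sector `S(d, α, r)` in direction `d`, with opening `α` and radius `r`. -/
def sector (d α r : ℝ) : Set ℂ := unboundedSector d α ∩ puncturedDisc r

/-- The half-line `{arg t = φ}`. -/
def argLine (φ : ℝ) : Set ℂ := {w | w.im = φ}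

/-- The disc `D_ρ` in the `z`-plane. -/
abbrev disc (ρ : ℝ) : Set ℂ := Metric.ball 0 ρ

/-- `f ∈ 𝒪(S × D_ρ)`. -/
def HolomorphicOn (S : Set ℂ) (ρ : ℝ) (f : ℂ → ℂ → ℂ) : Prop :=
  DifferentiableOn ℂ (Function.uncurry f) (S ×ˢ disc ρ)

/-! ### The Cauchy problem -/

/-- Data of the Cauchy problem
`∂ₜᵐ u = ∑_{j=1}^{m} ∂ₜ^{m-j} P_j(∂_z) u`, `∂ₜʲ u(0,z) = φ_j(z) ∈ 𝒪(D_R)` for `0 ≤ j < m`.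
The index `j : Fin order` of `P` stands for `P_{j+1}`. -/
structure CauchyProblem where
  /-- the order `m` in `∂ₜ` -/
  order : ℕ
  /-- the polynomials `P_1, …, P_m` -/
  P : Fin order → Polynomial ℂ
  /-- the radius of the disc on which the data are holomorphic -/
  R : ℝ
  R_pos : 0 < R
  /-- the Cauchy data -/
  φ : Fin order → ℂ → ℂ
  holo : ∀ j, DifferentiableOn ℂ (φ j) (disc R)

/-- The operator `p(∂_z)`. -/
def zOp (p : Polynomial ℂ) (h : ℂ → ℂ) (z : ℂ) : ℂ :=
  p.sum fun l c => c * iteratedDeriv l h z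

/-- `∂ₜ` in the coordinate `w = log t`, that is `e^{-w} ∂_w`. -/
def dt (f : ℂ → ℂ → ℂ) : ℂ → ℂ → ℂ :=
  fun w z => exp (-w) * deriv (fun v => f v z) w

/-- `∂ₜ` on formal power series `∑ aₙ(z) tⁿ`, given by their coefficients. -/
def formalDt (a : ℕ → ℂ → ℂ) : ℕ → ℂ → ℂ := fun n z => (n + 1 : ℂ) * a (n + 1) z

namespace CauchyProblem

variable (pb : CauchyProblem)

/-- `P(∂ₜ, ∂_z) f`. -/
def op (f : ℂ → ℂ → ℂ) (w z : ℂ) : ℂ :=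
  (dt^[pb.order] f) w z
    - ∑ j : Fin pb.order, zOp (pb.P j) ((dt^[pb.order - 1 - (j : ℕ)] f) w) z

/-- `û = ∑ aₙ(z) tⁿ ∈ 𝒪(D_R)[[t]]` is a formal power series solution of the Cauchy problem. -/
structure IsFormalSolution (a : ℕ → ℂ → ℂ) : Prop where
  holo : ∀ n, DifferentiableOn ℂ (a n) (disc pb.R)
  eqn : ∀ n, ∀ z ∈ disc pb.R,
    (formalDt^[pb.order] a) n z
      - ∑ j : Fin pb.order, zOp (pb.P j) ((formalDt^[pb.order - 1 - (j : ℕ)] a) n) z = 0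
  init : ∀ j : Fin pb.order, ∀ z ∈ disc pb.R, (formalDt^[(j : ℕ)] a) 0 z = pb.φ j z

/-- `f ∈ 𝒪(S × D_ρ)` is an actual solution of the Cauchy problem on `S × D_ρ`. In the limit
condition, `t → 0` is `re w → -∞`. -/
structure IsActualSolution (S : Set ℂ) (ρ : ℝ) (f : ℂ → ℂ → ℂ) : Prop where
  holo : HolomorphicOn S ρ f
  eqn : ∀ w ∈ S, ∀ z ∈ disc ρ, pb.op f w z = 0
  init : ∀ j : Fin pb.order, ∀ z ∈ disc ρ,
    Tendsto (fun w => (dt^[(j : ℕ)] f) w z) (comap re atBot ⊓ 𝓟 S) (𝓝 (pb.φ j z))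

end CauchyProblem

/-! ### Summability -/

/-- `∑ aₙ(z) tⁿ` is of Gevrey order `s`, uniformly for `z ∈ D_ρ`. -/
def IsGevrey (s : ℝ) (a : ℕ → ℂ → ℂ) (ρ : ℝ) : Prop :=
  ∃ A > 0, ∃ B > 0, ∀ n : ℕ, ∀ z ∈ disc ρ, ‖a n z‖ ≤ A * B ^ n * (n.factorial : ℝ) ^ s

/-- Coefficients of the modified Borel transform of order `k`. -/
def borelCoeff (k : ℝ) (a : ℕ → ℂ → ℂ) (n : ℕ) (z : ℂ) : ℂ :=
  a n z * (n.factorial : ℂ) / (Real.Gamma (1 + n * (1 + 1 / k)) : ℂ)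

/-- `g ∈ 𝒪ᵏ(S(d, ε) × D_ρ)`: holomorphic, and on every proper subsector bounded by
`C₁ exp (C₂ |s|ᵏ)`, uniformly for `z ∈ D_ρ`. (Every proper subsector of `S(d, ε)` lies in some
`S(d, α)` with `α < ε`.) -/
def HasExpGrowth (k d ε ρ : ℝ) (g : ℂ → ℂ → ℂ) : Prop :=
  HolomorphicOn (unboundedSector d ε) ρ g ∧
    ∀ α, 0 < α → α < ε → ∃ C₁ > 0, ∃ C₂ > 0, ∀ w ∈ unboundedSector d α, ∀ z ∈ disc ρ,
      ‖g w z‖ ≤ C₁ * Real.exp (C₂ * Real.exp w.re ^ k)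

/-- `û = ∑ aₙ(z) tⁿ` is of Gevrey order `1/k` on `D_ρ`, and its modified Borel transform of order
`k` (a convergent power series near `s = 0`) continues to `g ∈ 𝒪ᵏ(S(d, ε) × D_ρ)`. -/
structure IsBorelContinuation (k : ℝ) (a : ℕ → ℂ → ℂ) (d ε ρ : ℝ) (g : ℂ → ℂ → ℂ) : Prop where
  gevrey : IsGevrey (1 / k) a ρ
  growth : HasExpGrowth k d ε ρ g
  series : ∃ δ > 0, ∀ w ∈ sector d ε δ, ∀ z ∈ disc ρ,
    HasSum (fun n => borelCoeff k a n z * exp w ^ n) (g w z)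

/-- `û ∈ 𝒪(D_R)[[t]]` is `k`-summable in the direction `d`. The disc `D_ρ` may depend on `d`. -/
def IsSummableIn (k R : ℝ) (a : ℕ → ℂ → ℂ) (d : ℝ) : Prop :=
  ∃ ρ, 0 < ρ ∧ ρ ≤ R ∧ ∃ ε > 0, ∃ g, IsBorelContinuation k a d ε ρ g

/-- `û` is `k`-summable: all directions but finitely many modulo `2π` are nonsingular. -/
def IsSummable (k R : ℝ) (a : ℕ → ℂ → ℂ) : Prop :=
  ((fun d : ℝ => (d : Real.Angle)) '' {d | ¬ IsSummableIn k R a d}).Finite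

/-- `C_α(τ) = ∑ (-τ)ⁿ / (n! Γ(1 - (n+1)/α))`, where `1/Γ = 0` at the poles of `Γ`. -/
def kernelC (α : ℝ) (τ : ℂ) : ℂ :=
  ∑' n : ℕ, (-τ) ^ n / ((n.factorial : ℂ) * (Real.Gamma (1 - (n + 1) / α) : ℂ))

/-- The Ecalle operator
`t^{-κ} ∫_{e^{iθ}ℝ₊} g(s) C_{(k+1)/k}((s/t)^κ) d(s^κ)`, `κ = k/(1+k)`, with `t = exp w`;
the ray is parametrized by `s = exp (x + iθ)`, `x ∈ ℝ`. -/
def ecalle (k θ : ℝ) (g : ℂ → ℂ) (w : ℂ) : ℂ :=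
  let κ : ℂ := (k / (1 + k) : ℝ)
  exp (-κ * w) * ∫ x : ℝ, g (x + θ * I) * kernelC ((k + 1) / k) (exp (κ * (x + θ * I - w)))
    * (κ * exp (κ * (x + θ * I)))

/-- The function `f` on `S` is the `k`-sum `𝒮_{k,d} û`: the set `S` contains the direction `d`
near `0`, and there `f` is given by the Ecalle operator in the direction `d` applied to the Borel
transform of `û`. By analytic continuation this determines a holomorphic `f` on connected `S`. -/
def IsSum (k R : ℝ) (a : ℕ → ℂ → ℂ) (d : ℝ) (S : Set ℂ) (f : ℂ → ℂ → ℂ) : Prop :=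
  ∃ ρ, 0 < ρ ∧ ρ ≤ R ∧ ∃ ε > 0, ∃ g, IsBorelContinuation k a d ε ρ g ∧
    ∃ η > 0, ∃ r > 0, sector d η r ⊆ S ∧
      ∀ w ∈ sector d η r, ∀ z ∈ disc ρ, f w z = ecalle k d (fun s => g s z) w

/-- `L` is a Stokes line for `û`. -/
def IsStokesLine (k R : ℝ) (a : ℕ → ℂ → ℂ) (L : Set ℂ) : Prop :=
  (∃ ρ, 0 < ρ ∧ ρ ≤ R ∧ IsGevrey (1 / k) a ρ) ∧
    ∃ φ : ℝ, L = argLine φ ∧ ¬ IsSummableIn k R a φ ∧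
      ∃ ε > 0, ∀ d, φ - ε < d → d < φ + ε → d ≠ φ → IsSummableIn k R a d

/-- `L` is an anti-Stokes line for `û`. -/
def IsAntiStokesLine (k R : ℝ) (a : ℕ → ℂ → ℂ) (L : Set ℂ) : Prop :=
  ∃ φ : ℝ, IsStokesLine k R a (argLine φ) ∧
    (L = argLine (φ + Real.pi / (2 * k)) ∨ L = argLine (φ - Real.pi / (2 * k)))

/-! ### The Riemann surface of `t^{1/q}` and maximal families -/

/-- The Riemann surface `W` of `t^{1/q}`: the universal covering of `ℂ ∖ {0}` with `t` and
`t e^{2qπi}` identified, so that `t^{1/q}` is an injective holomorphic function on it. -/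
abbrev RootSurface (q : ℚ) : Type :=
  ℂ ⧸ AddSubgroup.zmultiples (2 * (q : ℂ) * (Real.pi : ℂ) * I)

/-- The covering map onto `W`. -/
def toRoot (q : ℚ) (w : ℂ) : RootSurface q := (w : RootSurface q)

/-- A function on `W × ℂ`, read on the universal covering. -/
def pull {q : ℚ} (u : RootSurface q → ℂ → ℂ) : ℂ → ℂ → ℂ := fun w z => u (toRoot q w) z

/-- `V ⊆ W` is a sector with opening `β`: the one-to-one image of a sector of the universal
covering, or a full punctured disc `W_r` (with opening `2qπ`). -/
def IsRootSector (q : ℚ) (V : Set (RootSurface q)) (β : ℝ) : Prop :=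
  ∃ r > 0, (0 < β ∧ β ≤ 2 * q * Real.pi ∧ ∃ d, V = toRoot q '' sector d β r) ∨
    (β = 2 * q * Real.pi ∧ V = toRoot q '' puncturedDisc r)

/-- `{uᵢ}` with `uᵢ ∈ 𝒪(Vᵢ × D_ρ)` is a maximal family of solutions of the Cauchy problem on
`V × D_ρ`, where `V ⊆ W` and `û = ∑ aₙ(z) tⁿ` is the formal solution. -/
structure IsMaximalFamily (pb : CauchyProblem) (k : ℝ) (a : ℕ → ℂ → ℂ) (q : ℚ)
    (V : Set (RootSurface q)) (ρ : ℝ) {ι : Type} [Finite ι]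
    (Vi : ι → Set (RootSurface q)) (u : ι → RootSurface q → ℂ → ℂ) : Prop where
  summable : IsSummable k pb.R a
  domain : ∃ β, Real.pi / k < β ∧ IsRootSector q V β
  sectors : ∀ i, Vi i ⊆ V ∧ ∃ β, Real.pi / k < β ∧ IsRootSector q (Vi i) β
  cover : V ⊆ ⋃ i, Vi i
  solution : ∀ i, pb.IsActualSolution (toRoot q ⁻¹' Vi i) ρ (pull (u i))
  distinct : ∀ i j, i ≠ j → (Vi i ∩ Vi j).Nonempty →
    ∃ t ∈ Vi i ∩ Vi j, ∃ z ∈ disc ρ, u i t z ≠ u j t z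
  maximal : ∀ (V' : Set (RootSurface q)) (u' : RootSurface q → ℂ → ℂ), V' ⊆ V →
    (∃ β, IsRootSector q V' β) →
    pb.IsActualSolution (toRoot q ⁻¹' V') ρ (pull u') →
    (∃ d, IsSummableIn k pb.R a d ∧ IsSum k pb.R a d (toRoot q ⁻¹' V') (pull u')) →
    ∃ i, (V' ∩ Vi i).Nonempty ∧ ∀ t ∈ V' ∩ Vi i, ∀ z ∈ disc ρ, u' t z = u i t z

/-- Invariance under `t ↦ t e^{2qπi}`: the formal series `û` is invariant (automatic if `q` is an
integer), and for every nonsingular direction `d` the `k`-sum `u^d` continues analytically around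
`t = 0` and satisfies `u^d(t e^{2qπi}, z) = u^d(t, z)`. -/
def HasPeriod (k R : ℝ) (a : ℕ → ℂ → ℂ) (q : ℚ) : Prop :=
  (∀ n : ℕ, ∀ z ∈ disc R, a n z * exp (2 * (q : ℂ) * (Real.pi : ℂ) * I) ^ n = a n z) ∧
    ∀ d, IsSummableIn k R a d → ∃ r > 0, ∃ ρ > 0, ∃ f : ℂ → ℂ → ℂ,
      HolomorphicOn (puncturedDisc r) ρ f ∧ IsSum k R a d (puncturedDisc r) f ∧
        ∀ w ∈ puncturedDisc r, ∀ z ∈ disc ρ,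
          f (w + 2 * (q : ℂ) * (Real.pi : ℂ) * I) z = f w z

end StokesPDE

end

/-!
Everything is computed in the coordinate `w = log t` of the universal covering. There the operator
that recovers a series from its modified Borel transform is an integral along a horizontal line
against the translates of the kernel `ecalleKernel k p = κ τ C_{(k+1)/k}(τ)`, with `τ = e^{κp}` and
`κ = k/(1+k)`.

The argument rests on the equivalence of `k`-summability in the direction `d` with the existence of
a holomorphic function that has the Gevrey expansion `û` of order `1/k` in a sector of opening
larger than `π/k` around `d`.

* From the sum to the expansion: Hankel's formula for `1/Γ` (`integral_hankel`) turns the series of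
  `C_α` into a contour integral (`kernelC_eq_integral`). A suitable choice of the contour shows that
  the kernel decays like `exp (-c |t|^k)` for `|arg t| < π/(2k)`, where `t = e^p`
  (`exists_kernel_bound`), and an exchange of integrals gives its moments
  `Γ(1 + n(1 + 1/k))/n!` (`integral_exp_mul_ecalleKernel`). Thus the `k`-sum is holomorphic with the
  Gevrey expansion `û` in a sector of opening larger than `π/k`
  (`IsBorelContinuation.exists_sum`, `IsSum.exists_gevreyBound`).
* From the expansion to the sum: the factors `n!/Γ(1 + n(1 + 1/k))` are moments, along Hankel
  contours, of the entire function `inverseKernel`. Integrating a function against this kernel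
  continues the modified Borel transform of its expansion. Moving the vertices of the contour along
  with the order `N` of the remainder shows that the Taylor series converges to the integral
  (`GevreyBound.isSummableIn`).

A Gevrey expansion can be differentiated and inserted into the equation. By Watson's lemma
(`eq_zero_of_gevreyBound_zero`, a consequence of the Phragmén-Lindelöf principle) a function with
the expansion zero in a sector of opening larger than `π/k` vanishes; hence a function with the
expansion `û` there is a solution (`HasGevreyExpansion.op_eq_zero`), and its expansion contains the
initial conditions (`HasGevreyExpansion.tendsto_dt_iterate`).

Between two consecutive singular directions the directions in which a given function is the
`k`-sum form an open and closed set, so there is one sum `u_i` (`IsSum.of_mem_Ioo`); by compactness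
it has the expansion `û` in every proper subsector of
`d_i - π/(2k) < arg t < d_{i+1} + π/(2k)` (`hasGevreyExpansion_of_isSum`). This
gives the solutions on `V_i`. If `u_i` and `u_j`, `i ≠ j`, agreed on the overlap of their sectors,
one function would have the expansion `û` in the union of the two sectors, which contains a sector
of opening larger than `π/k` around a singular direction between them; by the equivalence above
this direction would not be singular (`isSummableIn_of_overlap`). In the same way, if `2qπ ≤ π/k`,
the sector of `u_i` and its translates by the period would cover all directions, so the opening
`2qπ` of `W_r` exceeds `π/k`. Finally, any solution that is a `k`-sum in a nonsingular direction is
one of the `u_i`, since this direction lies in one of the intervals up to a multiple of the period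
and `k`-sums can be rotated by the period (`IsSum.rotate`). The Stokes and anti-Stokes lines are
read off from the arrangement of the singular directions.
-/

open Complex Filter Topology MeasureTheory Metric Set

namespace StokesPDE

/-! ### Integrals depending on a parameter -/

/-- An integral depending on a parameter in `ℂ²` is holomorphic if the integrand is holomorphic and
locally dominated. The derivative of the integrand is bounded by Cauchy's estimate and measurable
as a limit of difference quotients, so that no joint measurability is required. -/
theorem differentiableOn_integral {X : Type*} [MeasurableSpace X] {μ : Measure X}
    {U : Set (ℂ × ℂ)} (hU : IsOpen U) {F : ℂ × ℂ → X → ℂ}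
    (hd : ∀ x, DifferentiableOn ℂ (fun p => F p x) U)
    (hm : ∀ p ∈ U, AEStronglyMeasurable (F p) μ)
    (hb : ∀ p ∈ U, ∃ r > 0, ∃ b : X → ℝ, Integrable b μ ∧
      ∀ q ∈ ball p r ∩ U, ∀ x, ‖F q x‖ ≤ b x) :
    DifferentiableOn ℂ (fun p => ∫ x, F p x ∂μ) U := by
  intro p hp
  obtain ⟨r₁, hr₁, b, hbi, hb⟩ := hb p hp
  obtain ⟨r₂, hr₂, hU₂⟩ := Metric.isOpen_iff.1 hU p hp
  set r := min r₁ r₂ with hr_def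
  have hr : 0 < r := lt_min hr₁ hr₂
  have hrU : ball p r ⊆ U := (ball_subset_ball (min_le_right _ _)).trans hU₂
  have hrb : ∀ q ∈ ball p r, ∀ x, ‖F q x‖ ≤ b x := fun q hq x =>
    hb q ⟨ball_subset_ball (min_le_left _ _) hq, hrU hq⟩ x
  have hfd : ∀ x, HasFDerivAt (fun q => F q x) (fderiv ℂ (fun q => F q x) p) p := fun x =>
    ((hd x).differentiableAt (hU.mem_nhds hp)).hasFDerivAt
  have hdir : ∀ v : ℂ × ℂ, ‖v‖ ≤ 1 →
      AEStronglyMeasurable (fun x => fderiv ℂ (fun q => F q x) p v) μ := by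
    intro v hv
    set c : ℕ → ℂ := fun n => ((2 / r * (n + 1) : ℝ) : ℂ) with hc
    have hcpos : ∀ n : ℕ, 0 < 2 / r * ((n : ℝ) + 1) := fun n => by positivity
    have hcn : ∀ n, ‖c n‖ = 2 / r * (n + 1) := fun n => by
      simp only [hc]; rw [Complex.norm_real, Real.norm_of_nonneg (hcpos n).le]
    have hlim : Tendsto (fun n => ‖c n‖) atTop atTop := by
      simp only [hcn]
      exact (tendsto_natCast_atTop_atTop.atTop_add tendsto_const_nhds).const_mul_atTop
        (by positivity)
    refine aestronglyMeasurable_of_tendsto_ae (u := atTop)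
      (f := fun n x => c n • (F (p + (c n)⁻¹ • v) x - F p x)) ?_ ?_
    · intro n
      have hmem : p + (c n)⁻¹ • v ∈ U := by
        apply hrU
        rw [mem_ball, dist_eq_norm, add_sub_cancel_left, norm_smul, norm_inv, hcn]
        have h1 : (2 / r * ((n : ℝ) + 1))⁻¹ ≤ r / 2 := by
          rw [mul_inv, inv_div]
          have : ((n : ℝ) + 1)⁻¹ ≤ 1 := inv_le_one_of_one_le₀ (by linarith [n.cast_nonneg (α := ℝ)])
          nlinarith
        calc _ ≤ r / 2 * 1 := mul_le_mul h1 hv (norm_nonneg _) (by positivity)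
          _ < r := by linarith
      exact ((hm _ hmem).sub (hm p hp)).const_smul (c n)
    · exact Eventually.of_forall fun x => (hfd x).lim v hlim
  have hF' : AEStronglyMeasurable (fun x => fderiv ℂ (fun q => F q x) p) μ := by
    have : (fun x => fderiv ℂ (fun q => F q x) p) = fun x =>
        (fderiv ℂ (fun q => F q x) p (1, 0)) • ContinuousLinearMap.fst ℂ ℂ ℂ +
        (fderiv ℂ (fun q => F q x) p (0, 1)) • ContinuousLinearMap.snd ℂ ℂ ℂ := by
      funext x
      ext <;> simp
    rw [this]
    exact ((hdir _ (by simp)).smul_const _).add ((hdir _ (by simp)).smul_const _)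
  refine (hasFDerivAt_integral_of_dominated_loc_of_lip' (ball_mem_nhds p hr)
    (bound := fun x => 2 * b x / r) (fun q hq => hm q (hrU hq))
    (hbi.mono' (hm p hp) (Eventually.of_forall (hrb p (mem_ball_self hr)))) hF' ?_
    ((hbi.const_mul 2).div_const r)
    (Eventually.of_forall hfd)).2.differentiableAt.differentiableWithinAt
  refine Eventually.of_forall fun x q hq => ?_
  have := dist_le_div_mul_dist_of_mapsTo_ball (R₂ := 2 * b x) ((hd x).mono hrU) (fun y hy => ?_) hq
  · rwa [dist_eq_norm, dist_eq_norm] at this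
  · rw [mem_closedBall, dist_eq_norm]
    linarith [norm_sub_le (F y x) (F p x), hrb y hy x, hrb p (mem_ball_self hr) x]

theorem differentiableOn_integral_one {X : Type*} [MeasurableSpace X] {μ : Measure X}
    {U : Set ℂ} (hU : IsOpen U) {F : ℂ → X → ℂ}
    (hd : ∀ x, DifferentiableOn ℂ (fun p => F p x) U)
    (hm : ∀ p ∈ U, AEStronglyMeasurable (F p) μ)
    (hb : ∀ p ∈ U, ∃ r > 0, ∃ b : X → ℝ, Integrable b μ ∧
      ∀ q ∈ ball p r ∩ U, ∀ x, ‖F q x‖ ≤ b x) :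
    DifferentiableOn ℂ (fun p => ∫ x, F p x ∂μ) U := by
  have := differentiableOn_integral (μ := μ) (U := U ×ˢ univ) (hU.prod isOpen_univ)
    (F := fun p => F p.1)
    (fun x => (hd x).comp differentiableOn_fst fun p hp => hp.1) (fun p hp => hm p.1 hp.1) ?_
  · have h2 : DifferentiableOn ℂ (fun p : ℂ => (p, (0 : ℂ))) U := by fun_prop
    exact this.comp h2 fun p hp => ⟨hp, mem_univ _⟩
  · intro p hp
    obtain ⟨r, hr, b, hbi, hb⟩ := hb p.1 hp.1
    refine ⟨r, hr, b, hbi, fun q hq x => hb q.1 ⟨?_, hq.2.1⟩ x⟩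
    rw [← ball_prod_same] at hq
    exact hq.1.1

/-! ### Holomorphic functions of `(w, z)` -/

theorem HolomorphicOn.mono {S S' : Set ℂ} {ρ ρ' : ℝ} {f : ℂ → ℂ → ℂ} (hf : HolomorphicOn S ρ f)
    (hS : S' ⊆ S) (hρ : ρ' ≤ ρ) : HolomorphicOn S' ρ' f :=
  DifferentiableOn.mono hf (prod_mono hS (ball_subset_ball hρ))

theorem HolomorphicOn.fst {S : Set ℂ} {ρ : ℝ} {f : ℂ → ℂ → ℂ} (hf : HolomorphicOn S ρ f)
    {z : ℂ} (hz : z ∈ disc ρ) : DifferentiableOn ℂ (fun w => f w z) S :=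
  DifferentiableOn.comp (g := Function.uncurry f) hf
    (by fun_prop : DifferentiableOn ℂ (fun w : ℂ => (w, z)) S) fun _ hw => ⟨hw, hz⟩

theorem HolomorphicOn.snd {S : Set ℂ} {ρ : ℝ} {f : ℂ → ℂ → ℂ} (hf : HolomorphicOn S ρ f)
    {w : ℂ} (hw : w ∈ S) : DifferentiableOn ℂ (f w) (disc ρ) :=
  DifferentiableOn.comp (g := Function.uncurry f) hf
    (by fun_prop : DifferentiableOn ℂ (fun z : ℂ => (w, z)) (disc ρ)) fun _ hz => ⟨hw, hz⟩

theorem HolomorphicOn.swap {S T : Set ℂ} {f : ℂ → ℂ → ℂ}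
    (hf : DifferentiableOn ℂ (Function.uncurry f) (S ×ˢ T)) :
    DifferentiableOn ℂ (Function.uncurry fun z w => f w z) (T ×ˢ S) :=
  DifferentiableOn.comp (g := Function.uncurry f) hf
    (by fun_prop : DifferentiableOn ℂ (fun p : ℂ × ℂ => (p.2, p.1)) (T ×ˢ S))
    fun _ hp => ⟨hp.2, hp.1⟩

/-- The partial derivatives of a holomorphic function are holomorphic as functions of both
variables. -/
theorem differentiableOn_deriv_fst {S T : Set ℂ} (hS : IsOpen S) (hT : IsOpen T)
    {f : ℂ → ℂ → ℂ} (hf : DifferentiableOn ℂ (Function.uncurry f) (S ×ˢ T)) :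
    DifferentiableOn ℂ (Function.uncurry fun w z => deriv (fun v => f v z) w) (S ×ˢ T) := by
  rintro ⟨w₀, z₀⟩ ⟨hw₀, hz₀⟩
  simp only at hw₀ hz₀
  obtain ⟨R, hR, hRS⟩ := Metric.isOpen_iff.1 hS w₀ hw₀
  set r := R / 2 with hr
  have hr0 : 0 < r := by positivity
  have hcl : ∀ w ∈ ball w₀ r, closedBall w r ⊆ S := fun w hw y hy => hRS <| by
    rw [mem_ball] at *; rw [mem_closedBall] at hy
    linarith [dist_triangle y w w₀]
  -- Cauchy's formula for the derivative, on circles of a fixed radius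
  have key : ∀ p ∈ ball w₀ r ×ˢ T, (Function.uncurry fun w z => deriv (fun v => f v z) w) p =
      (2 * Real.pi * I : ℂ)⁻¹ * ∫ θ in Set.uIoc 0 (2 * Real.pi),
        deriv (circleMap 0 r) θ * (((circleMap 0 r θ) ^ 2)⁻¹ * f (p.1 + circleMap 0 r θ) p.2) := by
    rintro ⟨w, z⟩ ⟨hw, hz⟩
    have hd : DifferentiableOn ℂ (fun v => f v z) S :=
      DifferentiableOn.comp (g := Function.uncurry f) hf
        (by fun_prop : DifferentiableOn ℂ (fun w : ℂ => (w, z)) S) fun _ hw => ⟨hw, hz⟩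
    have := cderiv_eq_deriv hS hd hr0 (hcl w hw)
    simp only [Function.uncurry]
    rw [← this, cderiv, circleIntegral, intervalIntegral.integral_of_le (by positivity),
      uIoc_of_le (by positivity), smul_eq_mul]
    congr 1
    refine integral_congr_ae (Eventually.of_forall fun θ => ?_)
    simp [circleMap]
  have hO : IsOpen (ball w₀ r ×ˢ T) := isOpen_ball.prod hT
  suffices h : DifferentiableOn ℂ (fun p : ℂ × ℂ => ∫ θ in Set.uIoc 0 (2 * Real.pi),
        deriv (circleMap 0 r) θ * (((circleMap 0 r θ) ^ 2)⁻¹ * f (p.1 + circleMap 0 r θ) p.2))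
      (ball w₀ r ×ˢ T) from
    (((h.const_mul _).congr key).differentiableAt
      (hO.mem_nhds ⟨mem_ball_self hr0, hz₀⟩)).differentiableWithinAt
  have hmem : ∀ p ∈ ball w₀ r ×ˢ T, ∀ θ : ℝ, (p.1 + circleMap 0 r θ, p.2) ∈ S ×ˢ T := by
    rintro p ⟨hp1, hp2⟩ θ
    refine ⟨hcl _ hp1 ?_, hp2⟩
    simp [abs_of_pos hr0]
  have hcont : ContinuousOn (fun x : (ℂ × ℂ) × ℝ =>
      deriv (circleMap 0 r) x.2 * (((circleMap 0 r x.2) ^ 2)⁻¹ *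
        f (x.1.1 + circleMap 0 r x.2) x.1.2)) ((ball w₀ r ×ˢ T) ×ˢ univ) := by
    have h1 : Continuous (fun x : (ℂ × ℂ) × ℝ => circleMap 0 r x.2) :=
      (continuous_circleMap 0 r).comp continuous_snd
    have h2 : ContinuousOn (fun x : (ℂ × ℂ) × ℝ => f (x.1.1 + circleMap 0 r x.2) x.1.2)
        ((ball w₀ r ×ˢ T) ×ˢ univ) :=
      ContinuousOn.comp (g := Function.uncurry f) hf.continuousOn
        (f := fun x : (ℂ × ℂ) × ℝ => (x.1.1 + circleMap 0 r x.2, x.1.2))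
        (by fun_prop) fun x hx => hmem x.1 hx.1 x.2
    have h3 : Continuous (fun x : (ℂ × ℂ) × ℝ => ((circleMap 0 r x.2) ^ 2)⁻¹) :=
      (h1.pow 2).inv₀ fun x => by simp [circleMap, hr0.ne']
    have h4 : Continuous (fun x : (ℂ × ℂ) × ℝ => deriv (circleMap 0 r) x.2) := by
      have : deriv (circleMap 0 r) = fun θ => circleMap 0 r θ * I := by
        funext θ; exact deriv_circleMap 0 r θ
      rw [this]; fun_prop
    exact h4.continuousOn.mul (h3.continuousOn.mul h2)
  refine differentiableOn_integral hO (fun θ => ?_) (fun p hp => ?_) (fun p hp => ?_)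
  · refine DifferentiableOn.const_mul (DifferentiableOn.const_mul ?_ _) _
    exact DifferentiableOn.comp (g := Function.uncurry f) hf
      (f := fun p : ℂ × ℂ => (p.1 + circleMap 0 r θ, p.2)) (by fun_prop)
      fun p hp => hmem p hp θ
  · refine (Continuous.aestronglyMeasurable ?_)
    exact hcont.comp_continuous (f := fun θ : ℝ => (p, θ)) (by fun_prop) fun θ => ⟨hp, mem_univ _⟩
  · obtain ⟨s, hs, hsub⟩ := Metric.nhds_basis_closedBall.mem_iff.1 (hO.mem_nhds hp)
    have hcomp : IsCompact (closedBall p s ×ˢ Icc 0 (2 * Real.pi)) :=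
      (isCompact_closedBall p s).prod isCompact_Icc
    obtain ⟨M, hM⟩ := hcomp.exists_bound_of_continuousOn
      (hcont.mono (prod_mono hsub (subset_univ _)))
    have hper : ∀ θ : ℝ, ∃ θ' ∈ Icc 0 (2 * Real.pi), circleMap 0 r θ' = circleMap 0 r θ := by
      intro θ
      obtain ⟨θ', hθ', he⟩ := (periodic_circleMap 0 r).exists_mem_Ico₀ Real.two_pi_pos θ
      exact ⟨θ', ⟨hθ'.1, hθ'.2.le⟩, he.symm⟩
    refine ⟨s, hs, fun _ => M, continuous_const.integrableOn_uIoc, fun q hq θ => ?_⟩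
    obtain ⟨θ', hθ', he⟩ := hper θ
    have := hM (q, θ') ⟨ball_subset_closedBall hq.1, hθ'⟩
    simpa only [deriv_circleMap, he] using this

theorem HolomorphicOn.deriv_fst {S : Set ℂ} (hS : IsOpen S) {ρ : ℝ} {f : ℂ → ℂ → ℂ}
    (hf : HolomorphicOn S ρ f) : HolomorphicOn S ρ fun w z => deriv (fun v => f v z) w :=
  differentiableOn_deriv_fst hS isOpen_ball hf

theorem HolomorphicOn.deriv_snd {S : Set ℂ} (hS : IsOpen S) {ρ : ℝ} {f : ℂ → ℂ → ℂ}
    (hf : HolomorphicOn S ρ f) : HolomorphicOn S ρ fun w z => deriv (f w) z :=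
  HolomorphicOn.swap (differentiableOn_deriv_fst isOpen_ball hS (HolomorphicOn.swap hf))

theorem HolomorphicOn.dt {S : Set ℂ} (hS : IsOpen S) {ρ : ℝ} {f : ℂ → ℂ → ℂ}
    (hf : HolomorphicOn S ρ f) : HolomorphicOn S ρ (dt f) :=
  DifferentiableOn.mul (by fun_prop : DifferentiableOn ℂ (fun p : ℂ × ℂ => exp (-p.1)) _)
    (hf.deriv_fst hS)

theorem HolomorphicOn.dt_iterate {S : Set ℂ} (hS : IsOpen S) {ρ : ℝ} {f : ℂ → ℂ → ℂ}
    (hf : HolomorphicOn S ρ f) (j : ℕ) : HolomorphicOn S ρ (StokesPDE.dt^[j] f) := by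
  induction j with
  | zero => exact hf
  | succ j ih => rw [Function.iterate_succ_apply']; exact ih.dt hS

theorem HolomorphicOn.iteratedDeriv_snd {S : Set ℂ} (hS : IsOpen S) {ρ : ℝ} {f : ℂ → ℂ → ℂ}
    (hf : HolomorphicOn S ρ f) (l : ℕ) : HolomorphicOn S ρ fun w z => iteratedDeriv l (f w) z := by
  induction l with
  | zero => simpa using hf
  | succ l ih => simp only [iteratedDeriv_succ]; exact ih.deriv_snd hS

theorem HolomorphicOn.op {pb : CauchyProblem} {S : Set ℂ} (hS : IsOpen S) {ρ : ℝ}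
    {f : ℂ → ℂ → ℂ} (hf : HolomorphicOn S ρ f) : HolomorphicOn S ρ (pb.op f) := by
  unfold HolomorphicOn CauchyProblem.op zOp
  refine DifferentiableOn.sub (hf.dt_iterate hS _) ?_
  simp only [Polynomial.sum]
  refine DifferentiableOn.fun_sum fun j _ => DifferentiableOn.fun_sum fun l _ => ?_
  exact ((hf.dt_iterate hS _).iteratedDeriv_snd hS l).const_mul _

/-! ### Identity theorems -/

theorem isOpen_puncturedDisc (r : ℝ) : IsOpen (puncturedDisc r) :=
  isOpen_lt (by fun_prop) continuous_const

theorem isOpen_unboundedSector (d α : ℝ) : IsOpen (unboundedSector d α) :=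
  (isOpen_lt continuous_const continuous_im).inter (isOpen_lt continuous_im continuous_const)

theorem isOpen_sector (d α r : ℝ) : IsOpen (sector d α r) :=
  (isOpen_unboundedSector d α).inter (isOpen_puncturedDisc r)

theorem mem_puncturedDisc_iff {r : ℝ} (hr : 0 < r) {w : ℂ} :
    w ∈ puncturedDisc r ↔ w.re < Real.log r := (Real.lt_log_iff_exp_lt hr).symm

theorem convex_puncturedDisc {r : ℝ} (hr : 0 < r) : Convex ℝ (puncturedDisc r) := by
  have : puncturedDisc r = {w | w.re < Real.log r} := by
    ext w; exact mem_puncturedDisc_iff hr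
  rw [this]; exact convex_halfSpace_re_lt _

theorem convex_unboundedSector (d α : ℝ) : Convex ℝ (unboundedSector d α) :=
  (convex_halfSpace_im_gt _).inter (convex_halfSpace_im_lt _)

theorem convex_sector (d α : ℝ) {r : ℝ} (hr : 0 < r) : Convex ℝ (sector d α r) :=
  (convex_unboundedSector d α).inter (convex_puncturedDisc hr)

theorem eqOn_of_eqOn_open {f g : ℂ → ℂ} {U V : Set ℂ} (hU : IsOpen U) (hUc : Convex ℝ U)
    (hf : DifferentiableOn ℂ f U) (hg : DifferentiableOn ℂ g U) (hV : IsOpen V)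
    (hne : (U ∩ V).Nonempty) (h : EqOn f g (U ∩ V)) : EqOn f g U := by
  obtain ⟨x, hxU, hxV⟩ := hne
  refine (hf.analyticOnNhd hU).eqOn_of_preconnected_of_eventuallyEq (hg.analyticOnNhd hU)
    hUc.isPreconnected hxU ?_
  filter_upwards [(hU.inter hV).mem_nhds ⟨hxU, hxV⟩] with y hy using h hy

theorem HolomorphicOn.eq_of_eqOn {f g : ℂ → ℂ → ℂ} {S V : Set ℂ} {ρ ρ' : ℝ} (hS : IsOpen S)
    (hSc : Convex ℝ S) (hf : HolomorphicOn S ρ f) (hg : HolomorphicOn S ρ g) (hV : IsOpen V)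
    (hne : (S ∩ V).Nonempty) (hρ : 0 < ρ) (hρ' : 0 < ρ')
    (h : ∀ w ∈ S ∩ V, ∀ z ∈ disc (min ρ ρ'), f w z = g w z) :
    ∀ w ∈ S, ∀ z ∈ disc ρ, f w z = g w z := by
  intro w hw
  refine eqOn_of_eqOn_open isOpen_ball (convex_ball 0 ρ) (hf.snd hw) (hg.snd hw)
    (V := disc (min ρ ρ')) isOpen_ball ⟨0, by simp [hρ, hρ']⟩ fun z hz => ?_
  exact eqOn_of_eqOn_open hS hSc (hf.fst hz.1) (hg.fst hz.1) hV hne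
    (fun w hw => h w hw z hz.2) hw

/-! ### Doubly exponential decay on the real line -/

theorem integrable_exp_neg_abs : Integrable fun x : ℝ => Real.exp (-|x|) := by
  refine (integrable_inv_one_add_sq.const_mul 2).mono' (by fun_prop)
    (Eventually.of_forall fun x => ?_)
  rw [Real.norm_of_nonneg (Real.exp_pos _).le, Real.exp_neg, ← div_eq_mul_inv,
    inv_le_comm₀ (Real.exp_pos _) (by positivity), inv_div]
  have := Real.quadratic_le_exp_of_nonneg (abs_nonneg x)
  nlinarith [sq_abs x, abs_nonneg x]

theorem exists_le_sub_abs (a x₀ : ℝ) {c k : ℝ} (hc : 0 < c) (hk : 0 < k) :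
    ∃ M, ∀ x, x₀ ≤ x → a * x - c * Real.exp (k * x) ≤ M - |x| := by
  refine ⟨(|a| + 1) * |x₀| + (|a| + 1) ^ 2 / (c * k ^ 2), fun x hx => ?_⟩
  have hE := Real.exp_pos (k * x)
  have h2 : 0 ≤ (|a| + 1) ^ 2 / (c * k ^ 2) := by positivity
  have h3 : a * x ≤ |a| * |x| := by rw [← abs_mul]; exact le_abs_self _
  rcases le_total 0 x with h0 | h0
  · have h1 := Real.quadratic_le_exp_of_nonneg (by positivity : 0 ≤ k * x)
    have h4 : (|a| + 1) * x - c * (k * x) ^ 2 / 2 ≤ (|a| + 1) ^ 2 / (c * k ^ 2) := by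
      rw [le_div_iff₀ (by positivity)]
      nlinarith [sq_nonneg ((|a| + 1) - c * k ^ 2 * x), sq_nonneg (|a| + 1)]
    rw [abs_of_nonneg h0] at *
    have h5 : c * (k * x) ^ 2 / 2 ≤ c * Real.exp (k * x) := by
      have : (k * x) ^ 2 / 2 ≤ Real.exp (k * x) := by nlinarith [mul_nonneg hk.le h0]
      nlinarith
    have : 0 ≤ (|a| + 1) * |x₀| := by positivity
    nlinarith
  · have h1 : |x| ≤ |x₀| := by
      rw [abs_of_nonpos h0, abs_of_nonpos (hx.trans h0)]; linarith
    nlinarith [mul_pos hc hE, abs_nonneg a]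

theorem integrable_exp_sub_exp {a c k : ℝ} (ha : 0 < a) (hc : 0 < c) (hk : 0 < k) :
    Integrable fun x : ℝ => Real.exp (a * x - c * Real.exp (k * x)) := by
  obtain ⟨M, hM⟩ := exists_le_sub_abs (a / min a 1) 0 hc (by positivity : 0 < k / min a 1)
  have hm : 0 < min a 1 := lt_min ha one_pos
  have hi : Integrable fun x : ℝ => Real.exp (max M 0) * Real.exp (-|min a 1 * x|) :=
    (integrable_exp_neg_abs.comp_mul_left' hm.ne').const_mul _
  refine hi.mono' (by fun_prop) (Eventually.of_forall fun x => ?_)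
  rw [Real.norm_of_nonneg (Real.exp_pos _).le, ← Real.exp_add, Real.exp_le_exp]
  rcases le_total 0 x with h0 | h0
  · have := hM (min a 1 * x) (by positivity)
    rw [show a / min a 1 * (min a 1 * x) = a * x by field_simp,
      show k / min a 1 * (min a 1 * x) = k * x by field_simp] at this
    linarith [le_max_left M 0]
  · rw [abs_mul, abs_of_pos hm, abs_of_nonpos h0]
    nlinarith [min_le_left a 1, le_max_right M 0, mul_pos hc (Real.exp_pos (k * x))]

/-! ### Shifting horizontal lines of integration -/

theorem exists_lt_of_integrableOn_Ioi {b : ℝ → ℝ} {x₀ : ℝ} (hb : IntegrableOn b (Ioi x₀))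
    {ε : ℝ} (hε : 0 < ε) (T₀ : ℝ) : ∃ T > T₀, b T < ε := by
  by_contra! h
  have h1 : IntegrableOn b (Ioi (max x₀ T₀)) := hb.mono_set (Ioi_subset_Ioi (le_max_left _ _))
  have h2 : IntegrableOn (fun _ : ℝ => ε) (Ioi (max x₀ T₀)) := by
    refine Integrable.mono' h1 (by fun_prop) ?_
    refine (ae_restrict_iff' measurableSet_Ioi).2 (Eventually.of_forall fun x hx => ?_)
    rw [Real.norm_of_nonneg hε.le]
    exact h x ((le_max_right _ _).trans_lt hx)
  rw [integrableOn_const_iff] at h2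
  simp [hε.ne'] at h2

/-- Cauchy's theorem for a half-strip that extends to `+∞`. -/
theorem integral_Ioi_sub_integral_Ioi {G : ℂ → ℂ} {x₀ φ₁ φ₂ : ℝ} (h : φ₁ ≤ φ₂)
    (hG : DifferentiableOn ℂ G (Ici x₀ ×ℂ Icc φ₁ φ₂)) {b : ℝ → ℝ} (hb : IntegrableOn b (Ioi x₀))
    (hGb : ∀ x ≥ x₀, ∀ y ∈ Icc φ₁ φ₂, ‖G (x + y * I)‖ ≤ b x) :
    (∫ x in Ioi x₀, G (x + φ₁ * I)) - (∫ x in Ioi x₀, G (x + φ₂ * I)) =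
      I * ∫ y in φ₁..φ₂, G (x₀ + y * I) := by
  have hint : ∀ y ∈ Icc φ₁ φ₂, IntegrableOn (fun x : ℝ => G (x + y * I)) (Ioi x₀) := by
    intro y hy
    refine Integrable.mono' hb (ContinuousOn.aestronglyMeasurable ?_ measurableSet_Ioi) ?_
    · refine hG.continuousOn.comp (by fun_prop) fun x hx => ?_
      simpa [mem_reProdIm] using ⟨le_of_lt hx, hy⟩
    · exact (ae_restrict_iff' measurableSet_Ioi).2
        (Eventually.of_forall fun x hx => hGb x (le_of_lt hx) y hy)
  have h1 := intervalIntegral_tendsto_integral_Ioi x₀ (hint φ₁ ⟨le_rfl, h⟩) tendsto_id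
  have h2 := intervalIntegral_tendsto_integral_Ioi x₀ (hint φ₂ ⟨h, le_rfl⟩) tendsto_id
  have h3 := (h1.sub h2).sub_const (I * ∫ y in φ₁..φ₂, G (x₀ + y * I))
  rw [← sub_eq_zero]
  refine norm_le_zero_iff.1 (le_of_forall_pos_lt_add fun ε hε => ?_)
  have h4 := Metric.tendsto_atTop.1 h3 (ε / 2) (by positivity)
  obtain ⟨T₀, hT₀⟩ := h4
  obtain ⟨T, hT, hTb⟩ := exists_lt_of_integrableOn_Ioi hb
    (by positivity : 0 < ε / 2 / (|φ₂ - φ₁| + 1)) (max x₀ T₀)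
  have hTx : x₀ ≤ T := (le_max_left _ _).trans hT.le
  have h5 := hT₀ T ((le_max_right _ _).trans hT.le)
  have hrect := integral_boundary_rect_eq_zero_of_differentiableOn G (x₀ + φ₁ * I) (T + φ₂ * I)
    (hG.mono (by
      simp only [add_re, ofReal_re, mul_re, I_re, mul_zero, ofReal_im, I_im, mul_one, sub_self,
        add_zero, add_im, mul_im, zero_add]
      rw [uIcc_of_le hTx, uIcc_of_le h]
      exact fun z hz => ⟨hz.1.1, hz.2⟩))
  simp only [add_re, ofReal_re, mul_re, I_re, mul_zero, ofReal_im, I_im, mul_one, sub_self,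
        add_zero, add_im, mul_im, zero_add, smul_eq_mul] at hrect
  have h6 : ‖∫ y in φ₁..φ₂, G (T + y * I)‖ ≤ ε / 2 / (|φ₂ - φ₁| + 1) * |φ₂ - φ₁| := by
    refine intervalIntegral.norm_integral_le_of_norm_le_const fun y hy => ?_
    rw [uIoc_of_le h] at hy
    exact (hGb T hTx y ⟨hy.1.le, hy.2⟩).trans hTb.le
  have h7 : ε / 2 / (|φ₂ - φ₁| + 1) * |φ₂ - φ₁| ≤ ε / 2 := by
    rw [div_mul_eq_mul_div, div_le_iff₀ (by positivity)]
    nlinarith [abs_nonneg (φ₂ - φ₁)]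
  have h8 : (∫ x in x₀..T, G (x + φ₁ * I)) - (∫ x in x₀..T, G (x + φ₂ * I)) -
      I * ∫ y in φ₁..φ₂, G (x₀ + y * I) = -(I * ∫ y in φ₁..φ₂, G (T + y * I)) := by
    linear_combination hrect
  simp only [id] at h5
  rw [h8] at h5
  rw [dist_eq_norm] at h5
  set L := (∫ x in Ioi x₀, G (x + φ₁ * I)) - (∫ x in Ioi x₀, G (x + φ₂ * I)) -
      I * ∫ y in φ₁..φ₂, G (x₀ + y * I)
  have h9 : ‖L‖ ≤ ‖-(I * ∫ y in φ₁..φ₂, G (T + y * I)) - L‖ +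
      ‖∫ y in φ₁..φ₂, G (T + y * I)‖ := by
    have : ‖L‖ = ‖-(I * ∫ y in φ₁..φ₂, G (T + y * I)) -
      (-(I * ∫ y in φ₁..φ₂, G (T + y * I)) - L)‖ := by congr 1; ring
    rw [this]
    refine (norm_sub_le _ _).trans_eq ?_
    rw [norm_neg, norm_mul, norm_I, one_mul, add_comm]
  linarith

/-- Cauchy's theorem for a half-strip that extends to `-∞`. -/
theorem integral_Iic_sub_integral_Iic {G : ℂ → ℂ} {x₀ φ₁ φ₂ : ℝ} (h : φ₁ ≤ φ₂)
    (hG : DifferentiableOn ℂ G (Iic x₀ ×ℂ Icc φ₁ φ₂)) {b : ℝ → ℝ} (hb : IntegrableOn b (Iic x₀))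
    (hGb : ∀ x ≤ x₀, ∀ y ∈ Icc φ₁ φ₂, ‖G (x + y * I)‖ ≤ b x) :
    (∫ x in Iic x₀, G (x + φ₂ * I)) - (∫ x in Iic x₀, G (x + φ₁ * I)) =
      I * ∫ y in φ₁..φ₂, G (x₀ + y * I) := by
  have key := integral_Ioi_sub_integral_Ioi (G := fun v => G (-v)) (x₀ := -x₀) (φ₁ := -φ₂)
    (φ₂ := -φ₁) (by linarith) ?_ (b := fun x => b (-x)) ?_ ?_
  · have e : ∀ φ : ℝ, ∫ x in Ioi (-x₀), G (-(x + (-φ : ℝ) * I)) = ∫ x in Iic x₀, G (x + φ * I) := by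
      intro φ
      have := integral_comp_neg_Ioi (-x₀) (fun x : ℝ => G (x + φ * I))
      rw [neg_neg] at this
      rw [← this]
      congr 1; ext x; push_cast; ring_nf
    rw [e, e] at key
    rw [key]
    congr 1
    have := intervalIntegral.integral_comp_neg (a := -φ₂) (b := -φ₁)
      (fun y : ℝ => G (x₀ + y * I))
    rw [neg_neg, neg_neg] at this
    rw [← this]
    congr 1; ext y; push_cast; ring_nf
  · refine hG.comp (by fun_prop) fun v hv => ?_
    simp only [mem_reProdIm, mem_Ici, mem_Icc, mem_Iic, neg_re, neg_im] at hv ⊢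
    exact ⟨by linarith, by linarith, by linarith⟩
  · have := hb.comp_neg
    rwa [neg_Iic, integrableOn_Ici_iff_integrableOn_Ioi] at this
  · intro x hx y hy
    have := hGb (-x) (by linarith) (-y) ⟨by linarith [hy.2], by linarith [hy.1]⟩
    push_cast at this
    rwa [neg_add, ← neg_mul]

/-- A horizontal line of integration may be moved within a strip in which the integrand has an
integrable bound. -/
theorem integral_line_eq_integral_line {G : ℂ → ℂ} {φ₁ φ₂ : ℝ} (h : φ₁ ≤ φ₂)
    (hG : DifferentiableOn ℂ G {v | v.im ∈ Icc φ₁ φ₂}) {b : ℝ → ℝ} (hb : Integrable b)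
    (hGb : ∀ x : ℝ, ∀ y ∈ Icc φ₁ φ₂, ‖G (x + y * I)‖ ≤ b x) :
    ∫ x : ℝ, G (x + φ₁ * I) = ∫ x : ℝ, G (x + φ₂ * I) := by
  have hint : ∀ y ∈ Icc φ₁ φ₂, Integrable (fun x : ℝ => G (x + y * I)) := by
    intro y hy
    refine hb.mono' (Continuous.aestronglyMeasurable ?_) (Eventually.of_forall fun x => hGb x y hy)
    exact hG.continuousOn.comp_continuous (by fun_prop) fun x => by simpa using hy
  have h1 := integral_Ioi_sub_integral_Ioi (x₀ := 0) h (hG.mono fun v hv => hv.2)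
    (hb.integrableOn) fun x _ => hGb x
  have h2 := integral_Iic_sub_integral_Iic (x₀ := 0) h (hG.mono fun v hv => hv.2)
    (hb.integrableOn) fun x _ => hGb x
  rw [← intervalIntegral.integral_Iic_add_Ioi (b := 0) (hint φ₁ ⟨le_rfl, h⟩).integrableOn
    (hint φ₁ ⟨le_rfl, h⟩).integrableOn,
    ← intervalIntegral.integral_Iic_add_Ioi (b := 0) (hint φ₂ ⟨h, le_rfl⟩).integrableOn
    (hint φ₂ ⟨h, le_rfl⟩).integrableOn]
  linear_combination h1 - h2

theorem integral_exp_smul_comp_exp (g : ℝ → ℝ) :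
    ∫ x : ℝ, Real.exp x * g (Real.exp x) = ∫ y in Ioi (0 : ℝ), g y := by
  have h := integral_image_eq_integral_abs_deriv_smul MeasurableSet.univ
      (fun x _ ↦ (Real.hasDerivAt_exp x).hasDerivWithinAt)
      (fun x _ y _ hxy ↦ Real.exp_injective hxy) g
  rw [image_univ, Real.range_exp] at h
  simpa [abs_of_pos (Real.exp_pos _)] using h.symm

theorem integral_exp_sub_exp {s : ℝ} (hs : 0 < s) :
    ∫ x : ℝ, Real.exp (s * x - Real.exp x) = Real.Gamma s := by
  rw [Real.Gamma_eq_integral hs, ← integral_exp_smul_comp_exp]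
  congr 1; ext x
  rw [← Real.exp_mul, ← Real.exp_add, ← Real.exp_add]
  congr 1; ring

/-! ### Hankel contours -/

/-- The imaginary part of `hankelPath`: the parameter clamped to `[φm, φp]`. -/
def hankelIm (φm φp y : ℝ) : ℝ := max φm (min y φp)

/-- The real part of `hankelPath`: it equals `x₀` on the vertical segment and grows with slope `1`
on both sides of it. -/
def hankelRe (x₀ φm φp y : ℝ) : ℝ := x₀ + |y - hankelIm φm φp y|

/-- The contour from `+∞ + iφm` to `x₀ + iφm`, up to `x₀ + iφp` and back to `+∞ + iφp`, parametrised
by arc length. Its image under `exp` is a Hankel contour around the origin. -/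
def hankelPath (x₀ φm φp y : ℝ) : ℂ := hankelRe x₀ φm φp y + hankelIm φm φp y * I

/-- The derivative of `hankelPath` away from the corners. -/
noncomputable def hankelDir (φm φp y : ℝ) : ℂ := if y < φm then -1 else if y ≤ φp then I else 1

section hankel

variable {x₀ φm φp : ℝ}

@[simp] theorem hankelPath_re (y : ℝ) : (hankelPath x₀ φm φp y).re = hankelRe x₀ φm φp y := by
  simp [hankelPath]

@[simp] theorem hankelPath_im (y : ℝ) : (hankelPath x₀ φm φp y).im = hankelIm φm φp y := by
  simp [hankelPath]

@[fun_prop] theorem continuous_hankelIm : Continuous (hankelIm φm φp) := by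
  unfold hankelIm; fun_prop

@[fun_prop] theorem continuous_hankelRe : Continuous (hankelRe x₀ φm φp) := by
  unfold hankelRe; fun_prop

@[fun_prop] theorem continuous_hankelPath : Continuous (hankelPath x₀ φm φp) := by
  unfold hankelPath; fun_prop

@[fun_prop] theorem measurable_hankelDir : Measurable (hankelDir φm φp) := by
  unfold hankelDir
  exact Measurable.ite measurableSet_Iio measurable_const
    (Measurable.ite measurableSet_Iic measurable_const measurable_const)

theorem norm_hankelDir (y : ℝ) : ‖hankelDir φm φp y‖ = 1 := by
  unfold hankelDir; split_ifs <;> simp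

theorem le_hankelRe (y : ℝ) : x₀ ≤ hankelRe x₀ φm φp y := by
  unfold hankelRe; linarith [abs_nonneg (y - hankelIm φm φp y)]

theorem hankelIm_mem (h : φm ≤ φp) (y : ℝ) : hankelIm φm φp y ∈ Icc φm φp :=
  ⟨le_max_left _ _, max_le h (min_le_right _ _)⟩

theorem hankelPath_of_lt (h : φm ≤ φp) {y : ℝ} (hy : y < φm) :
    hankelPath x₀ φm φp y = ((x₀ + φm - y : ℝ) : ℂ) + φm * I := by
  have : hankelIm φm φp y = φm := by
    unfold hankelIm; rw [min_eq_left (hy.le.trans h), max_eq_left hy.le]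
  rw [hankelPath, hankelRe, this, abs_of_neg (by linarith)]
  congr 2; ring

theorem hankelPath_of_mem {y : ℝ} (hy : y ∈ Icc φm φp) :
    hankelPath x₀ φm φp y = x₀ + y * I := by
  have : hankelIm φm φp y = y := by
    unfold hankelIm; rw [min_eq_left hy.2, max_eq_right hy.1]
  rw [hankelPath, hankelRe, this]; simp

theorem hankelPath_of_gt (h : φm ≤ φp) {y : ℝ} (hy : φp < y) :
    hankelPath x₀ φm φp y = ((x₀ - φp + y : ℝ) : ℂ) + φp * I := by
  have : hankelIm φm φp y = φp := by
    unfold hankelIm; rw [min_eq_right hy.le, max_eq_right h]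
  rw [hankelPath, hankelRe, this, abs_of_pos (by linarith)]
  congr 2; ring

theorem integral_hankelPath (h : φm ≤ φp) {G : ℂ → ℂ}
    (hG : Integrable fun y => G (hankelPath x₀ φm φp y) * hankelDir φm φp y) :
    ∫ y, G (hankelPath x₀ φm φp y) * hankelDir φm φp y =
      (∫ x in Ioi x₀, G (x + φp * I)) - (∫ x in Ioi x₀, G (x + φm * I)) +
        I * ∫ y in φm..φp, G (x₀ + y * I) := by
  set F : ℝ → ℂ := fun y => G (hankelPath x₀ φm φp y) * hankelDir φm φp y with hF
  have e1 : ∫ y in Iic φm, F y = -∫ x in Ioi x₀, G (x + φm * I) := by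
    rw [integral_Iic_eq_integral_Iio, ← integral_neg]
    have h1 : ∫ y in Iio φm, F y =
        ∫ y in Iio φm, (fun x : ℝ => -G (x + φm * I)) (x₀ + φm - y) := by
      refine setIntegral_congr_fun measurableSet_Iio fun y hy => ?_
      simp only [hF]
      rw [hankelPath_of_lt h hy, hankelDir, if_pos (mem_Iio.1 hy)]
      push_cast; ring
    rw [h1, ← integral_Iic_eq_integral_Iio]
    have h2 := integral_comp_neg_Iic φm (fun y : ℝ => (fun x : ℝ => -G (x + φm * I)) (x₀ + φm + y))
    simp only [← sub_eq_add_neg] at h2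
    rw [h2]
    have h3 := (measurePreserving_add_left (volume : Measure ℝ) (x₀ + φm)).setIntegral_preimage_emb
      (measurableEmbedding_addLeft _) (fun x : ℝ => -G (x + φm * I)) (Ioi x₀)
    rw [← h3]
    congr 2
    ext x; simp only [mem_Ioi, mem_preimage]; constructor <;> intro _ <;> linarith
  have e2 : ∫ y in φm..φp, F y = I * ∫ y in φm..φp, G (x₀ + y * I) := by
    rw [← intervalIntegral.integral_const_mul]
    refine intervalIntegral.integral_congr fun y hy => ?_
    rw [uIcc_of_le h] at hy
    simp only [hF]
    rw [hankelPath_of_mem hy, hankelDir, if_neg (not_lt.2 hy.1), if_pos hy.2, mul_comm]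
  have e3 : ∫ y in Ioi φp, F y = ∫ x in Ioi x₀, G (x + φp * I) := by
    have h1 : ∫ y in Ioi φp, F y =
        ∫ y in Ioi φp, (fun x : ℝ => G (x + φp * I)) (x₀ - φp + y) := by
      refine setIntegral_congr_fun measurableSet_Ioi fun y hy => ?_
      simp only [hF]
      rw [hankelPath_of_gt h hy, hankelDir, if_neg (not_lt.2 (h.trans (le_of_lt hy))),
        if_neg (not_le.2 hy), mul_one]
    rw [h1]
    have h3 := (measurePreserving_add_left (volume : Measure ℝ) (x₀ - φp)).setIntegral_preimage_emb
      (measurableEmbedding_addLeft _) (fun x : ℝ => G (x + φp * I)) (Ioi x₀)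
    rw [← h3]
    congr 2
    ext x; simp only [mem_Ioi, mem_preimage]; constructor <;> intro _ <;> linarith
  have e4 := intervalIntegral.integral_Iic_sub_Iic (a := φm) (b := φp) hG.integrableOn
    hG.integrableOn
  rw [← intervalIntegral.integral_Iic_add_Ioi (b := φp) hG.integrableOn hG.integrableOn, e3]
  linear_combination e1 + e2 + e4

theorem integrable_exp_neg_hankelRe (h : φm ≤ φp) :
    Integrable fun y => Real.exp (-|hankelRe x₀ φm φp y|) := by
  refine (integrable_exp_neg_abs.const_mul (Real.exp (|x₀| + |φm| + |φp|))).mono' (by fun_prop)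
    (Eventually.of_forall fun y => ?_)
  rw [Real.norm_of_nonneg (Real.exp_pos _).le, ← Real.exp_add, Real.exp_le_exp]
  have h1 : |hankelIm φm φp y| ≤ |φm| + |φp| := by
    obtain ⟨ha, hb⟩ := hankelIm_mem h y
    rw [abs_le]
    constructor
    · linarith [neg_abs_le φm, abs_nonneg φp]
    · linarith [le_abs_self φp, abs_nonneg φm]
  have h2 : |y - hankelIm φm φp y| - |x₀| ≤ |hankelRe x₀ φm φp y| := by
    unfold hankelRe
    linarith [le_abs_self (x₀ + |y - hankelIm φm φp y|), neg_abs_le x₀]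
  have h3 : |y| ≤ |y - hankelIm φm φp y| + |hankelIm φm φp y| := by
    simpa using abs_add_le (y - hankelIm φm φp y) (hankelIm φm φp y)
  linarith

theorem integrable_exp_hankelRe (h : φm ≤ φp) (a : ℝ) {c k : ℝ} (hc : 0 < c) (hk : 0 < k) :
    Integrable fun y => Real.exp (a * hankelRe x₀ φm φp y -
      c * Real.exp (k * hankelRe x₀ φm φp y)) := by
  obtain ⟨M, hM⟩ := exists_le_sub_abs a x₀ hc hk
  refine ((integrable_exp_neg_hankelRe (x₀ := x₀) h).const_mul (Real.exp M)).mono' (by fun_prop)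
    (Eventually.of_forall fun y => ?_)
  rw [Real.norm_of_nonneg (Real.exp_pos _).le, ← Real.exp_add, Real.exp_le_exp]
  linarith [hM _ (le_hankelRe (x₀ := x₀) (φm := φm) (φp := φp) y)]

/-- The real part of `exp` tends exponentially to `-∞` along the two ends of the contour. -/
theorem re_exp_hankelPath_le {c : ℝ} (hc0 : 0 ≤ c) (h : φm ≤ φp) (hm : Real.cos φm ≤ -c)
    (hp : Real.cos φp ≤ -c) (y : ℝ) :
    (exp (hankelPath x₀ φm φp y)).re ≤
      (1 + c) * Real.exp x₀ - c * Real.exp (hankelRe x₀ φm φp y) := by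
  rw [exp_re, hankelPath_re, hankelPath_im]
  have hE := Real.exp_pos (hankelRe x₀ φm φp y)
  have hE0 := Real.exp_pos x₀
  rcases lt_or_ge y φm with h1 | h1
  · have : hankelIm φm φp y = φm := by
      unfold hankelIm; rw [min_eq_left (h1.le.trans h), max_eq_left h1.le]
    rw [this]
    nlinarith
  · rcases lt_or_ge φp y with h2 | h2
    · have : hankelIm φm φp y = φp := by
        unfold hankelIm; rw [min_eq_right h2.le, max_eq_right h]
      rw [this]
      nlinarith
    · have : hankelRe x₀ φm φp y = x₀ := by
        unfold hankelRe hankelIm; rw [min_eq_left h2, max_eq_right h1]; simp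
      rw [this]
      nlinarith [Real.cos_le_one (hankelIm φm φp y)]

theorem norm_exp_hankel_le {c : ℝ} (hc0 : 0 ≤ c) (h : φm ≤ φp) (hm : Real.cos φm ≤ -c)
    (hp : Real.cos φp ≤ -c) (ν y : ℝ) :
    ‖exp (exp (hankelPath x₀ φm φp y) - ν * hankelPath x₀ φm φp y)‖ ≤
      Real.exp ((1 + c) * Real.exp x₀) * Real.exp (-ν * hankelRe x₀ φm φp y -
        c * Real.exp (1 * hankelRe x₀ φm φp y)) := by
  rw [norm_exp, ← Real.exp_add, Real.exp_le_exp, sub_re, re_ofReal_mul, hankelPath_re, one_mul]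
  linarith [re_exp_hankelPath_le (x₀ := x₀) hc0 h hm hp y]

theorem integrable_hankel {c : ℝ} (hc0 : 0 < c) (h : φm ≤ φp) (hm : Real.cos φm ≤ -c)
    (hp : Real.cos φp ≤ -c) (ν : ℝ) :
    Integrable fun y => exp (exp (hankelPath x₀ φm φp y) - ν * hankelPath x₀ φm φp y) *
      hankelDir φm φp y := by
  refine ((integrable_exp_hankelRe (x₀ := x₀) h (-ν) hc0 one_pos).const_mul
    (Real.exp ((1 + c) * Real.exp x₀))).mono'
    (Continuous.aestronglyMeasurable (by fun_prop) |>.mul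
      measurable_hankelDir.aestronglyMeasurable) (Eventually.of_forall fun y => ?_)
  rw [norm_mul, norm_hankelDir, mul_one]
  exact norm_exp_hankel_le hc0.le h hm hp ν y

theorem integrableOn_exp_sub_exp (a x₀ : ℝ) {c k : ℝ} (hc : 0 < c) (hk : 0 < k) :
    IntegrableOn (fun x : ℝ => Real.exp (a * x - c * Real.exp (k * x))) (Ioi x₀) := by
  obtain ⟨M, hM⟩ := exists_le_sub_abs a x₀ hc hk
  refine (integrable_exp_neg_abs.const_mul (Real.exp M)).integrableOn.mono' (by fun_prop)
    ((ae_restrict_iff' measurableSet_Ioi).2 (Eventually.of_forall fun x hx => ?_))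
  rw [Real.norm_of_nonneg (Real.exp_pos _).le, ← Real.exp_add, Real.exp_le_exp]
  linarith [hM x (le_of_lt hx)]

theorem norm_exp_hankel_line (ν x y : ℝ) :
    ‖exp (exp (x + y * I) - ν * (x + y * I))‖ =
      Real.exp (Real.exp x * Real.cos y - ν * x) := by
  rw [norm_exp, sub_re, exp_re, re_ofReal_mul]
  simp

/-- The ends of the contour may be opened to the lines `Im v = ±π`. -/
theorem integral_hankel_eq_pi {c : ℝ} (hc : 0 < c) (hm : Real.cos φm ≤ -c)
    (hp : Real.cos φp ≤ -c) (hm' : φm ∈ Icc (-Real.pi) 0) (hp' : φp ∈ Icc 0 Real.pi) (ν : ℝ) :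
    (∫ y, exp (exp (hankelPath x₀ φm φp y) - ν * hankelPath x₀ φm φp y) * hankelDir φm φp y) =
      ∫ y, exp (exp (hankelPath x₀ (-Real.pi) Real.pi y) - ν * hankelPath x₀ (-Real.pi) Real.pi y) *
        hankelDir (-Real.pi) Real.pi y := by
  have hπ := Real.pi_pos
  have hc1 : c ≤ 1 := by linarith [Real.neg_one_le_cos φm]
  have hle : φm ≤ φp := hm'.2.trans hp'.1
  rw [integral_hankelPath (G := fun v => exp (exp v - ν * v)) hle (integrable_hankel hc hle hm hp ν),
    integral_hankelPath (G := fun v => exp (exp v - ν * v)) (by linarith)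
      (integrable_hankel hc (by linarith) (by simpa using hc1) (by simpa using hc1) ν)]
  have hb := integrableOn_exp_sub_exp (-ν) x₀ hc one_pos
  have h1 := integral_Ioi_sub_integral_Ioi (G := fun v => exp (exp v - ν * v)) (x₀ := x₀) hp'.2
    (by fun_prop) hb fun x hx y hy => by
      rw [norm_exp_hankel_line, Real.exp_le_exp, one_mul]
      have : Real.cos y ≤ -c :=
        (Real.cos_le_cos_of_nonneg_of_le_pi hp'.1 hy.2 hy.1).trans hp
      nlinarith [Real.exp_pos x]
  have h2 := integral_Ioi_sub_integral_Ioi (G := fun v => exp (exp v - ν * v)) (x₀ := x₀) hm'.1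
    (by fun_prop) hb fun x hx y hy => by
      rw [norm_exp_hankel_line, Real.exp_le_exp, one_mul]
      have : Real.cos y ≤ -c := by
        rw [← Real.cos_neg] at hm ⊢
        exact (Real.cos_le_cos_of_nonneg_of_le_pi (by linarith [hm'.2]) (by linarith [hy.1])
          (by linarith [hy.2])).trans hm
      nlinarith [Real.exp_pos x]
  have hi : ∀ a b : ℝ, IntervalIntegrable (fun y : ℝ => exp (exp (x₀ + y * I) - ν * (x₀ + y * I)))
      volume a b := fun a b => Continuous.intervalIntegrable (by fun_prop) a b
  have h3 := intervalIntegral.integral_add_adjacent_intervals (hi (-Real.pi) φm) (hi φm φp)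
  have h4 := intervalIntegral.integral_add_adjacent_intervals (hi (-Real.pi) φp) (hi φp Real.pi)
  linear_combination h1 + h2 + I * h3 + I * h4

/-- Hankel's formula for `ν < 0`. The integrand is then integrable at `-∞`, so the contour may be
replaced by the full lines `Im v = ±π`, on which the integral is `Γ(-ν)` up to a phase. The
reflection formula gives `1/Γ(1 + ν)`. -/
theorem integral_hankel_pi_of_neg {ν : ℝ} (hν : ν < 0) :
    ∫ y, exp (exp (hankelPath x₀ (-Real.pi) Real.pi y) - ν * hankelPath x₀ (-Real.pi) Real.pi y) *
        hankelDir (-Real.pi) Real.pi y =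
      2 * Real.pi * I * ((Real.Gamma (1 + ν))⁻¹ : ℝ) := by
  have hπ := Real.pi_pos
  rw [integral_hankelPath (G := fun v => exp (exp v - ν * v)) (by linarith)
      (integrable_hankel one_pos (by linarith) (by simp) (by simp) ν)]
  have hb : IntegrableOn (fun x : ℝ => Real.exp (Real.exp x₀) * Real.exp (-ν * x)) (Iic x₀) :=
    (integrableOn_exp_mul_Iic (by linarith) x₀).const_mul _
  have h1 := integral_Iic_sub_integral_Iic (G := fun v => exp (exp v - ν * v)) (x₀ := x₀)
    (by linarith : -Real.pi ≤ Real.pi) (by fun_prop) hb fun x hx y _ => by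
      rw [norm_exp_hankel_line, ← Real.exp_add, Real.exp_le_exp]
      have : Real.exp x * Real.cos y ≤ Real.exp x₀ := by
        nlinarith [Real.exp_pos x, Real.cos_le_one y, Real.exp_le_exp.2 hx]
      linarith
  have hI : Integrable fun x : ℝ => Real.exp (-ν * x - Real.exp x) := by
    simpa using integrable_exp_sub_exp (a := -ν) (by linarith) one_pos one_pos
  have e : ∀ s : ℝ, exp (s * Real.pi * I) = -1 →
      (fun x : ℝ => exp (exp (x + ((s * Real.pi : ℝ) : ℂ) * I) - ν * (x + ((s * Real.pi : ℝ) : ℂ) * I))) =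
      fun x : ℝ => exp (-ν * s * Real.pi * I) * (Real.exp (-ν * x - Real.exp x) : ℝ) := by
    intro s hs
    funext x
    push_cast
    rw [exp_add (x : ℂ), hs, ← exp_add]
    congr 1; ring
  have ep := e 1 (by simp)
  have em := e (-1) (by simp [exp_neg])
  simp only [one_mul, neg_one_mul] at ep em
  have hint : ∀ s : ℝ, exp (s * Real.pi * I) = -1 →
      Integrable (fun x : ℝ => exp (exp (x + ((s * Real.pi : ℝ) : ℂ) * I) -
        ν * (x + ((s * Real.pi : ℝ) : ℂ) * I))) := by
    intro s hs
    rw [e s hs]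
    exact hI.ofReal.const_mul _
  have hip := hint 1 (by simp)
  have him := hint (-1) (by simp [exp_neg])
  simp only [one_mul, neg_one_mul] at hip him
  have sp := intervalIntegral.integral_Iic_add_Ioi (b := x₀) hip.integrableOn hip.integrableOn
  have sm := intervalIntegral.integral_Iic_add_Ioi (b := x₀) him.integrableOn him.integrableOn
  have vp : ∫ x : ℝ, exp (exp (x + (Real.pi : ℂ) * I) - ν * (x + (Real.pi : ℂ) * I)) =
      exp (-ν * Real.pi * I) * (Real.Gamma (-ν) : ℝ) := by
    rw [← integral_exp_sub_exp (by linarith : 0 < -ν), ep, integral_const_mul, integral_complex_ofReal]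
    simp
  have vm : ∫ x : ℝ, exp (exp (x + ((-Real.pi : ℝ) : ℂ) * I) - ν * (x + ((-Real.pi : ℝ) : ℂ) * I)) =
      exp (ν * Real.pi * I) * (Real.Gamma (-ν) : ℝ) := by
    rw [← integral_exp_sub_exp (by linarith : 0 < -ν), em, integral_const_mul, integral_complex_ofReal]
    simp
  rw [vp] at sp
  rw [vm] at sm
  have hsum : (∫ x in Ioi x₀, exp (exp (x + (Real.pi : ℂ) * I) - ν * (x + (Real.pi : ℂ) * I))) -
      (∫ x in Ioi x₀, exp (exp (x + ((-Real.pi : ℝ) : ℂ) * I) - ν * (x + ((-Real.pi : ℝ) : ℂ) * I))) +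
      I * ∫ y in -Real.pi..Real.pi, exp (exp (x₀ + y * I) - ν * (x₀ + y * I)) =
      (exp (-ν * Real.pi * I) - exp (ν * Real.pi * I)) * (Real.Gamma (-ν) : ℝ) := by
    linear_combination sp - sm - h1
  rw [hsum]
  have hsin : exp (-ν * Real.pi * I) - exp (ν * Real.pi * I) =
      2 * I * (Real.sin (Real.pi * -ν) : ℝ) := by
    rw [ofReal_sin, Complex.sin]
    push_cast
    have h1 : -(Real.pi * -ν : ℂ) * I = ν * Real.pi * I := by ring
    have h2 : (Real.pi * -ν : ℂ) * I = -ν * Real.pi * I := by ring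
    rw [h1, h2]
    linear_combination (exp (-ν * Real.pi * I) - exp (ν * Real.pi * I)) * I_sq
  have hrefl : Real.sin (Real.pi * -ν) * Real.Gamma (-ν) = Real.pi * (Real.Gamma (1 + ν))⁻¹ := by
    have h := Real.Gamma_mul_Gamma_one_sub (-ν)
    rw [sub_neg_eq_add] at h
    have hG : Real.Gamma (-ν) ≠ 0 := (Real.Gamma_pos_of_pos (by linarith)).ne'
    have h' : Real.Gamma (1 + ν) = Real.pi / Real.sin (Real.pi * -ν) / Real.Gamma (-ν) := by
      rw [← h]; field_simp
    rw [h', inv_div, div_div_eq_mul_div]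
    field_simp
  rw [hsin]
  have := congrArg (fun x : ℝ => (x : ℂ)) hrefl
  push_cast at this ⊢
  linear_combination 2 * I * this

/-- The functional equation of Hankel's integral, from the derivative of `exp (exp v - ν v)`. -/
theorem integral_hankel_sub_one {c : ℝ} (hc : 0 < c) (h : φm ≤ φp) (hm : Real.cos φm ≤ -c)
    (hp : Real.cos φp ≤ -c) (ν : ℝ) :
    (∫ y, exp (exp (hankelPath x₀ φm φp y) - (ν - 1 : ℝ) * hankelPath x₀ φm φp y) *
      hankelDir φm φp y) =
    ν * ∫ y, exp (exp (hankelPath x₀ φm φp y) - ν * hankelPath x₀ φm φp y) *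
      hankelDir φm φp y := by
  have hi1 := integrable_hankel (x₀ := x₀) hc h hm hp (ν - 1)
  have hi2 := (integrable_hankel (x₀ := x₀) hc h hm hp ν).const_mul (ν : ℂ)
  rw [← sub_eq_zero, ← integral_const_mul, ← integral_sub hi1 hi2]
  set G : ℂ → ℂ := fun v => exp (exp v - ν * v)
  set G' : ℂ → ℂ := fun v => exp (exp v - (ν - 1 : ℝ) * v) - ν * exp (exp v - ν * v)
  have hG : ∀ v, HasDerivAt G (G' v) v := by
    intro v
    have := (((hasDerivAt_exp v).sub ((hasDerivAt_id v).const_mul (ν : ℂ))).cexp)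
    refine this.congr_deriv ?_
    simp only [G', Pi.sub_apply, id]
    have : exp (exp v - (ν - 1 : ℝ) * v) = exp v * exp (exp v - ν * v) := by
      rw [← exp_add]; congr 1; push_cast; ring
    rw [this]; ring
  have e : (fun y => exp (exp (hankelPath x₀ φm φp y) - (ν - 1 : ℝ) * hankelPath x₀ φm φp y) *
      hankelDir φm φp y - ν * (exp (exp (hankelPath x₀ φm φp y) - ν * hankelPath x₀ φm φp y) *
      hankelDir φm φp y)) = fun y => G' (hankelPath x₀ φm φp y) * hankelDir φm φp y := by
    funext y; simp only [G']; ring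
  have hi := hi1.sub hi2
  rw [show (fun y => exp (exp (hankelPath x₀ φm φp y) - (ν - 1 : ℝ) * hankelPath x₀ φm φp y) *
      hankelDir φm φp y) - (fun y => (ν : ℂ) * (exp (exp (hankelPath x₀ φm φp y) -
      ν * hankelPath x₀ φm φp y) * hankelDir φm φp y)) = _ from e] at hi
  rw [e, integral_hankelPath h hi]
  have hline : ∀ φ : ℝ, Real.cos φ ≤ -c → ∫ x in Ioi x₀, G' (x + φ * I) = 0 - G (x₀ + φ * I) := by
    intro φ hφ
    have hb : ∀ ν' : ℝ, ∀ x : ℝ, ‖exp (exp (x + φ * I) - ν' * (x + φ * I))‖ ≤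
        Real.exp (-ν' * x - c * Real.exp (1 * x)) := by
      intro ν' x
      rw [norm_exp_hankel_line, Real.exp_le_exp, one_mul]
      nlinarith [Real.exp_pos x]
    have hbi : ∀ ν' : ℝ, IntegrableOn
        (fun x : ℝ => exp (exp (x + φ * I) - ν' * (x + φ * I))) (Ioi x₀) := fun ν' =>
      (integrableOn_exp_sub_exp (-ν') x₀ hc one_pos).mono'
        (Continuous.aestronglyMeasurable (by fun_prop)) (Eventually.of_forall (hb ν'))
    refine integral_Ioi_of_hasDerivAt_of_tendsto' (f := fun x : ℝ => G (x + φ * I))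
      (fun x _ => ?_) ((hbi (ν - 1)).sub ((hbi ν).const_mul (ν : ℂ))) ?_
    · have h1 : HasDerivAt (fun x : ℝ => (x : ℂ) + φ * I) 1 x :=
        (ofRealCLM.hasDerivAt (x := x)).add_const _
      simpa [Function.comp_def] using (hG (x + φ * I)).comp x h1
    · obtain ⟨M, hM⟩ := exists_le_sub_abs (-ν) 0 hc one_pos
      refine squeeze_zero_norm' (a := fun x : ℝ => Real.exp (M - x)) ?_
        (Real.tendsto_exp_atBot.comp ?_)
      · filter_upwards [eventually_ge_atTop 0] with x hx
        refine (hb ν x).trans (Real.exp_le_exp.2 ?_)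
        have := hM x hx
        rwa [abs_of_nonneg hx] at this
      · exact tendsto_atBot_add_const_left _ M tendsto_neg_atTop_atBot
  have hvert : I * ∫ y in φm..φp, G' (x₀ + y * I) = G (x₀ + φp * I) - G (x₀ + φm * I) := by
    rw [← intervalIntegral.integral_const_mul]
    refine intervalIntegral.integral_eq_sub_of_hasDerivAt (f := fun y : ℝ => G (x₀ + y * I))
      (fun y _ => ?_) (Continuous.intervalIntegrable (by fun_prop) _ _)
    have h1 : HasDerivAt (fun y : ℝ => (x₀ : ℂ) + y * I) I y := by
      simpa using ((ofRealCLM.hasDerivAt (x := y)).mul_const I).const_add (x₀ : ℂ)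
    simpa [Function.comp_def, mul_comm] using (hG (x₀ + y * I)).comp y h1
  rw [hline φp hp, hline φm hm, hvert]
  ring

/-- Hankel's formula for `ν = 0`: the ends of the contour cancel, and the mean value property of
`exp` remains. -/
theorem integral_hankel_pi_zero :
    ∫ y, exp (exp (hankelPath x₀ (-Real.pi) Real.pi y) -
        (0 : ℝ) * hankelPath x₀ (-Real.pi) Real.pi y) * hankelDir (-Real.pi) Real.pi y =
      2 * Real.pi * I := by
  have hπ := Real.pi_pos
  rw [integral_hankelPath (G := fun v => exp (exp v - (0 : ℝ) * v)) (by linarith)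
      (integrable_hankel one_pos (by linarith) (by simp) (by simp) 0)]
  have e1 : ∀ x : ℝ, exp ((x : ℂ) + (Real.pi : ℂ) * I) = exp (x + ((-Real.pi : ℝ) : ℂ) * I) := by
    intro x; rw [exp_add, exp_add]; simp [exp_neg]
  simp only [ofReal_zero, zero_mul, sub_zero, e1, sub_self, zero_add]
  have h := DiffContOnCl.circleAverage (f := exp) (c := 0) (R := Real.exp x₀)
    (differentiable_exp.diffContOnCl)
  rw [Real.circleAverage_def] at h
  have h2 : ∫ y in -Real.pi..Real.pi, exp (exp (x₀ + y * I)) =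
      ∫ θ in 0..2 * Real.pi, exp (circleMap 0 (Real.exp x₀) θ) := by
    have hper := (periodic_circleMap 0 (Real.exp x₀)).comp exp
    have := hper.intervalIntegral_add_eq (-Real.pi) 0
    rw [show -Real.pi + 2 * Real.pi = Real.pi by ring, zero_add] at this
    have e : ∀ y, circleMap 0 (Real.exp x₀) y = exp (x₀ + y * I) := fun y => by
      simp [circleMap, exp_add]
    simp only [Function.comp_apply, e] at this ⊢
    exact this
  rw [h2]
  rw [exp_zero, inv_smul_eq_iff₀ (by positivity)] at h
  rw [h, real_smul]
  push_cast; ring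

/-- **Hankel's formula** for `1/Γ`: with `s = e^v`, it is the integral of `e^s s^{-ν-1}` along a
Hankel contour. -/
theorem integral_hankel {c : ℝ} (hc : 0 < c) (hm : Real.cos φm ≤ -c)
    (hp : Real.cos φp ≤ -c) (hm' : φm ∈ Icc (-Real.pi) 0) (hp' : φp ∈ Icc 0 Real.pi) (ν : ℝ) :
    ∫ y, exp (exp (hankelPath x₀ φm φp y) - ν * hankelPath x₀ φm φp y) * hankelDir φm φp y =
      2 * Real.pi * I * ((Real.Gamma (1 + ν))⁻¹ : ℝ) := by
  rw [integral_hankel_eq_pi hc hm hp hm' hp']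
  have key : ∀ m : ℕ, ∀ ν : ℝ, ν < m →
      ∫ y, exp (exp (hankelPath x₀ (-Real.pi) Real.pi y) - ν * hankelPath x₀ (-Real.pi) Real.pi y) *
        hankelDir (-Real.pi) Real.pi y = 2 * Real.pi * I * ((Real.Gamma (1 + ν))⁻¹ : ℝ) := by
    intro m
    induction m with
    | zero => exact fun ν hν => integral_hankel_pi_of_neg (by simpa using hν)
    | succ m ih =>
      intro ν hν
      rcases lt_trichotomy ν 0 with h0 | h0 | h0
      · exact integral_hankel_pi_of_neg h0
      · subst h0; rw [integral_hankel_pi_zero]; simp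
      · have h1 := ih (ν - 1) (by push_cast at hν; linarith)
        rw [integral_hankel_sub_one one_pos (by linarith [Real.pi_pos]) (by simp) (by simp),
          add_sub_cancel] at h1
        have hν0 : (ν : ℂ) ≠ 0 := by exact_mod_cast h0.ne'
        rw [add_comm 1 ν, Real.Gamma_add_one h0.ne']
        rw [← mul_right_inj' hν0, h1]
        push_cast
        field_simp
  obtain ⟨m, hm⟩ := exists_nat_gt ν
  exact key m ν hm

end hankel

/-! ### The kernel `C_α` -/

theorem exists_mul_exp_le {A c κ : ℝ} (hA : 0 ≤ A) (hc : 0 < c) (hκ : κ < 1) (hκ0 : 0 < κ) :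
    ∃ M, ∀ x : ℝ, A * Real.exp (κ * x) ≤ c * Real.exp x + M := by
  set L := Real.log (A / c + 1) / (1 - κ) with hL
  refine ⟨A * Real.exp (κ * L), fun x => ?_⟩
  have h1 : 0 < 1 - κ := by linarith
  rcases le_total x L with h | h
  · have : Real.exp (κ * x) ≤ Real.exp (κ * L) := Real.exp_le_exp.2 (by nlinarith)
    nlinarith [Real.exp_pos x]
  · have h2 : A / c + 1 ≤ Real.exp ((1 - κ) * x) := by
      rw [← Real.log_le_iff_le_exp (by positivity)]
      rw [hL, div_le_iff₀ h1] at h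
      linarith
    have h3 : A ≤ c * Real.exp ((1 - κ) * x) := by
      have : A / c ≤ Real.exp ((1 - κ) * x) := by linarith
      rwa [div_le_iff₀' hc] at this
    have h4 : Real.exp x = Real.exp ((1 - κ) * x) * Real.exp (κ * x) := by
      rw [← Real.exp_add]; congr 1; ring
    have h5 : 0 ≤ A * Real.exp (κ * L) := by positivity
    rw [h4]
    nlinarith [Real.exp_pos (κ * x)]

section

variable {x₀ φm φp : ℝ} {c : ℝ}

theorem integrable_hankel_mul_exp (hc : 0 < c) (h : φm ≤ φp) (hm : Real.cos φm ≤ -c)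
    (hp : Real.cos φp ≤ -c) {A κ : ℝ} (hA : 0 ≤ A) (hκ0 : 0 < κ) (hκ : κ < 1) (ν : ℝ) :
    Integrable fun y => Real.exp (A * Real.exp (κ * hankelRe x₀ φm φp y)) *
      ‖exp (exp (hankelPath x₀ φm φp y) - ν * hankelPath x₀ φm φp y)‖ := by
  obtain ⟨M, hM⟩ := exists_mul_exp_le hA (half_pos hc) hκ hκ0
  refine ((integrable_exp_hankelRe (x₀ := x₀) h (-ν) (half_pos hc) one_pos).const_mul
    (Real.exp M * Real.exp ((1 + c) * Real.exp x₀))).mono' (by fun_prop)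
    (Eventually.of_forall fun y => ?_)
  rw [norm_mul, norm_norm, Real.norm_of_nonneg (Real.exp_pos _).le]
  refine (mul_le_mul_of_nonneg_left (norm_exp_hankel_le (x₀ := x₀) hc.le h hm hp ν y)
    (Real.exp_pos _).le).trans ?_
  rw [← Real.exp_add, ← Real.exp_add, ← Real.exp_add, ← Real.exp_add, Real.exp_le_exp]
  have := hM (hankelRe x₀ φm φp y)
  rw [one_mul]
  linarith

theorem norm_exp_mul_exp_le (z v : ℂ) (κ : ℝ) :
    ‖exp (-(z * exp (κ * v)))‖ ≤ Real.exp (‖z‖ * Real.exp (κ * v.re)) := by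
  rw [norm_exp, Real.exp_le_exp]
  refine (re_le_norm _).trans_eq ?_
  rw [norm_neg, norm_mul, norm_exp, re_ofReal_mul]

/-- The series of `C_α`, summed under Hankel's integral for the factors `1/Γ(1 - (n+1)/α)`. -/
theorem kernelC_eq_integral (hc : 0 < c) (hm : Real.cos φm ≤ -c)
    (hp : Real.cos φp ≤ -c) (hm' : φm ∈ Icc (-Real.pi) 0) (hp' : φp ∈ Icc 0 Real.pi)
    {α : ℝ} (hα : 1 < α) (z : ℂ) :
    kernelC α z = (2 * Real.pi * I)⁻¹ * ∫ y,
      exp (exp (hankelPath x₀ φm φp y) - (-α⁻¹ : ℝ) * hankelPath x₀ φm φp y) *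
        exp (-(z * exp ((α⁻¹ : ℝ) * hankelPath x₀ φm φp y))) * hankelDir φm φp y := by
  have h : φm ≤ φp := hm'.2.trans hp'.1
  have hα0 : 0 < α⁻¹ := by positivity
  have hα1 : α⁻¹ < 1 := inv_lt_one_of_one_lt₀ hα
  have key := hasSum_integral_of_dominated_convergence (μ := (volume : Measure ℝ))
    (F := fun (n : ℕ) y => (-z) ^ n / (n.factorial : ℂ) *
      (exp (exp (hankelPath x₀ φm φp y) - (-(n + 1) / α : ℝ) * hankelPath x₀ φm φp y) *
        hankelDir φm φp y))
    (f := fun y => exp (exp (hankelPath x₀ φm φp y) - (-α⁻¹ : ℝ) * hankelPath x₀ φm φp y) *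
        exp (-(z * exp ((α⁻¹ : ℝ) * hankelPath x₀ φm φp y))) * hankelDir φm φp y)
    (fun n y => (‖z‖ * Real.exp (α⁻¹ * hankelRe x₀ φm φp y)) ^ n / (n.factorial : ℝ) *
      ‖exp (exp (hankelPath x₀ φm φp y) - (-α⁻¹ : ℝ) * hankelPath x₀ φm φp y)‖)
    ?_ ?_ ?_ ?_ ?_
  · simp_rw [integral_const_mul, integral_hankel hc hm hp hm' hp'] at key
    rw [← key.tsum_eq, ← tsum_mul_left, kernelC]
    congr 1; ext n
    have h2 : (2 * Real.pi * I : ℂ) ≠ 0 := by simp [Real.pi_ne_zero]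
    rw [show (1 : ℝ) + -(n + 1) / α = 1 - (n + 1) / α by ring]
    push_cast
    field_simp
  · intro n
    exact ((Continuous.aestronglyMeasurable (by fun_prop)).mul
      measurable_hankelDir.aestronglyMeasurable).const_mul _
  · intro n
    refine Eventually.of_forall fun y => le_of_eq ?_
    rw [norm_mul, norm_mul, norm_hankelDir, mul_one, norm_div, norm_pow, norm_neg, mul_pow,
      norm_natCast, mul_div_right_comm, mul_assoc]
    congr 1
    rw [← Real.exp_nat_mul, norm_exp, norm_exp, ← Real.exp_add]
    congr 1
    rw [sub_re, sub_re, re_ofReal_mul, re_ofReal_mul, hankelPath_re]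
    ring
  · exact Eventually.of_forall fun y =>
      (Real.summable_pow_div_factorial _).mul_right _
  · have e : ∀ y, (∑' n : ℕ, (‖z‖ * Real.exp (α⁻¹ * hankelRe x₀ φm φp y)) ^ n / (n.factorial : ℝ) *
      ‖exp (exp (hankelPath x₀ φm φp y) - (-α⁻¹ : ℝ) * hankelPath x₀ φm φp y)‖) =
      Real.exp (‖z‖ * Real.exp (α⁻¹ * hankelRe x₀ φm φp y)) *
      ‖exp (exp (hankelPath x₀ φm φp y) - (-α⁻¹ : ℝ) * hankelPath x₀ φm φp y)‖ := by
      intro y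
      rw [tsum_mul_right, Real.exp_eq_exp_ℝ, NormedSpace.exp_eq_tsum_div]
    simp_rw [e]
    exact integrable_hankel_mul_exp hc h hm hp (norm_nonneg z) hα0 hα1 _
  · refine Eventually.of_forall fun y => ?_
    have := (NormedSpace.expSeries_div_hasSum_exp (-(z * exp ((α⁻¹ : ℝ) * hankelPath x₀ φm φp y))))
    rw [← Complex.exp_eq_exp_ℂ] at this
    have h3 := this.mul_left (exp (exp (hankelPath x₀ φm φp y) - (-α⁻¹ : ℝ) * hankelPath x₀ φm φp y) *
      hankelDir φm φp y)
    rw [mul_right_comm]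
    refine Eq.mp (congrArg (fun F => HasSum F _) (funext fun n => ?_)) h3
    symm
    have : exp (exp (hankelPath x₀ φm φp y) - (-(n + 1) / α : ℝ) * hankelPath x₀ φm φp y) =
      exp (exp (hankelPath x₀ φm φp y) - (-α⁻¹ : ℝ) * hankelPath x₀ φm φp y) *
        exp ((α⁻¹ : ℝ) * hankelPath x₀ φm φp y) ^ n := by
      rw [← exp_nat_mul, ← exp_add]; congr 1; push_cast; ring
    rw [this, ← neg_mul, mul_pow]
    ring

end

theorem differentiable_kernelC {α : ℝ} (hα : 1 < α) : Differentiable ℂ (kernelC α) := by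
  have hπ := Real.pi_pos
  rw [← differentiableOn_univ]
  have e := fun z => kernelC_eq_integral (x₀ := 0) (φm := -Real.pi) (φp := Real.pi) one_pos
    (by simp) (by simp) ⟨le_rfl, by linarith⟩ ⟨by linarith, le_rfl⟩ hα z
  rw [funext e]
  have hα0 : 0 < α⁻¹ := by positivity
  have hα1 : α⁻¹ < 1 := inv_lt_one_of_one_lt₀ hα
  refine DifferentiableOn.const_mul (differentiableOn_integral_one isOpen_univ
    (fun y => by fun_prop) (fun z _ => ?_) fun z _ => ?_) _
  · exact (Continuous.aestronglyMeasurable (by fun_prop)).mul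
      measurable_hankelDir.aestronglyMeasurable
  · refine ⟨1, one_pos, _, integrable_hankel_mul_exp (x₀ := 0) (φm := -Real.pi) (φp := Real.pi)
      (A := ‖z‖ + 1) one_pos (by linarith) (by simp) (by simp) (by positivity) hα0 hα1 (-α⁻¹),
      fun q hq y => ?_⟩
    rw [norm_mul, norm_mul, norm_hankelDir, mul_one, mul_comm]
    refine mul_le_mul_of_nonneg_right ((norm_exp_mul_exp_le _ _ _).trans ?_) (norm_nonneg _)
    rw [Real.exp_le_exp, hankelPath_re]
    refine mul_le_mul_of_nonneg_right ?_ (Real.exp_pos _).le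
    have := norm_sub_norm_le q z
    have h2 := hq.1
    rw [mem_ball, dist_eq_norm] at h2
    linarith

theorem kappa_pos {k : ℝ} (hk : 0 < k) : 0 < k / (1 + k) := by positivity

theorem kappa_lt_one {k : ℝ} (hk : 0 < k) : k / (1 + k) < 1 := by
  rw [div_lt_one (by positivity)]; linarith

/-- The kernel `κ τ C_{(k+1)/k}(τ)`, `τ = e^{κp}`, with `κ = k/(1+k)`. In logarithmic coordinates
the Ecalle operator integrates `g` against the translates of this kernel. -/
noncomputable def ecalleKernel (k : ℝ) (p : ℂ) : ℂ :=
  (k / (1 + k) : ℝ) * exp ((k / (1 + k) : ℝ) * p) *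
    kernelC ((k + 1) / k) (exp ((k / (1 + k) : ℝ) * p))

theorem ecalle_eq_integral (k θ : ℝ) (g : ℂ → ℂ) (w : ℂ) :
    ecalle k θ g w = ∫ x : ℝ, g (x + θ * I) * ecalleKernel k (x + θ * I - w) := by
  rw [ecalle, ← integral_const_mul]
  congr 1; ext x
  rw [ecalleKernel]
  have : exp ((k / (1 + k) : ℝ) * (x + θ * I - w)) =
      exp (-(k / (1 + k) : ℝ) * w) * exp ((k / (1 + k) : ℝ) * (x + θ * I)) := by
    rw [← exp_add]; congr 1; ring
  nth_rw 2 [this]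
  ring

theorem differentiable_ecalleKernel {k : ℝ} (hk : 0 < k) : Differentiable ℂ (ecalleKernel k) := by
  have hα : 1 < (k + 1) / k := by rw [lt_div_iff₀ hk]; linarith
  have := differentiable_kernelC hα
  unfold ecalleKernel
  fun_prop

/-- The integrand of Hankel's representation of the kernel at `p` is small, as the argument of
`e^{κ(p+v)}` stays below `π/2` for `|Im p| < π/(2k)` and `v` on the contour. -/
theorem norm_hankel_integrand_le {k δ η : ℝ} (hk : 0 < k) (hδ : 0 < δ) {x₀ φ : ℝ} {p : ℂ}
    (hφ0 : 0 ≤ φ) (hφ : φ ≤ Real.pi / 2 + δ / 2) (hp : |p.im| ≤ Real.pi / (2 * k) - δ)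
    (hη : η = Real.cos (Real.pi / 2 - k / (1 + k) * δ / 2)) (y : ℝ) :
    ‖exp (exp (hankelPath x₀ (-φ) φ y) - (-(k / (1 + k)) : ℝ) * hankelPath x₀ (-φ) φ y) *
        exp (-(exp ((k / (1 + k) : ℝ) * p) * exp ((k / (1 + k) : ℝ) * hankelPath x₀ (-φ) φ y)))‖ ≤
      Real.exp (k / (1 + k) * hankelRe x₀ (-φ) φ y - η * Real.exp (k / (1 + k) * p.re) *
        Real.exp (k / (1 + k) * hankelRe x₀ (-φ) φ y)) *
      Real.exp (exp (hankelPath x₀ (-φ) φ y)).re := by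
  rw [← exp_add, norm_exp, ← Real.exp_add, Real.exp_le_exp, ← exp_add, add_re, neg_re, sub_re,
    re_ofReal_mul, exp_re (_ + _), hankelPath_re]
  have hκ := kappa_pos hk
  set κ := k / (1 + k) with hκdef
  have him := hankelIm_mem (φm := -φ) (φp := φ) (by linarith) y
  have e1 : ((κ : ℂ) * p + κ * hankelPath x₀ (-φ) φ y).re = κ * p.re + κ * hankelRe x₀ (-φ) φ y := by
    rw [add_re, re_ofReal_mul, re_ofReal_mul, hankelPath_re]
  have e2 : ((κ : ℂ) * p + κ * hankelPath x₀ (-φ) φ y).im = κ * (p.im + hankelIm (-φ) φ y) := by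
    rw [add_im, im_ofReal_mul, im_ofReal_mul, hankelPath_im]; ring
  have hcos : η ≤ Real.cos (κ * (p.im + hankelIm (-φ) φ y)) := by
    have h1 : |κ * (p.im + hankelIm (-φ) φ y)| ≤ Real.pi / 2 - κ * δ / 2 := by
      rw [abs_mul, abs_of_pos hκ]
      have h2 : |p.im + hankelIm (-φ) φ y| ≤ (Real.pi / (2 * k) - δ) + (Real.pi / 2 + δ / 2) :=
        (abs_add_le _ _).trans (add_le_add hp ((abs_le.2 him).trans hφ))
      have h3 : κ * (Real.pi / (2 * k) + Real.pi / 2) = Real.pi / 2 := by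
        rw [hκdef]; field_simp
      nlinarith
    rw [hη, ← Real.cos_abs (κ * _)]
    refine Real.cos_le_cos_of_nonneg_of_le_pi (abs_nonneg _) ?_ h1
    have : 0 ≤ κ * δ / 2 := by positivity
    linarith [Real.pi_pos]
  rw [e1, e2, Real.exp_add]
  have h4 := mul_le_mul_of_nonneg_left hcos
    (mul_pos (Real.exp_pos (κ * p.re)) (Real.exp_pos (κ * hankelRe x₀ (-φ) φ y))).le
  linarith

/-- For `t = e^p` the kernel decays like `exp (-c |t|^k)` in proper subsectors of
`|arg t| < π/(2k)`. In Hankel's representation the terms `e^v` and `e^{κ(p+v)}` balance at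
`|e^v| = |t|^k`, which determines the corner of the contour. -/
theorem exists_kernel_bound {k δ : ℝ} (hk : 0 < k) (hδ : 0 < δ) :
    ∃ C > 0, ∃ c > 0, ∀ p : ℂ, |p.im| ≤ Real.pi / (2 * k) - δ →
      ‖ecalleKernel k p‖ ≤ C * Real.exp (k / (1 + k) * p.re - c * Real.exp (k * p.re)) := by
  by_cases hne : ∃ p : ℂ, |p.im| ≤ Real.pi / (2 * k) - δ
  swap
  · exact ⟨1, one_pos, 1, one_pos, fun p hp => (hne ⟨p, hp⟩).elim⟩
  have hκ := kappa_pos hk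
  have hκ1 := kappa_lt_one hk
  have hα : 1 < (k + 1) / k := by rw [lt_div_iff₀ hk]; linarith
  have hακ : ((k + 1) / k)⁻¹ = k / (1 + k) := by rw [inv_div, add_comm]
  have hδk : δ ≤ Real.pi / (2 * k) := by
    obtain ⟨p, hp⟩ := hne; linarith [abs_nonneg p.im]
  have hπ := Real.pi_pos
  obtain ⟨M, hM⟩ := (isCompact_closedBall (0 : ℂ) 1).exists_bound_of_continuousOn
    (differentiable_kernelC hα).continuous.continuousOn
  set η := Real.cos (Real.pi / 2 - k / (1 + k) * δ / 2) with hη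
  have hηpos : 0 < η := by
    have h1 : k / (1 + k) * δ ≤ Real.pi / 2 := by
      calc k / (1 + k) * δ ≤ k / (1 + k) * (Real.pi / (2 * k)) := by gcongr
        _ = Real.pi / (2 * (1 + k)) := by field_simp
        _ ≤ Real.pi / 2 := by
          apply div_le_div_of_nonneg_left hπ.le (by norm_num); linarith
    have h2 : 0 < k / (1 + k) * δ := by positivity
    refine Real.cos_pos_of_mem_Ioo ⟨by linarith, by linarith⟩
  have hη1 : η ≤ 1 := Real.cos_le_one _
  set κ := k / (1 + k) with hκdef
  set φ := min (Real.pi / 2 + δ / 2) Real.pi with hφdef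
  have hφ1 : Real.pi / 2 < φ := lt_min (by linarith) (by linarith)
  have hφ2 : φ ≤ Real.pi := min_le_right _ _
  have hcos : Real.cos φ < 0 := Real.cos_neg_of_pi_div_two_lt_of_lt hφ1 (by linarith)
  -- the corner of the contour sits at `e^{x₀} = e^L e^{k Re p}`
  set L := Real.log (η / 4) / (1 - κ) with hL
  have hLexp : Real.exp L = η / 4 * Real.exp (κ * L) := by
    have h1 : Real.exp ((1 - κ) * L) = η / 4 := by
      rw [hL, mul_div_cancel₀ _ (by linarith), Real.exp_log (by positivity)]
    rw [← h1, ← Real.exp_add]; congr 1; ring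
  set D := η * Real.exp (κ * L) with hD
  have hDpos : 0 < D := by positivity
  set J := ∫ y, Real.exp (κ * hankelRe 0 (-φ) φ y - D / 2 * Real.exp (κ * hankelRe 0 (-φ) φ y))
    with hJ
  have hJint : Integrable fun y => Real.exp (κ * hankelRe 0 (-φ) φ y -
      D / 2 * Real.exp (κ * hankelRe 0 (-φ) φ y)) :=
    integrable_exp_hankelRe (x₀ := 0) (by linarith) κ (half_pos hDpos) hκ
  have hJ0 : 0 ≤ J := integral_nonneg fun y => (Real.exp_pos _).le
  have hM0 : 0 ≤ M := (norm_nonneg _).trans (hM 0 (by simp))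
  have hlarge : ∀ p : ℂ, |p.im| ≤ Real.pi / (2 * k) - δ → 0 ≤ p.re →
      ‖kernelC ((k + 1) / k) (exp (κ * p))‖ ≤
        (Real.exp (κ * L) * J) * Real.exp (κ * k * p.re - D / 4 * Real.exp (k * p.re)) := by
    intro p hp hp0
    set x₀ := k * p.re + L with hx₀
    rw [kernelC_eq_integral (x₀ := x₀) (φm := -φ) (φp := φ) (neg_pos.2 hcos)
      (by rw [Real.cos_neg, neg_neg]) (by rw [neg_neg]) ⟨by linarith, by linarith⟩
      ⟨by linarith, hφ2⟩ hα, hακ, norm_mul]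
    have h1 : ‖(2 * Real.pi * I : ℂ)⁻¹‖ ≤ 1 := by
      rw [norm_inv, norm_mul, norm_mul, norm_I, norm_real, Real.norm_of_nonneg hπ.le]
      refine inv_le_one_of_one_le₀ ?_
      simp only [Complex.norm_ofNat, mul_one]
      linarith [Real.pi_gt_three]
    refine (mul_le_of_le_one_left (norm_nonneg _) h1).trans ?_
    have h2 : ∀ y, ‖exp (exp (hankelPath x₀ (-φ) φ y) - (-κ : ℝ) * hankelPath x₀ (-φ) φ y) *
        exp (-(exp (κ * p) * exp (κ * hankelPath x₀ (-φ) φ y))) * hankelDir (-φ) φ y‖ ≤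
        (Real.exp (κ * L) * Real.exp (κ * k * p.re - D / 4 * Real.exp (k * p.re))) *
        Real.exp (κ * hankelRe 0 (-φ) φ y - D / 2 * Real.exp (κ * hankelRe 0 (-φ) φ y)) := by
      intro y
      rw [norm_mul, norm_hankelDir, mul_one]
      refine (norm_hankel_integrand_le hk hδ (by linarith) (min_le_left _ _) hp hη y).trans ?_
      rw [← Real.exp_add, ← Real.exp_add, ← Real.exp_add, Real.exp_le_exp]
      have h3 : (exp (hankelPath x₀ (-φ) φ y)).re ≤ Real.exp x₀ := by
        have := re_exp_hankelPath_le (x₀ := x₀) (φm := -φ) (φp := φ) le_rfl (by linarith)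
          (by rw [Real.cos_neg]; linarith) (by linarith) y
        linarith
      have h4 : hankelRe x₀ (-φ) φ y = x₀ + hankelRe 0 (-φ) φ y := by simp [hankelRe]
      have hs : 0 ≤ hankelRe 0 (-φ) φ y := le_hankelRe y
      set s := hankelRe 0 (-φ) φ y
      have h5 : η * Real.exp (κ * p.re) * Real.exp (κ * (x₀ + s)) =
          D * Real.exp (k * p.re) * Real.exp (κ * s) := by
        have : κ * p.re + κ * (x₀ + s) = κ * L + k * p.re + κ * s := by
          have : κ * (1 + k) = k := by rw [hκdef]; field_simp
          rw [hx₀]; linear_combination p.re * this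
        rw [hD, mul_assoc, ← Real.exp_add, this, Real.exp_add, Real.exp_add]; ring
      have h6 : Real.exp x₀ = D / 4 * Real.exp (k * p.re) := by
        rw [hx₀, Real.exp_add, hLexp, hD]; ring
      have h7 : 1 ≤ Real.exp (k * p.re) := Real.one_le_exp (by positivity)
      have h8 : 1 ≤ Real.exp (κ * s) := Real.one_le_exp (by positivity)
      rw [h4, h5]
      rw [h6] at h3
      have h9 : D / 2 * Real.exp (κ * s) + D / 2 * Real.exp (k * p.re) ≤
          D * Real.exp (k * p.re) * Real.exp (κ * s) := by
        nlinarith [mul_nonneg (sub_nonneg.2 h7) (sub_nonneg.2 h8),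
          mul_nonneg hDpos.le (mul_nonneg (sub_nonneg.2 h7) (sub_nonneg.2 h8))]
      rw [hx₀]
      nlinarith
    refine (norm_integral_le_of_norm_le (hJint.const_mul _)
      (Eventually.of_forall h2)).trans_eq ?_
    rw [integral_const_mul]; ring
  -- absorb the factor `e^{k Re p}`
  have hx : ∀ X : ℝ, 0 ≤ X → X * Real.exp (-(D / 4 * X)) ≤ 8 / D * Real.exp (-(D / 8 * X)) := by
    intro X hX
    have h1 := Real.add_one_le_exp (D / 8 * X)
    have h2 : X ≤ 8 / D * Real.exp (D / 8 * X) := by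
      rw [div_mul_eq_mul_div, le_div_iff₀ hDpos]; linarith
    calc X * Real.exp (-(D / 4 * X)) ≤ 8 / D * Real.exp (D / 8 * X) * Real.exp (-(D / 4 * X)) := by
          gcongr
      _ = 8 / D * Real.exp (-(D / 8 * X)) := by
          rw [mul_assoc, ← Real.exp_add]; congr 2; ring
  refine ⟨κ * (Real.exp (κ * L) * J * (8 / D)) + κ * M * Real.exp (D / 8) + 1, by positivity,
    D / 8, by positivity, fun p hp => ?_⟩
  have hn : ‖ecalleKernel k p‖ = κ * Real.exp (κ * p.re) *
      ‖kernelC ((k + 1) / k) (exp (κ * p))‖ := by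
    rw [ecalleKernel, norm_mul, norm_mul, norm_exp, norm_real, Real.norm_of_nonneg hκ.le,
      re_ofReal_mul]
  rw [hn]
  set X := Real.exp (k * p.re) with hX
  have hX0 : 0 < X := Real.exp_pos _
  rcases le_total 0 p.re with h0 | h0
  · have h1 := hlarge p hp h0
    have h2 : Real.exp (κ * k * p.re - D / 4 * X) ≤ 8 / D * Real.exp (-(D / 8 * X)) := by
      refine le_trans ?_ (hx X hX0.le)
      rw [sub_eq_add_neg, Real.exp_add]
      refine mul_le_mul_of_nonneg_right ?_ (Real.exp_pos _).le
      rw [hX, Real.exp_le_exp, mul_assoc]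
      exact mul_le_of_le_one_left (by positivity) hκ1.le
    rw [sub_eq_add_neg, Real.exp_add]
    calc κ * Real.exp (κ * p.re) * ‖kernelC ((k + 1) / k) (exp (κ * p))‖
        ≤ κ * Real.exp (κ * p.re) * (Real.exp (κ * L) * J * (8 / D * Real.exp (-(D / 8 * X)))) := by
          gcongr; exact h1.trans (by gcongr)
      _ = (κ * (Real.exp (κ * L) * J * (8 / D))) *
          (Real.exp (κ * p.re) * Real.exp (-(D / 8 * X))) := by ring
      _ ≤ _ := by
          refine mul_le_mul_of_nonneg_right ?_ (by positivity)
          have : 0 ≤ κ * M * Real.exp (D / 8) := by positivity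
          linarith
  · have h1 : ‖kernelC ((k + 1) / k) (exp (κ * p))‖ ≤ M := by
      refine hM _ ?_
      rw [mem_closedBall_zero_iff, norm_exp, re_ofReal_mul]
      exact Real.exp_le_one_iff.2 (mul_nonpos_of_nonneg_of_nonpos hκ.le h0)
    have hX1 : X ≤ 1 := Real.exp_le_one_iff.2 (mul_nonpos_of_nonneg_of_nonpos hk.le h0)
    have h2 : 1 ≤ Real.exp (D / 8) * Real.exp (-(D / 8 * X)) := by
      rw [← Real.exp_add]; exact Real.one_le_exp (by nlinarith)
    rw [sub_eq_add_neg, Real.exp_add]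
    calc κ * Real.exp (κ * p.re) * ‖kernelC ((k + 1) / k) (exp (κ * p))‖
        ≤ κ * Real.exp (κ * p.re) * (M * (Real.exp (D / 8) * Real.exp (-(D / 8 * X)))) := by
          gcongr; exact h1.trans (le_mul_of_one_le_right hM0 h2)
      _ = (κ * M * Real.exp (D / 8)) * (Real.exp (κ * p.re) * Real.exp (-(D / 8 * X))) := by ring
      _ ≤ _ := by
          refine mul_le_mul_of_nonneg_right ?_ (by positivity)
          have : 0 ≤ κ * (Real.exp (κ * L) * J * (8 / D)) := by positivity
          linarith

/-! ### Moments of the kernel -/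

theorem integral_exp_sub_exp_mul {s κ : ℝ} (hs : 0 < s) (hκ : 0 < κ) :
    ∫ x : ℝ, Real.exp (s * x - Real.exp (κ * x)) = Real.Gamma (s / κ) / κ := by
  rw [← integral_exp_sub_exp (by positivity)]
  have := Measure.integral_comp_mul_left (fun x : ℝ => Real.exp (s / κ * x - Real.exp x)) κ
  rw [abs_of_pos (by positivity), smul_eq_mul] at this
  rw [div_eq_inv_mul, ← this]
  congr 1; ext x
  congr 2; field_simp

/-- The gamma integral along a horizontal line. -/
theorem integral_exp_mul_exp_neg_exp {s κ : ℝ} (hs : 0 < s) (hκ : 0 < κ) {γ : ℂ}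
    (hγ : κ * |γ.im| < Real.pi / 2) :
    ∫ x : ℝ, exp (s * (x + γ)) * exp (-exp (κ * (x + γ))) = (Real.Gamma (s / κ) / κ : ℝ) := by
  set G : ℂ → ℂ := fun v => exp (s * v) * exp (-exp (κ * v)) with hG
  have e1 : ∫ x : ℝ, G (x + γ) = ∫ x : ℝ, G (x + γ.im * I) := by
    rw [← integral_add_right_eq_self (fun x : ℝ => G (x + γ.im * I)) γ.re]
    congr 1; ext x
    congr 1
    push_cast
    nth_rw 1 [← re_add_im γ]; ring
  have hcpos : 0 < Real.cos (κ * |γ.im|) :=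
    Real.cos_pos_of_mem_Ioo ⟨by linarith [Real.pi_pos, mul_nonneg hκ.le (abs_nonneg γ.im)], hγ⟩
  have hb := integrable_exp_sub_exp hs hcpos hκ
  have hGb : ∀ x y : ℝ, |y| ≤ |γ.im| → ‖G (x + y * I)‖ ≤
      Real.exp (s * x - Real.cos (κ * |γ.im|) * Real.exp (κ * x)) := by
    intro x y hy
    rw [hG]
    simp only
    rw [← exp_add, norm_exp, Real.exp_le_exp, add_re, neg_re, exp_re, re_ofReal_mul,
      re_ofReal_mul, im_ofReal_mul]
    simp only [add_re, ofReal_re, mul_re, I_re, mul_zero, ofReal_im, I_im, mul_one, sub_self,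
      add_zero, add_im, mul_im, zero_add]
    have : Real.cos (κ * |γ.im|) ≤ Real.cos (κ * y) := by
      rw [← Real.cos_abs (κ * y), abs_mul, abs_of_pos hκ]
      exact Real.cos_le_cos_of_nonneg_of_le_pi (by positivity) (by linarith [Real.pi_pos])
        (by gcongr)
    nlinarith [Real.exp_pos (κ * x)]
  have e2 : ∫ x : ℝ, G (x + γ.im * I) = ∫ x : ℝ, G (x + (0 : ℝ) * I) := by
    rcases le_total 0 γ.im with h | h
    · exact (integral_line_eq_integral_line h (by fun_prop) hb fun x y hy => hGb x y (by
        rw [abs_of_nonneg hy.1, abs_of_nonneg h]; exact hy.2)).symm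
    · exact integral_line_eq_integral_line h (by fun_prop) hb fun x y hy => hGb x y (by
        rw [abs_of_nonpos hy.2, abs_of_nonpos h]; linarith [hy.1])
  rw [show ∫ x : ℝ, exp (s * (x + γ)) * exp (-exp (κ * (x + γ))) = ∫ x : ℝ, G (x + γ) from rfl,
    e1, e2, ← integral_exp_sub_exp_mul hs hκ, ← integral_complex_ofReal]
  congr 1; ext x
  simp only [hG]
  rw [← exp_add]
  push_cast
  congr 1; ring_nf

/-- The moments of the kernel are the inverses of the factors of the modified Borel transform:
after an exchange of integrals, the inner one is a gamma integral and the outer one is Hankel's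
integral for `1/n!`. -/
theorem integral_exp_mul_ecalleKernel_real {k : ℝ} (hk : 0 < k) (n : ℕ) :
    ∫ x : ℝ, exp (n * x) * ecalleKernel k x =
      (Real.Gamma (1 + n * (1 + 1 / k)) / n.factorial : ℝ) := by
  have hπ := Real.pi_pos
  have hκ := kappa_pos hk
  have hκ1 := kappa_lt_one hk
  have hα : 1 < (k + 1) / k := by rw [lt_div_iff₀ hk]; linarith
  have hακ : ((k + 1) / k)⁻¹ = k / (1 + k) := by rw [inv_div, add_comm]
  have hκinv : (n : ℝ) / (k / (1 + k)) = n * (1 + 1 / k) := by field_simp; ring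
  set κ := k / (1 + k) with hκdef
  have hs : 0 < n + κ := by positivity
  set φ := min (Real.pi / 2 / κ * ((1 + κ) / 2)) Real.pi with hφdef
  have hφ1 : Real.pi / 2 < φ := by
    refine lt_min ?_ (by linarith)
    rw [div_mul_div_comm, lt_div_iff₀ (by positivity)]
    nlinarith
  have hφ2 : φ ≤ Real.pi := min_le_right _ _
  have hφ3 : κ * φ < Real.pi / 2 := by
    have : κ * φ ≤ κ * (Real.pi / 2 / κ * ((1 + κ) / 2)) :=
      mul_le_mul_of_nonneg_left (min_le_left _ _) hκ.le
    have e : κ * (Real.pi / 2 / κ * ((1 + κ) / 2)) = Real.pi / 2 * ((1 + κ) / 2) := by field_simp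
    nlinarith
  have hcos : Real.cos φ < 0 := Real.cos_neg_of_pi_div_two_lt_of_lt hφ1 (by linarith)
  have him : ∀ y, κ * |hankelIm (-φ) φ y| ≤ κ * φ := fun y => by
    have := hankelIm_mem (φm := -φ) (φp := φ) (by linarith) y
    exact mul_le_mul_of_nonneg_left (abs_le.2 this) hκ.le
  set γ := hankelPath 0 (-φ) φ with hγ
  set R := hankelRe 0 (-φ) φ with hR
  set D := hankelDir (-φ) φ with hD
  set c := Real.cos (κ * φ) with hc
  have hcpos : 0 < c := Real.cos_pos_of_mem_Ioo ⟨by nlinarith, hφ3⟩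
  -- the double integral
  set F : ℝ → ℝ → ℂ := fun x y => (κ / (2 * Real.pi * I)) *
    (exp ((n + κ : ℝ) * x) * (exp (exp (γ y) - (-κ : ℝ) * γ y) *
      exp (-exp (κ * (x + γ y))) * D y)) with hF
  have e1 : ∀ x : ℝ, exp (n * x) * ecalleKernel k x = ∫ y, F x y := by
    intro x
    rw [ecalleKernel, kernelC_eq_integral (x₀ := 0) (φm := -φ) (φp := φ) (neg_pos.2 hcos)
      (by rw [Real.cos_neg, neg_neg]) (by rw [neg_neg]) ⟨by linarith, by linarith⟩
      ⟨by linarith, hφ2⟩ hα, hακ]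
    simp only [hF]
    rw [integral_const_mul, integral_const_mul]
    have : ∀ y, exp (κ * (x + γ y)) = exp (κ * x) * exp (κ * γ y) := fun y => by
      rw [← exp_add]; congr 1; ring
    simp_rw [this]
    have e : exp ((n + κ : ℝ) * x) = exp (n * x) * exp (κ * x) := by
      rw [← exp_add]; congr 1; push_cast; ring
    rw [e]
    ring
  have hbi := integrable_exp_sub_exp hs hcpos hκ
  have hFb : ∀ x y, ‖F x y‖ ≤ (κ * ‖exp (exp (γ y) - (n : ℝ) * γ y)‖) *
      Real.exp ((n + κ) * (x + R y) - c * Real.exp (κ * (x + R y))) := by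
    intro x y
    have h1 : ‖(κ / (2 * Real.pi * I) : ℂ)‖ ≤ κ := by
      rw [norm_div, norm_mul, norm_mul, norm_I, norm_real, norm_real, Real.norm_of_nonneg hπ.le,
        Real.norm_of_nonneg hκ.le, Complex.norm_ofNat, mul_one]
      exact div_le_self hκ.le (by linarith [Real.pi_gt_three])
    simp only [hF]
    rw [norm_mul, norm_mul, norm_mul, norm_mul, norm_hankelDir, mul_one, mul_assoc κ]
    refine mul_le_mul h1 ?_ (by positivity) hκ.le
    rw [norm_exp, norm_exp, norm_exp, norm_exp, ← Real.exp_add, ← Real.exp_add, ← Real.exp_add,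
      Real.exp_le_exp, neg_re, exp_re (κ * (x + γ y)), sub_re, sub_re, re_ofReal_mul, re_ofReal_mul,
      re_ofReal_mul, re_ofReal_mul, im_ofReal_mul, add_re, add_im, ofReal_re, ofReal_im, zero_add]
    have h2 : (γ y).re = R y := hankelPath_re y
    have h3 : (γ y).im = hankelIm (-φ) φ y := hankelPath_im y
    rw [h2, h3]
    have : c ≤ Real.cos (κ * hankelIm (-φ) φ y) := by
      rw [← Real.cos_abs (κ * _), abs_mul, abs_of_pos hκ]
      exact Real.cos_le_cos_of_nonneg_of_le_pi (by positivity) (by linarith) (him y)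
    nlinarith [Real.exp_pos (κ * (x + R y))]
  have hγc : Continuous γ := continuous_hankelPath
  have hRc : Continuous R := continuous_hankelRe
  have hint : Integrable (Function.uncurry F) ((volume : Measure ℝ).prod volume) := by
    have hmain : Integrable (fun q : ℝ × ℝ => (κ * ‖exp (exp (γ q.2) - (n : ℝ) * γ q.2)‖) *
      Real.exp ((n + κ) * (q.1 + R q.2) - c * Real.exp (κ * (q.1 + R q.2))))
      ((volume : Measure ℝ).prod volume) := by
      rw [integrable_prod_iff' (Continuous.aestronglyMeasurable (by fun_prop))]
      refine ⟨Eventually.of_forall fun y => (hbi.comp_add_right (R y)).const_mul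
        (κ * ‖exp (exp (γ y) - (n : ℝ) * γ y)‖), ?_⟩
      have : ∀ y, (∫ x : ℝ, ‖(κ * ‖exp (exp (γ y) - (n : ℝ) * γ y)‖) *
        Real.exp ((n + κ) * (x + R y) - c * Real.exp (κ * (x + R y)))‖) =
        (κ * ‖exp (exp (γ y) - (n : ℝ) * γ y)‖) *
          ∫ x : ℝ, Real.exp ((n + κ) * x - c * Real.exp (κ * x)) := by
        intro y
        rw [← integral_add_right_eq_self
          (fun x : ℝ => Real.exp ((n + κ) * x - c * Real.exp (κ * x))) (R y), ← integral_const_mul]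
        congr 1; ext x
        exact Real.norm_of_nonneg (by positivity)
      simp_rw [this]
      refine Integrable.mul_const (Integrable.const_mul ?_ κ) _
      have := (integrable_hankel (x₀ := 0) (φm := -φ) (φp := φ) (neg_pos.2 hcos) (by linarith)
        (by rw [Real.cos_neg, neg_neg]) (by rw [neg_neg]) n).norm
      simpa [norm_hankelDir] using this
    refine hmain.mono' (AEStronglyMeasurable.const_mul (AEStronglyMeasurable.mul
      (Continuous.aestronglyMeasurable (by fun_prop)) (AEStronglyMeasurable.mul
      (Continuous.aestronglyMeasurable (by fun_prop))
      (measurable_hankelDir.comp measurable_snd).aestronglyMeasurable)) _)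
      (Eventually.of_forall fun q => hFb q.1 q.2)
  simp_rw [e1]
  rw [integral_integral_swap hint]
  have e2 : ∀ y, ∫ x, F x y = (κ / (2 * Real.pi * I)) * (Real.Gamma ((n + κ) / κ) / κ : ℝ) *
      (exp (exp (γ y) - (n : ℝ) * γ y) * D y) := by
    intro y
    have h3 : (γ y).im = hankelIm (-φ) φ y := hankelPath_im y
    rw [← integral_exp_mul_exp_neg_exp hs hκ (γ := γ y) (by rw [h3]; exact (him y).trans_lt hφ3),
      mul_assoc, ← integral_mul_const, ← integral_const_mul]
    congr 1; ext x
    simp only [hF]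
    have : exp ((n + κ : ℝ) * x) * exp (exp (γ y) - (-κ : ℝ) * γ y) =
        exp ((n + κ : ℝ) * (x + γ y)) * exp (exp (γ y) - (n : ℝ) * γ y) := by
      rw [← exp_add, ← exp_add]; congr 1; push_cast; ring
    linear_combination (κ / (2 * Real.pi * I)) * exp (-exp (κ * (x + γ y))) * D y * this
  simp_rw [e2]
  rw [integral_const_mul, integral_hankel (neg_pos.2 hcos)
      (by rw [Real.cos_neg, neg_neg]) (by rw [neg_neg]) ⟨by linarith, by linarith⟩
      ⟨by linarith, hφ2⟩]
  rw [add_div, div_self hκ.ne', hκinv, add_comm _ (1 : ℝ), add_comm (1 : ℝ) (n : ℝ),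
    Real.Gamma_nat_eq_factorial]
  have h1 : (κ : ℂ) ≠ 0 := by exact_mod_cast hκ.ne'
  have h2 : (Real.pi : ℂ) ≠ 0 := by exact_mod_cast hπ.ne'
  push_cast
  field_simp

/-- The moments may be computed on every ray on which the kernel decays. -/
theorem integral_exp_mul_ecalleKernel {k : ℝ} (hk : 0 < k) (n : ℕ) {q : ℂ}
    (hq : |q.im| < Real.pi / (2 * k)) :
    ∫ x : ℝ, exp (n * (x + q)) * ecalleKernel k (x + q) =
      (Real.Gamma (1 + n * (1 + 1 / k)) / n.factorial : ℝ) := by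
  rw [← integral_exp_mul_ecalleKernel_real hk n]
  set G : ℂ → ℂ := fun v => exp (n * v) * ecalleKernel k v with hG
  have hGd : Differentiable ℂ G := by
    have := differentiable_ecalleKernel hk
    fun_prop
  have e1 : ∫ x : ℝ, G (x + q) = ∫ x : ℝ, G (x + q.im * I) := by
    rw [← integral_add_right_eq_self (fun x : ℝ => G (x + q.im * I)) q.re]
    congr 1; ext x
    congr 1
    push_cast
    nth_rw 1 [← re_add_im q]; ring
  obtain ⟨C, hC, c, hc, hK⟩ := exists_kernel_bound hk (sub_pos.2 hq)
  have hb := (integrable_exp_sub_exp (a := n + k / (1 + k)) (by positivity) hc hk).const_mul C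
  have hGb : ∀ x y : ℝ, |y| ≤ |q.im| → ‖G (x + y * I)‖ ≤
      C * Real.exp ((n + k / (1 + k)) * x - c * Real.exp (k * x)) := by
    intro x y hy
    have := hK (x + y * I) (by simpa using hy)
    simp only [hG]
    rw [norm_mul, norm_exp]
    simp only [add_re, ofReal_re, mul_re, I_re, mul_zero, ofReal_im, I_im, mul_one, sub_self,
      add_zero, natCast_re, natCast_im, zero_mul, sub_zero] at this ⊢
    refine (mul_le_mul_of_nonneg_left this (Real.exp_pos _).le).trans_eq ?_
    rw [mul_left_comm, ← Real.exp_add]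
    congr 2; ring
  have e2 : ∫ x : ℝ, G (x + q.im * I) = ∫ x : ℝ, G (x + (0 : ℝ) * I) := by
    rcases le_total 0 q.im with h | h
    · exact (integral_line_eq_integral_line h hGd.differentiableOn hb fun x y hy => hGb x y (by
        rw [abs_of_nonneg hy.1, abs_of_nonneg h]; exact hy.2)).symm
    · exact integral_line_eq_integral_line h hGd.differentiableOn hb fun x y hy => hGb x y (by
        rw [abs_of_nonpos hy.2, abs_of_nonpos h]; linarith [hy.1])
  change ∫ x : ℝ, G (x + q) = _
  rw [e1, e2]
  simp [hG]

/-! ### Gevrey estimates for the Ecalle operator -/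

theorem rpow_mul_exp_neg_le_Gamma {L s : ℝ} (hL : 0 < L) (hs : 0 ≤ s) :
    L ^ s * Real.exp (-L) ≤ Real.Gamma (1 + s) := by
  rw [Real.Gamma_eq_integral (by linarith), add_sub_cancel_left, ← integral_exp_neg_Ioi L,
    ← integral_const_mul]
  have hi : IntegrableOn (fun x : ℝ => Real.exp (-x) * x ^ s) (Ioi 0) := by
    simpa using Real.GammaIntegral_convergent (s := 1 + s) (by linarith)
  refine (setIntegral_mono_on ((integrableOn_exp_neg_Ioi L).const_mul _) (hi.mono_set (Ioi_subset_Ioi hL.le)) measurableSet_Ioi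
    fun x hx => ?_).trans (setIntegral_mono_set hi ?_ (Ioi_subset_Ioi hL.le).eventuallyLE)
  · rw [mul_comm]
    exact mul_le_mul_of_nonneg_left (Real.rpow_le_rpow hL.le (le_of_lt hx) hs) (Real.exp_pos _).le
  · refine (ae_restrict_iff' measurableSet_Ioi).2 (Eventually.of_forall fun x hx => ?_)
    exact mul_nonneg (Real.exp_pos _).le (Real.rpow_nonneg (le_of_lt hx) _)

/-- The factors of the modified Borel transform compensate the growth `(n!)^{1/k}`. -/
theorem factorial_mul_rpow_le {k : ℝ} (hk : 0 < k) (n : ℕ) :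
    (n.factorial : ℝ) * (n.factorial : ℝ) ^ (1 / k) ≤
      Real.exp 1 ^ n * Real.Gamma (1 + n * (1 + 1 / k)) := by
  rcases Nat.eq_zero_or_pos n with rfl | hn
  · simp
  · have hn' : (0 : ℝ) < n := by exact_mod_cast hn
    have hk' : 0 < 1 / k := by positivity
    have h1 := rpow_mul_exp_neg_le_Gamma hn' (by positivity : 0 ≤ (n : ℝ) * (1 + 1 / k))
    have h2 : (n.factorial : ℝ) ≤ (n : ℝ) ^ n := by exact_mod_cast Nat.factorial_le_pow n
    have h3 : (n.factorial : ℝ) * (n.factorial : ℝ) ^ (1 / k) ≤ (n : ℝ) ^ ((n : ℝ) * (1 + 1 / k)) := by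
      calc (n.factorial : ℝ) * (n.factorial : ℝ) ^ (1 / k)
          = (n.factorial : ℝ) ^ (1 + 1 / k) := by
            rw [Real.rpow_add (by positivity), Real.rpow_one]
        _ ≤ ((n : ℝ) ^ n) ^ (1 + 1 / k) := Real.rpow_le_rpow (by positivity) h2 (by positivity)
        _ = _ := by rw [← Real.rpow_natCast, ← Real.rpow_mul hn'.le]
    rw [← Real.exp_nat_mul, mul_one]
    calc _ ≤ (n : ℝ) ^ ((n : ℝ) * (1 + 1 / k)) := h3
      _ = Real.exp n * ((n : ℝ) ^ ((n : ℝ) * (1 + 1 / k)) * Real.exp (-n)) := by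
        rw [mul_left_comm, ← Real.exp_add]; simp
      _ ≤ _ := by gcongr

theorem IsGevrey.borelCoeff_le {k ρ : ℝ} (hk : 0 < k) {a : ℕ → ℂ → ℂ}
    (h : IsGevrey (1 / k) a ρ) :
    ∃ A > 0, ∃ B > 0, ∀ n, ∀ z ∈ disc ρ, ‖borelCoeff k a n z‖ ≤ A * B ^ n := by
  obtain ⟨A, hA, B, hB, h⟩ := h
  refine ⟨A, hA, B * Real.exp 1, by positivity, fun n z hz => ?_⟩
  have hΓ : 0 < Real.Gamma (1 + n * (1 + 1 / k)) := Real.Gamma_pos_of_pos (by positivity)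
  rw [borelCoeff, norm_div, norm_mul, norm_natCast, norm_real, Real.norm_of_nonneg hΓ.le,
    div_le_iff₀ hΓ]
  calc ‖a n z‖ * n.factorial ≤ A * B ^ n * (n.factorial : ℝ) ^ (1 / k) * n.factorial := by
        gcongr; exact h n z hz
    _ = A * B ^ n * ((n.factorial : ℝ) * (n.factorial : ℝ) ^ (1 / k)) := by ring
    _ ≤ A * B ^ n * (Real.exp 1 ^ n * Real.Gamma (1 + n * (1 + 1 / k))) := by
        exact mul_le_mul_of_nonneg_left (factorial_mul_rpow_le hk n) (by positivity)
    _ = _ := by rw [mul_pow]; ring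

theorem exp_rpow_eq (x k : ℝ) : Real.exp x ^ k = Real.exp (k * x) := by
  rw [← Real.exp_mul, mul_comm]

theorem borelCoeff_mul {k : ℝ} (hk : 0 < k) (a : ℕ → ℂ → ℂ) (n : ℕ) (z : ℂ) :
    borelCoeff k a n z * ((Real.Gamma (1 + n * (1 + 1 / k)) / n.factorial : ℝ) : ℂ) = a n z := by
  have hΓ : (Real.Gamma (1 + n * (1 + 1 / k)) : ℂ) ≠ 0 := by
    exact_mod_cast (Real.Gamma_pos_of_pos (by positivity)).ne'
  have hn : (n.factorial : ℂ) ≠ 0 := by exact_mod_cast n.factorial_ne_zero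
  rw [borelCoeff, ofReal_div, ofReal_natCast, div_mul_div_comm, div_eq_iff (mul_ne_zero hΓ hn)]
  ring

/-- The Taylor remainders of `g` satisfy geometric bounds in `N`, near `s = 0` by the power series
and elsewhere by the growth of `g`. -/
theorem IsBorelContinuation.remainder_le {k d ε ρ : ℝ} (hk : 0 < k) {a : ℕ → ℂ → ℂ}
    {g : ℂ → ℂ → ℂ} (h : IsBorelContinuation k a d ε ρ g) {α : ℝ} (hα : 0 < α) (hαε : α < ε) :
    ∃ C > 0, ∃ B > 0, ∃ C₂ > 0, ∀ N : ℕ, ∀ w ∈ unboundedSector d α, ∀ z ∈ disc ρ,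
      ‖g w z - ∑ n ∈ Finset.range N, borelCoeff k a n z * exp w ^ n‖ ≤
        C * (B * Real.exp w.re) ^ N * Real.exp (C₂ * Real.exp (k * w.re)) := by
  obtain ⟨A, hA, B, hB, hb⟩ := h.gevrey.borelCoeff_le hk
  obtain ⟨C₁, hC₁, C₂, hC₂, hg⟩ := h.growth.2 α hα hαε
  obtain ⟨δ, hδ, hs⟩ := h.series
  set s := min (δ / 2) (1 / (2 * B)) with hsdef
  have hs0 : 0 < s := lt_min (by positivity) (by positivity)
  refine ⟨C₁ + 2 * A, by positivity, max (2 / s) (2 * B), by positivity, C₂, hC₂,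
    fun N w hw z hz => ?_⟩
  set X := Real.exp w.re with hX
  have hX0 : 0 < X := Real.exp_pos _
  have hE : 1 ≤ Real.exp (C₂ * Real.exp (k * w.re)) := Real.one_le_exp (by positivity)
  have hterm : ∀ n, ‖borelCoeff k a n z * exp w ^ n‖ ≤ A * (B * X) ^ n := by
    intro n
    rw [norm_mul, norm_pow, norm_exp, mul_pow, ← mul_assoc]
    exact mul_le_mul_of_nonneg_right (hb n z hz) (by positivity)
  have hBX : B * X ≤ max (2 / s) (2 * B) * X / 2 := by
    have := le_max_right (2 / s) (2 * B)
    nlinarith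
  rcases le_or_gt X s with hXs | hXs
  · have hws : w ∈ sector d ε δ := by
      refine ⟨⟨?_, ?_⟩, ?_⟩
      · linarith [hw.1]
      · linarith [hw.2]
      · change X < δ
        linarith [hXs.trans (min_le_left _ _)]
    have hBX1 : B * X ≤ 1 / 2 := by
      have := hXs.trans (min_le_right _ _)
      rw [le_div_iff₀ (by positivity)] at this
      linarith
    have h1 := (hasSum_nat_add_iff' N).2 (hs w hws z hz)
    have h2 : HasSum (fun n => A * (B * X) ^ N * (B * X) ^ n) (A * (B * X) ^ N * (1 - B * X)⁻¹) :=
      (hasSum_geometric_of_lt_one (by positivity) (by linarith)).mul_left _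
    have h3 := tsum_of_norm_bounded h2 fun n => (hterm (n + N)).trans_eq (by rw [pow_add]; ring)
    rw [h1.tsum_eq] at h3
    refine h3.trans ?_
    have h4 : (1 - B * X)⁻¹ ≤ 2 := by
      rw [inv_le_comm₀ (by linarith) (by norm_num)]; linarith
    have h5 : (B * X) ^ N ≤ (max (2 / s) (2 * B) * X) ^ N :=
      pow_le_pow_left₀ (by positivity) (by nlinarith [mul_pos hB hX0]) N
    calc A * (B * X) ^ N * (1 - B * X)⁻¹ ≤ A * (max (2 / s) (2 * B) * X) ^ N * 2 :=
          mul_le_mul (mul_le_mul_of_nonneg_left h5 hA.le) h4 (inv_nonneg.2 (by linarith))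
            (by positivity)
      _ = 2 * A * (max (2 / s) (2 * B) * X) ^ N := by ring
      _ ≤ (C₁ + 2 * A) * (max (2 / s) (2 * B) * X) ^ N := by gcongr; linarith
      _ ≤ _ := le_mul_of_one_le_right (by positivity) hE
  · set B₁ := max (2 / s) (2 * B) with hB₁
    have hB₁X : 1 ≤ B₁ * X := by
      have h1 : 2 ≤ B₁ * s := by
        have := le_max_left (2 / s) (2 * B)
        rwa [div_le_iff₀ hs0] at this
      have h2 : B₁ * s ≤ B₁ * X := by gcongr
      linarith
    have h1 : ‖g w z‖ ≤ C₁ * Real.exp (C₂ * Real.exp (k * w.re)) := by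
      have := hg w hw z hz; rwa [exp_rpow_eq] at this
    have h2 : ‖∑ n ∈ Finset.range N, borelCoeff k a n z * exp w ^ n‖ ≤ 2 * A * (B₁ * X) ^ N := by
      calc ‖∑ n ∈ Finset.range N, borelCoeff k a n z * exp w ^ n‖
          ≤ ∑ n ∈ Finset.range N, A * (B₁ * X) ^ N * (1 / 2) ^ n := by
            refine norm_sum_le_of_le _ fun n hn => (hterm n).trans ?_
            rw [mul_assoc]
            refine mul_le_mul_of_nonneg_left ?_ hA.le
            calc (B * X) ^ n ≤ (B₁ * X / 2) ^ n := pow_le_pow_left₀ (by positivity) hBX n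
              _ = (B₁ * X) ^ n * (1 / 2) ^ n := by rw [← mul_pow]; ring
              _ ≤ (B₁ * X) ^ N * (1 / 2) ^ n := by
                exact mul_le_mul_of_nonneg_right
                  (pow_le_pow_right₀ hB₁X (Finset.mem_range.1 hn).le) (by positivity)
        _ ≤ A * (B₁ * X) ^ N * 2 := by
            rw [← Finset.mul_sum]
            exact mul_le_mul_of_nonneg_left (sum_geometric_two_le N) (by positivity)
        _ = _ := by ring
    refine (norm_sub_le _ _).trans ((add_le_add h1 h2).trans ?_)
    have h3 : 1 ≤ (B₁ * X) ^ N := one_le_pow₀ hB₁X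
    have h4 : C₁ * Real.exp (C₂ * Real.exp (k * w.re)) ≤
        C₁ * (B₁ * X) ^ N * Real.exp (C₂ * Real.exp (k * w.re)) := by
      rw [mul_right_comm]; exact le_mul_of_one_le_right (by positivity) h3
    have h5 : 2 * A * (B₁ * X) ^ N ≤
        2 * A * (B₁ * X) ^ N * Real.exp (C₂ * Real.exp (k * w.re)) :=
      le_mul_of_one_le_right (by positivity) hE
    nlinarith

/-- The bound `T^N ≤ (N!)^{1/k} K^N exp (c T^k)` for `T = e^x`, which turns a power of the variable of
integration into a Gevrey factor. -/
theorem exp_mul_le_factorial_rpow {k c : ℝ} (hk : 0 < k) (hc : 0 < c) (N : ℕ) (x : ℝ) :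
    Real.exp (N * x) ≤ (N.factorial : ℝ) ^ (1 / k) * ((c * k) ^ (-(1 / k))) ^ N *
      Real.exp (c * Real.exp (k * x)) := by
  set u := c * k * Real.exp (k * x) with hu
  have hu0 : 0 < u := by positivity
  have h1 : u ^ N ≤ N.factorial * Real.exp u := by
    have := Real.pow_div_factorial_le_exp u hu0.le N
    rwa [div_le_iff₀' (by positivity)] at this
  have h2 := Real.rpow_le_rpow (by positivity) h1 (by positivity : 0 ≤ 1 / k)
  rw [Real.mul_rpow (by positivity) (by positivity), ← Real.exp_mul] at h2
  have h3 : u * (1 / k) = c * Real.exp (k * x) := by rw [hu]; field_simp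
  rw [h3] at h2
  have h4 : (u ^ N) ^ (1 / k) = ((c * k) ^ (1 / k)) ^ N * Real.exp (N * x) := by
    rw [← Real.rpow_natCast, ← Real.rpow_mul hu0.le, hu, Real.mul_rpow (by positivity)
      (by positivity), ← Real.exp_mul, ← Real.rpow_natCast, ← Real.rpow_mul (by positivity),
      mul_comm (N : ℝ) (1 / k)]
    congr 2; field_simp
  rw [h4] at h2
  have h5 : ((c * k) ^ (-(1 / k))) ^ N * ((c * k) ^ (1 / k)) ^ N = 1 := by
    rw [← mul_pow, ← Real.rpow_add (by positivity)]; simp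
  have h6 : 0 < ((c * k) ^ (-(1 / k))) ^ N := by positivity
  calc Real.exp (N * x) = ((c * k) ^ (-(1 / k))) ^ N *
        (((c * k) ^ (1 / k)) ^ N * Real.exp (N * x)) := by rw [← mul_assoc, h5, one_mul]
    _ ≤ ((c * k) ^ (-(1 / k))) ^ N *
        ((N.factorial : ℝ) ^ (1 / k) * Real.exp (c * Real.exp (k * x))) := by gcongr
    _ = _ := by ring

section ecalle

variable {k d ε α δ C c C₁ C₂ : ℝ} {G : ℂ → ℂ}

theorem mem_unboundedSector_line {θ : ℝ} (hθ : |θ - d| < α / 2) (x : ℝ) :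
    (x + θ * I : ℂ) ∈ unboundedSector d α := by
  rw [abs_lt] at hθ
  have : (x + θ * I : ℂ).im = θ := by simp
  exact ⟨by rw [this]; linarith, by rw [this]; linarith⟩

/-- The decay of the kernel beats the growth of `g` for small `|t|`. -/
theorem norm_ecalle_integrand_le
    (hK : ∀ p : ℂ, |p.im| ≤ Real.pi / (2 * k) - δ →
      ‖ecalleKernel k p‖ ≤ C * Real.exp (k / (1 + k) * p.re - c * Real.exp (k * p.re)))
    {M : ℝ} {v w : ℂ} (hG : ‖G v‖ ≤ M * Real.exp (C₂ * Real.exp (k * v.re)))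
    (hM : 0 ≤ M) (hw : |v.im - w.im| ≤ Real.pi / (2 * k) - δ)
    (hwr : C₂ * Real.exp (k * w.re) ≤ c / 2) :
    ‖G v * ecalleKernel k (v - w)‖ ≤ M * C * Real.exp (k / (1 + k) * (v.re - w.re) -
      c / 2 * Real.exp (k * (v.re - w.re))) := by
  have h1 := hK (v - w) (by simpa using hw)
  rw [norm_mul]
  refine (mul_le_mul hG h1 (norm_nonneg _) (by positivity)).trans ?_
  have h2 : M * Real.exp (C₂ * Real.exp (k * v.re)) *
      (C * Real.exp (k / (1 + k) * (v - w).re - c * Real.exp (k * (v - w).re))) =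
      M * C * Real.exp (C₂ * Real.exp (k * v.re) +
        (k / (1 + k) * (v.re - w.re) - c * Real.exp (k * (v.re - w.re)))) := by
    rw [Real.exp_add (C₂ * _), sub_re]; ring
  have hC : 0 ≤ C := by
    by_contra hC
    have := (norm_nonneg _).trans h1
    nlinarith [Real.exp_pos (k / (1 + k) * (v - w).re - c * Real.exp (k * (v - w).re))]
  rw [h2]
  refine mul_le_mul_of_nonneg_left (Real.exp_le_exp.2 ?_) (by positivity)
  have h3 : Real.exp (k * v.re) = Real.exp (k * w.re) * Real.exp (k * (v.re - w.re)) := by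
    rw [← Real.exp_add]; congr 1; ring
  rw [h3]
  nlinarith [Real.exp_pos (k * (v.re - w.re))]

variable (hk : 0 < k) (hc : 0 < c)
    (hK : ∀ p : ℂ, |p.im| ≤ Real.pi / (2 * k) - δ →
      ‖ecalleKernel k p‖ ≤ C * Real.exp (k / (1 + k) * p.re - c * Real.exp (k * p.re)))
    (hGd : DifferentiableOn ℂ G (unboundedSector d α)) (hC₁ : 0 ≤ C₁) (hC : 0 ≤ C)
    (hG : ∀ v ∈ unboundedSector d α, ‖G v‖ ≤ C₁ * Real.exp (C₂ * Real.exp (k * v.re)))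

include hk hGd in
theorem continuous_ecalle_integrand {θ : ℝ} (hθ : |θ - d| < α / 2) (w : ℂ) :
    Continuous fun x : ℝ => G (x + θ * I) * ecalleKernel k (x + θ * I - w) := by
  refine (hGd.continuousOn.comp_continuous (by fun_prop)
    (mem_unboundedSector_line hθ)).mul ?_
  exact (differentiable_ecalleKernel hk).continuous.comp (by fun_prop)

include hk hc in
theorem integrable_ecalle_bound (R : ℝ) : Integrable fun x : ℝ =>
    C₁ * C * Real.exp (k / (1 + k) * (x - R) - c / 2 * Real.exp (k * (x - R))) :=
  ((integrable_exp_sub_exp (kappa_pos hk) (half_pos hc) hk).comp_sub_right R).const_mul _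

include hk hc hK hGd hC₁ hG in
/-- The ray of integration may be rotated, by Cauchy's theorem. -/
theorem ecalle_eq_ecalle {θ₁ θ₂ : ℝ} (hθ₁ : |θ₁ - d| < α / 2) (hθ₂ : |θ₂ - d| < α / 2) {w : ℂ}
    (hw₁ : |θ₁ - w.im| ≤ Real.pi / (2 * k) - δ) (hw₂ : |θ₂ - w.im| ≤ Real.pi / (2 * k) - δ)
    (hwr : C₂ * Real.exp (k * w.re) ≤ c / 2) : ecalle k θ₁ G w = ecalle k θ₂ G w := by
  wlog h : θ₁ ≤ θ₂ generalizing θ₁ θ₂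
  · exact (this hθ₂ hθ₁ hw₂ hw₁ (le_of_not_ge h)).symm
  rw [ecalle_eq_integral, ecalle_eq_integral]
  rw [abs_lt] at hθ₁ hθ₂
  rw [abs_le] at hw₁ hw₂
  have hmem : ∀ y ∈ Icc θ₁ θ₂, |y - d| < α / 2 := fun y hy => by
    rw [abs_lt]; exact ⟨by linarith [hy.1], by linarith [hy.2]⟩
  refine integral_line_eq_integral_line (G := fun v => G v * ecalleKernel k (v - w)) h ?_
    (integrable_ecalle_bound (C₁ := C₁) (C := C) hk hc w.re) fun x y hy => ?_
  · refine DifferentiableOn.mul (hGd.mono fun v hv => ?_) ?_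
    · have := mem_unboundedSector_line (hmem _ hv) v.re
      rwa [re_add_im] at this
    · have := differentiable_ecalleKernel hk
      fun_prop
  · have := norm_ecalle_integrand_le (v := x + y * I) hK (hG _ (mem_unboundedSector_line (hmem y hy) x)) hC₁
      (w := w) (by
        simp only [add_im, ofReal_im, mul_im, ofReal_re, I_im, mul_one, I_re, mul_zero, add_zero,
          zero_add]
        rw [abs_le]; exact ⟨by linarith [hy.1], by linarith [hy.2]⟩) hwr
    simpa using this

include hk hc hK hGd hC₁ hC hG in
theorem differentiableOn_ecalle {θ : ℝ} (hθ : |θ - d| < α / 2) {U : Set ℂ} (hU : IsOpen U)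
    (hUw : ∀ w ∈ U, |θ - w.im| ≤ Real.pi / (2 * k) - δ ∧ C₂ * Real.exp (k * w.re) ≤ c / 2) :
    DifferentiableOn ℂ (ecalle k θ G) U := by
  have e : ecalle k θ G = fun w => ∫ x : ℝ, G (x + θ * I) * ecalleKernel k (x + θ * I - w) :=
    funext fun w => ecalle_eq_integral k θ G w
  rw [e]
  refine differentiableOn_integral_one hU (fun x => ?_) (fun w _ =>
    (continuous_ecalle_integrand hk hGd hθ w).aestronglyMeasurable) fun p hp => ?_
  · have := differentiable_ecalleKernel hk
    fun_prop
  · have hbi : Integrable fun x : ℝ => C₁ * C * Real.exp (2 * (k / (1 + k))) *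
        Real.exp (k / (1 + k) * (x - (p.re + 1)) - c / 2 * Real.exp (k * (x - (p.re + 1)))) :=
      ((integrable_exp_sub_exp (kappa_pos hk) (half_pos hc) hk).comp_sub_right _).const_mul _
    refine ⟨1, one_pos, _, hbi, fun w hw x => ?_⟩
    have := norm_ecalle_integrand_le (v := x + θ * I) hK (hG _ (mem_unboundedSector_line hθ x)) hC₁
      (w := w) (by simpa using (hUw w hw.2).1) (hUw w hw.2).2
    refine this.trans ?_
    rw [mul_assoc (C₁ * C), ← Real.exp_add]
    refine mul_le_mul_of_nonneg_left (Real.exp_le_exp.2 ?_) (by positivity)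
    simp only [add_re, ofReal_re, mul_re, I_re, mul_zero, ofReal_im, I_im, mul_one, sub_self,
      add_zero]
    have h1 : |w.re - p.re| < 1 := by
      have h2 := abs_re_le_norm (w - p)
      have h3 := hw.1
      rw [mem_ball, dist_eq_norm] at h3
      rw [sub_re] at h2; linarith
    rw [abs_lt] at h1
    have h4 : Real.exp (k * (x - (p.re + 1))) ≤ Real.exp (k * (x - w.re)) :=
      Real.exp_le_exp.2 (mul_le_mul_of_nonneg_left (by linarith) hk.le)
    have h5 : k / (1 + k) * (x - w.re) ≤ 2 * (k / (1 + k)) + k / (1 + k) * (x - (p.re + 1)) := by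
      have := kappa_pos hk
      nlinarith
    nlinarith

end ecalle

theorem integrable_exp_mul_ecalleKernel {k : ℝ} (hk : 0 < k) (n : ℕ) {q : ℂ}
    (hq : |q.im| < Real.pi / (2 * k)) :
    Integrable fun x : ℝ => exp (n * (x + q)) * ecalleKernel k (x + q) := by
  obtain ⟨C, hC, c, hc, hK⟩ := exists_kernel_bound hk (sub_pos.2 hq)
  have hκ := kappa_pos hk
  have hb := (((integrable_exp_sub_exp (a := n + k / (1 + k)) (by positivity) hc hk).const_mul
    C).comp_add_right q.re)
  have hd := differentiable_ecalleKernel hk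
  refine hb.mono' (Continuous.aestronglyMeasurable ?_) (Eventually.of_forall fun x => ?_)
  · have := hd.continuous
    fun_prop
  · have := hK (x + q) (by simp)
    rw [norm_mul, norm_exp]
    simp only [add_re, ofReal_re, mul_re, natCast_re, natCast_im, zero_mul, sub_zero] at this ⊢
    refine (mul_le_mul_of_nonneg_left this (Real.exp_pos _).le).trans_eq ?_
    rw [mul_left_comm, ← Real.exp_add]
    congr 2; ring

/-- The Ecalle operator inverts the modified Borel transform, with Gevrey estimates: the Taylor
polynomials of `g` are mapped to those of `û`, and the remainders are estimated. -/
theorem norm_ecalle_sub_le {k d α δ C c C₁ C₂ B θ : ℝ} {a : ℕ → ℂ → ℂ} {g : ℂ → ℂ} {z : ℂ}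
    (hk : 0 < k) (hc : 0 < c) (hδ : 0 < δ)
    (hK : ∀ p : ℂ, |p.im| ≤ Real.pi / (2 * k) - δ →
      ‖ecalleKernel k p‖ ≤ C * Real.exp (k / (1 + k) * p.re - c * Real.exp (k * p.re)))
    (hC₁ : 0 ≤ C₁) (hC : 0 ≤ C) (hB : 0 ≤ B)
    (hgd : DifferentiableOn ℂ g (unboundedSector d α))
    (hg : ∀ N : ℕ, ∀ w ∈ unboundedSector d α,
      ‖g w - ∑ n ∈ Finset.range N, borelCoeff k a n z * exp w ^ n‖ ≤
        C₁ * (B * Real.exp w.re) ^ N * Real.exp (C₂ * Real.exp (k * w.re)))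
    (hθ : |θ - d| < α / 2) {w : ℂ} (hw : |θ - w.im| ≤ Real.pi / (2 * k) - δ)
    (hwr : C₂ * Real.exp (k * w.re) ≤ c / 2) (N : ℕ) :
    ‖ecalle k θ g w - ∑ n ∈ Finset.range N, a n z * exp w ^ n‖ ≤
      (C₁ * C * ∫ x : ℝ, Real.exp (k / (1 + k) * x - c / 4 * Real.exp (k * x))) *
        (B * (c / 4 * k) ^ (-(1 / k))) ^ N * (N.factorial : ℝ) ^ (1 / k) * Real.exp w.re ^ N := by
  have hκ := kappa_pos hk
  set q : ℂ := θ * I - w with hq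
  have hqim : |q.im| < Real.pi / (2 * k) := by
    have : q.im = θ - w.im := by simp [hq]
    rw [this]; linarith
  have hxq : ∀ x : ℝ, (x + θ * I - w : ℂ) = x + q := fun x => by rw [hq]; ring
  have hmono : ∀ n : ℕ, ∀ x : ℝ, exp (x + θ * I) ^ n * ecalleKernel k (x + θ * I - w) =
      exp w ^ n * (exp (n * (x + q)) * ecalleKernel k (x + q)) := by
    intro n x
    rw [hxq, ← exp_nat_mul, ← exp_nat_mul, ← mul_assoc, ← exp_add]
    congr 2; rw [hq]; ring
  have hmi : ∀ n : ℕ, Integrable fun x : ℝ => borelCoeff k a n z *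
      (exp (x + θ * I) ^ n * ecalleKernel k (x + θ * I - w)) := by
    intro n
    simp_rw [hmono]
    exact ((integrable_exp_mul_ecalleKernel hk n hqim).const_mul _).const_mul _
  have hmv : ∀ n : ℕ, ∫ x : ℝ, borelCoeff k a n z *
      (exp (x + θ * I) ^ n * ecalleKernel k (x + θ * I - w)) = a n z * exp w ^ n := by
    intro n
    simp_rw [hmono]
    rw [integral_const_mul, integral_const_mul, integral_exp_mul_ecalleKernel hk n hqim,
      ← borelCoeff_mul hk a n z]
    ring
  set G : ℂ → ℂ := fun v => g v - ∑ n ∈ Finset.range N, borelCoeff k a n z * exp v ^ n with hG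
  have hGd : DifferentiableOn ℂ G (unboundedSector d α) :=
    hgd.sub (Differentiable.differentiableOn (by fun_prop))
  -- the kernel splits: half of its decay absorbs `g`, a quarter the power of the variable
  have hb : ∀ x : ℝ, ‖G (x + θ * I) * ecalleKernel k (x + θ * I - w)‖ ≤
      (C₁ * C * (B * (c / 4 * k) ^ (-(1 / k))) ^ N * (N.factorial : ℝ) ^ (1 / k) *
        Real.exp w.re ^ N) * Real.exp (k / (1 + k) * (x - w.re) -
          c / 4 * Real.exp (k * (x - w.re))) := by
    intro x
    have h1 := hg N (x + θ * I) (mem_unboundedSector_line hθ x)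
    have hre : (x + θ * I : ℂ).re = x := by simp
    have him : (x + θ * I : ℂ).im = θ := by simp
    have h2 := norm_ecalle_integrand_le hK (G := G) h1 (by positivity) (w := w)
      (by rw [him]; exact hw) hwr
    rw [hre] at h2
    refine h2.trans ?_
    have h3 := exp_mul_le_factorial_rpow hk (by positivity : 0 < c / 4) N (x - w.re)
    have h4 : (B * Real.exp x) ^ N = B ^ N * Real.exp w.re ^ N * Real.exp (N * (x - w.re)) := by
      rw [mul_pow, ← Real.exp_nat_mul, ← Real.exp_nat_mul, mul_assoc, ← Real.exp_add]
      congr 2; ring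
    have h5 : Real.exp (k / (1 + k) * (x - w.re) - c / 4 * Real.exp (k * (x - w.re))) =
        Real.exp (c / 4 * Real.exp (k * (x - w.re))) *
          Real.exp (k / (1 + k) * (x - w.re) - c / 2 * Real.exp (k * (x - w.re))) := by
      rw [← Real.exp_add]; congr 1; ring
    rw [h4, h5, mul_pow]
    calc _ = C₁ * C * B ^ N * Real.exp w.re ^ N * Real.exp (k / (1 + k) * (x - w.re) -
          c / 2 * Real.exp (k * (x - w.re))) * Real.exp (N * (x - w.re)) := by ring
      _ ≤ C₁ * C * B ^ N * Real.exp w.re ^ N * Real.exp (k / (1 + k) * (x - w.re) -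
          c / 2 * Real.exp (k * (x - w.re))) * ((N.factorial : ℝ) ^ (1 / k) *
            ((c / 4 * k) ^ (-(1 / k))) ^ N * Real.exp (c / 4 * Real.exp (k * (x - w.re)))) :=
          mul_le_mul_of_nonneg_left h3 (by positivity)
      _ = _ := by ring
  have hbi : Integrable fun x : ℝ => Real.exp (k / (1 + k) * (x - w.re) -
      c / 4 * Real.exp (k * (x - w.re))) :=
    (integrable_exp_sub_exp hκ (by positivity) hk).comp_sub_right w.re
  have hGi : Integrable fun x : ℝ => G (x + θ * I) * ecalleKernel k (x + θ * I - w) :=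
    (hbi.const_mul _).mono' (continuous_ecalle_integrand hk hGd hθ w).aestronglyMeasurable
      (Eventually.of_forall hb)
  have hsplit : ecalle k θ g w - ∑ n ∈ Finset.range N, a n z * exp w ^ n =
      ∫ x : ℝ, G (x + θ * I) * ecalleKernel k (x + θ * I - w) := by
    rw [sub_eq_iff_eq_add, ecalle_eq_integral, ← Finset.sum_congr rfl fun n _ => hmv n,
      ← integral_finsetSum _ fun n _ => hmi n,
      ← integral_add hGi (integrable_finsetSum _ fun n _ => hmi n)]
    congr 1; ext x
    simp only [hG]
    rw [sub_mul, Finset.sum_mul]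
    simp_rw [mul_assoc]
    ring
  rw [hsplit]
  refine (norm_integral_le_of_norm_le (hbi.const_mul _) (Eventually.of_forall hb)).trans_eq ?_
  rw [integral_const_mul, integral_sub_right_eq_self
    (fun x : ℝ => Real.exp (k / (1 + k) * x - c / 4 * Real.exp (k * x))) w.re]
  ring

/-- The `k`-sum is holomorphic, with Gevrey expansion `û`, in a sector of opening larger than
`π/k`. -/
theorem IsBorelContinuation.exists_sum {k d ε ρ : ℝ} (hk : 0 < k) (hε : 0 < ε) {a : ℕ → ℂ → ℂ}
    {g : ℂ → ℂ → ℂ} (h : IsBorelContinuation k a d ε ρ g) :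
    ∃ η > 0, η < ε / 4 ∧ ∃ ℓ : ℝ, ∃ A > 0, ∃ B > 0, ∃ F : ℂ → ℂ → ℂ,
      (∀ z ∈ disc ρ, DifferentiableOn ℂ (fun w => F w z)
        {w | |w.im - d| < Real.pi / (2 * k) + η ∧ w.re < ℓ}) ∧
      (∀ θ, |θ - d| ≤ η → ∀ w : ℂ, |w.im - θ| < η → w.re < ℓ → ∀ z ∈ disc ρ,
        F w z = ecalle k θ (fun s => g s z) w) ∧
      ∀ N : ℕ, ∀ w : ℂ, |w.im - d| < Real.pi / (2 * k) + η → w.re < ℓ → ∀ z ∈ disc ρ,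
        ‖F w z - ∑ n ∈ Finset.range N, a n z * exp w ^ n‖ ≤
          A * B ^ N * (N.factorial : ℝ) ^ (1 / k) * Real.exp w.re ^ N := by
  have hπ := Real.pi_pos
  have hκ := kappa_pos hk
  set e := min (ε / 8) (Real.pi / (2 * k) / 4) with he
  have hpk : 0 < Real.pi / (2 * k) := by positivity
  have he0 : 0 < e := lt_min (by positivity) (by positivity)
  have he1 : e ≤ ε / 8 := min_le_left _ _
  have he2 : e ≤ Real.pi / (2 * k) / 4 := min_le_right _ _
  obtain ⟨C₁, hC₁, B, hB, C₂, hC₂, hrem⟩ := h.remainder_le hk (α := 3 * ε / 4)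
    (by positivity) (by linarith)
  obtain ⟨C, hC, c, hc, hK⟩ := exists_kernel_bound hk he0
  set ℓ := Real.log (c / (2 * C₂)) / k with hℓ
  have hwr : ∀ w : ℂ, w.re < ℓ → C₂ * Real.exp (k * w.re) ≤ c / 2 := by
    intro w hw
    rw [hℓ, lt_div_iff₀ hk, Real.lt_log_iff_exp_lt (by positivity), lt_div_iff₀ (by positivity),
      mul_comm w.re] at hw
    linarith
  -- `F w` is computed along the ray closest to `w`; nearby rays give the same value
  set T : ℂ → ℝ := fun w => max (d - 2 * e) (min w.im (d + 2 * e)) with hT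
  have hT1 : ∀ w, |T w - d| < 3 * ε / 4 / 2 := by
    intro w
    have h1 : d - 2 * e ≤ T w := le_max_left _ _
    have h2 : T w ≤ d + 2 * e := max_le (by linarith) (min_le_right _ _)
    rw [abs_lt]; constructor <;> linarith
  have hT2 : ∀ w : ℂ, |w.im - d| < Real.pi / (2 * k) + e → |T w - w.im| < Real.pi / (2 * k) - e := by
    intro w hw
    rw [abs_lt] at hw ⊢
    simp only [hT]
    rcases max_cases (d - 2 * e) (min w.im (d + 2 * e)) with h1 | h1 <;>
      rcases min_cases w.im (d + 2 * e) with h2 | h2 <;> constructor <;> linarith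
  have hGd : ∀ z ∈ disc ρ, DifferentiableOn ℂ (fun s => g s z) (unboundedSector d (3 * ε / 4)) :=
    fun z hz => (h.growth.1.fst hz).mono fun w hw =>
      ⟨by linarith [hw.1], by linarith [hw.2]⟩
  have hG0 : ∀ z ∈ disc ρ, ∀ v ∈ unboundedSector d (3 * ε / 4),
      ‖g v z‖ ≤ C₁ * Real.exp (C₂ * Real.exp (k * v.re)) := by
    intro z hz v hv
    simpa using hrem 0 v hv z hz
  have hJ : 0 ≤ ∫ x : ℝ, Real.exp (k / (1 + k) * x - c / 4 * Real.exp (k * x)) :=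
    integral_nonneg fun x => (Real.exp_pos _).le
  refine ⟨e, he0, by linarith, ℓ,
    C₁ * C * (∫ x : ℝ, Real.exp (k / (1 + k) * x - c / 4 * Real.exp (k * x))) + 1, by positivity,
    B * (c / 4 * k) ^ (-(1 / k)), by positivity,
    fun w z => ecalle k (T w) (fun s => g s z) w, fun z hz => ?_, fun θ hθ w hw hwl z hz => ?_,
    fun N w hw hwl z hz => ?_⟩
  · intro w₀ hw₀
    set U : Set ℂ := {w | |w.im - T w₀| < Real.pi / (2 * k) - e ∧
      |w.im - d| < Real.pi / (2 * k) + e ∧ w.re < ℓ} with hU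
    have hUo : IsOpen U :=
      (isOpen_lt (continuous_im.sub continuous_const).abs continuous_const).inter
        ((isOpen_lt (continuous_im.sub continuous_const).abs continuous_const).inter
          (isOpen_lt continuous_re continuous_const))
    have hd := differentiableOn_ecalle (θ := T w₀) hk hc hK (hGd z hz) hC₁.le hC.le (hG0 z hz)
      (hT1 w₀) hUo fun w hw => ⟨by rw [abs_sub_comm]; exact hw.1.le, hwr w hw.2.2⟩
    have hw₀U : w₀ ∈ U := ⟨by rw [abs_sub_comm]; exact hT2 w₀ hw₀.1, hw₀⟩
    refine ((hd.differentiableAt (hUo.mem_nhds hw₀U)).congr_of_eventuallyEq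
      ?_).differentiableWithinAt
    filter_upwards [hUo.mem_nhds hw₀U] with w hw
    exact ecalle_eq_ecalle hk hc hK (hGd z hz) hC₁.le (hG0 z hz) (hT1 w) (hT1 w₀)
      (hT2 w hw.2.1).le (by rw [abs_sub_comm]; exact hw.1.le) (hwr w hw.2.2)
  · have hwd : |w.im - d| < Real.pi / (2 * k) + e := by
      have := abs_sub_le w.im θ d
      linarith
    exact ecalle_eq_ecalle hk hc hK (hGd z hz) hC₁.le (hG0 z hz) (hT1 w) (by linarith)
      (hT2 w hwd).le (by rw [abs_sub_comm]; linarith) (hwr w hwl)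
  · refine (norm_ecalle_sub_le hk hc he0 hK hC₁.le hC.le hB.le (hGd z hz)
      (fun N v hv => hrem N v hv z hz) (hT1 w) (hT2 w hw).le (hwr w hwl) N).trans ?_
    gcongr
    linarith

/-! ### Gevrey asymptotic expansions -/

/-- The truncated sector `{t : α < arg t < β, |t| < e^ℓ}` in logarithmic coordinates. -/
def strip (α β ℓ : ℝ) : Set ℂ := {w | (α < w.im ∧ w.im < β) ∧ w.re < ℓ}

theorem isOpen_strip (α β ℓ : ℝ) : IsOpen (strip α β ℓ) :=
  ((isOpen_lt continuous_const continuous_im).inter (isOpen_lt continuous_im continuous_const)).inter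
    (isOpen_lt continuous_re continuous_const)

theorem convex_strip (α β ℓ : ℝ) : Convex ℝ (strip α β ℓ) :=
  ((convex_halfSpace_im_gt _).inter (convex_halfSpace_im_lt _)).inter (convex_halfSpace_re_lt _)

theorem strip_mono {α β ℓ α' β' ℓ' : ℝ} (hα : α ≤ α') (hβ : β' ≤ β) (hℓ : ℓ' ≤ ℓ) :
    strip α' β' ℓ' ⊆ strip α β ℓ := fun _ hw =>
  ⟨⟨hα.trans_lt hw.1.1, hw.1.2.trans_le hβ⟩, hw.2.trans_le hℓ⟩

theorem strip_nonempty {α β : ℝ} (h : α < β) (ℓ : ℝ) : (strip α β ℓ).Nonempty :=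
  ⟨⟨ℓ - 1, (α + β) / 2⟩, ⟨by simp; linarith, by simp; linarith⟩, by simp⟩

theorem strip_subset_puncturedDisc (α β : ℝ) {ℓ r : ℝ} (hr : 0 < r) (h : ℓ ≤ Real.log r) :
    strip α β ℓ ⊆ puncturedDisc r := fun _ hw => (mem_puncturedDisc_iff hr).2 (hw.2.trans_le h)

/-- `f ∼ ∑ aₙ(z) tⁿ` on `S × D_ρ`, with remainders of Gevrey order `s` uniformly on `S × D_ρ`. -/
def GevreyBound (s : ℝ) (f : ℂ → ℂ → ℂ) (a : ℕ → ℂ → ℂ) (S : Set ℂ) (ρ : ℝ) : Prop :=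
  ∃ A > 0, ∃ B > 0, ∀ N : ℕ, ∀ w ∈ S, ∀ z ∈ disc ρ,
    ‖f w z - ∑ n ∈ Finset.range N, a n z * exp w ^ n‖ ≤
      A * B ^ N * (N.factorial : ℝ) ^ s * Real.exp w.re ^ N

/-- `f` has the Gevrey asymptotic expansion `∑ aₙ(z) tⁿ` of order `s` at `t = 0` on every proper
subsector of `α < arg t < β`; the radius and the disc in `z` may depend on the subsector. -/
def HasGevreyExpansion (s : ℝ) (f : ℂ → ℂ → ℂ) (a : ℕ → ℂ → ℂ) (α β : ℝ) : Prop :=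
  ∀ α' β', α < α' → β' < β → ∃ ℓ, ∃ ρ > 0, GevreyBound s f a (strip α' β' ℓ) ρ

theorem GevreyBound.mono {s : ℝ} {f : ℂ → ℂ → ℂ} {a : ℕ → ℂ → ℂ} {S S' : Set ℂ} {ρ ρ' : ℝ}
    (h : GevreyBound s f a S ρ) (hS : S' ⊆ S) (hρ : ρ' ≤ ρ) : GevreyBound s f a S' ρ' := by
  obtain ⟨A, hA, B, hB, h⟩ := h
  exact ⟨A, hA, B, hB, fun N w hw z hz => h N w (hS hw) z (ball_subset_ball hρ hz)⟩

theorem GevreyBound.congr {s : ℝ} {f g : ℂ → ℂ → ℂ} {a : ℕ → ℂ → ℂ} {S : Set ℂ} {ρ : ℝ}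
    (h : GevreyBound s f a S ρ) (hfg : ∀ w ∈ S, ∀ z ∈ disc ρ, g w z = f w z) :
    GevreyBound s g a S ρ := by
  obtain ⟨A, hA, B, hB, h⟩ := h
  exact ⟨A, hA, B, hB, fun N w hw z hz => hfg w hw z hz ▸ h N w hw z hz⟩

theorem GevreyBound.add {s : ℝ} {f g : ℂ → ℂ → ℂ} {a b : ℕ → ℂ → ℂ} {S : Set ℂ} {ρ : ℝ}
    (hf : GevreyBound s f a S ρ) (hg : GevreyBound s g b S ρ) :
    GevreyBound s (fun w z => f w z + g w z) (fun n z => a n z + b n z) S ρ := by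
  obtain ⟨A, hA, B, hB, h⟩ := hf
  obtain ⟨A', hA', B', hB', h'⟩ := hg
  refine ⟨A + A', by positivity, max B B', lt_max_of_lt_left hB, fun N w hw z hz => ?_⟩
  simp only [add_mul, Finset.sum_add_distrib]
  rw [add_sub_add_comm]
  refine (norm_add_le _ _).trans (add_le_add ((h N w hw z hz).trans ?_) ((h' N w hw z hz).trans ?_))
  · gcongr; exact le_max_left _ _
  · gcongr; exact le_max_right _ _

theorem GevreyBound.const_mul {s : ℝ} {f : ℂ → ℂ → ℂ} {a : ℕ → ℂ → ℂ} {S : Set ℂ} {ρ : ℝ}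
    (hf : GevreyBound s f a S ρ) (c : ℂ) :
    GevreyBound s (fun w z => c * f w z) (fun n z => c * a n z) S ρ := by
  obtain ⟨A, hA, B, hB, h⟩ := hf
  refine ⟨(‖c‖ + 1) * A, by positivity, B, hB, fun N w hw z hz => ?_⟩
  simp only [mul_assoc]
  rw [← Finset.mul_sum, ← mul_sub, norm_mul]
  have := h N w hw z hz
  simp only [mul_assoc] at this
  gcongr
  linarith

theorem GevreyBound.zero (s : ℝ) (S : Set ℂ) (ρ : ℝ) :
    GevreyBound s (fun _ _ => 0) (fun _ _ => 0) S ρ :=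
  ⟨1, one_pos, 1, one_pos, fun N w _ z _ => by simp; positivity⟩

theorem HasGevreyExpansion.add {s α β : ℝ} {f g : ℂ → ℂ → ℂ} {a b : ℕ → ℂ → ℂ}
    (hf : HasGevreyExpansion s f a α β) (hg : HasGevreyExpansion s g b α β) :
    HasGevreyExpansion s (fun w z => f w z + g w z) (fun n z => a n z + b n z) α β := by
  intro α' β' hα hβ
  obtain ⟨ℓ₁, ρ₁, h₁, hf⟩ := hf α' β' hα hβ
  obtain ⟨ℓ₂, ρ₂, h₂, hg⟩ := hg α' β' hα hβ
  exact ⟨min ℓ₁ ℓ₂, min ρ₁ ρ₂, lt_min h₁ h₂,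
    (hf.mono (strip_mono le_rfl le_rfl (min_le_left _ _)) (min_le_left _ _)).add
      (hg.mono (strip_mono le_rfl le_rfl (min_le_right _ _)) (min_le_right _ _))⟩

theorem HasGevreyExpansion.const_mul {s α β : ℝ} {f : ℂ → ℂ → ℂ} {a : ℕ → ℂ → ℂ}
    (hf : HasGevreyExpansion s f a α β) (c : ℂ) :
    HasGevreyExpansion s (fun w z => c * f w z) (fun n z => c * a n z) α β := by
  intro α' β' hα hβ
  obtain ⟨ℓ, ρ, h, hf⟩ := hf α' β' hα hβ
  exact ⟨ℓ, ρ, h, hf.const_mul c⟩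

theorem HasGevreyExpansion.sum {ι : Type*} (T : Finset ι) {s α β : ℝ} {f : ι → ℂ → ℂ → ℂ}
    {a : ι → ℕ → ℂ → ℂ} (hf : ∀ i ∈ T, HasGevreyExpansion s (f i) (a i) α β) :
    HasGevreyExpansion s (fun w z => ∑ i ∈ T, f i w z) (fun n z => ∑ i ∈ T, a i n z) α β := by
  classical
  induction T using Finset.induction_on with
  | empty =>
    intro α' β' _ _
    exact ⟨0, 1, one_pos, by simpa using GevreyBound.zero s _ 1⟩
  | insert i T hi ih =>
    simp only [Finset.sum_insert hi]
    exact (hf i (Finset.mem_insert_self i T)).add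
      (ih fun j hj => hf j (Finset.mem_insert_of_mem hj))

theorem add_one_rpow_le {s : ℝ} (hs : 0 ≤ s) (N : ℕ) :
    ((N : ℝ) + 1) ^ s ≤ Real.exp s ^ N := by
  calc ((N : ℝ) + 1) ^ s ≤ Real.exp N ^ s :=
        Real.rpow_le_rpow (by positivity) (Real.add_one_le_exp _) hs
    _ = Real.exp s ^ N := by rw [← Real.exp_mul, ← Real.exp_nat_mul]

/-- An expansion may be differentiated in `t`, by Cauchy's estimate on discs of fixed radius in
the coordinate `log t`. -/
theorem HasGevreyExpansion.dt {s α β r ρ₀ : ℝ} (hs : 0 ≤ s) (hr : 0 < r) (hρ₀ : 0 < ρ₀)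
    {f : ℂ → ℂ → ℂ} {a : ℕ → ℂ → ℂ} (hf : HolomorphicOn (puncturedDisc r) ρ₀ f)
    (h : HasGevreyExpansion s f a α β) : HasGevreyExpansion s (dt f) (formalDt a) α β := by
  intro α' β' hα hβ
  set δ := min ((α' - α) / 2) ((β - β') / 2) with hδ
  have hδ0 : 0 < δ := lt_min (by linarith) (by linarith)
  have hδ1 : δ ≤ (α' - α) / 2 := min_le_left _ _
  have hδ2 : δ ≤ (β - β') / 2 := min_le_right _ _
  obtain ⟨ℓ, ρ, hρ, A, hA, B, hB, hb⟩ := h (α' - δ) (β' + δ) (by linarith) (by linarith)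
  have hmem : ∀ w ∈ strip α' β' (min ℓ (Real.log r) - δ), ∀ v ∈ closedBall w δ,
      v ∈ strip (α' - δ) (β' + δ) ℓ ∧ v ∈ puncturedDisc r ∧ v.re ≤ w.re + δ := by
    intro w hw v hv
    rw [mem_closedBall, dist_eq] at hv
    have h1 := (abs_le.1 ((abs_re_le_norm _).trans hv))
    have h2 := (abs_le.1 ((abs_im_le_norm _).trans hv))
    simp only [sub_re, sub_im] at h1 h2
    have h3 := hw.2
    have h4 := hw.1
    have h5 := min_le_left ℓ (Real.log r)
    have h6 := min_le_right ℓ (Real.log r)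
    refine ⟨⟨⟨by linarith, by linarith⟩, by linarith⟩, (mem_puncturedDisc_iff hr).2 (by linarith),
      by linarith⟩
  refine ⟨min ℓ (Real.log r) - δ, min ρ ρ₀, lt_min hρ hρ₀, A * B * Real.exp δ / δ, by positivity,
    B * Real.exp δ * Real.exp s, by positivity, fun N w hw z hz => ?_⟩
  have hz1 : z ∈ disc ρ := ball_subset_ball (min_le_left _ _) hz
  have hz2 : z ∈ disc ρ₀ := ball_subset_ball (min_le_right _ _) hz
  have hfd := hf.fst hz2
  have hwP : w ∈ puncturedDisc r := (hmem w hw w (mem_closedBall_self hδ0.le)).2.1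
  set Q : ℂ → ℂ := fun v => f v z - ∑ n ∈ Finset.range (N + 1), a n z * exp v ^ n with hQ
  have hQd : DifferentiableOn ℂ Q (puncturedDisc r) := hfd.sub (by fun_prop)
  have hder : deriv Q w = deriv (fun v => f v z) w -
      ∑ n ∈ Finset.range (N + 1), a n z * (n * exp w ^ n) := by
    refine HasDerivAt.deriv (HasDerivAt.sub
      (hfd.differentiableAt ((isOpen_puncturedDisc r).mem_nhds hwP)).hasDerivAt
      (HasDerivAt.fun_sum fun n _ => HasDerivAt.const_mul _ ?_))
    simp only [← Complex.exp_nat_mul]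
    simpa [mul_comm] using ((hasDerivAt_id w).const_mul (n : ℂ)).cexp
  have hc : ‖deriv Q w‖ ≤
      A * B ^ (N + 1) * ((N + 1).factorial : ℝ) ^ s * Real.exp (w.re + δ) ^ (N + 1) / δ := by
    refine norm_deriv_le_of_forall_mem_sphere_norm_le hδ0 ?_ fun v hv => ?_
    · refine (hQd.mono fun v hv => (hmem w hw v ?_).2.1).diffContOnCl
      exact closure_ball_subset_closedBall hv
    · have hv' := hmem w hw v (sphere_subset_closedBall hv)
      refine (hb (N + 1) v hv'.1 z hz1).trans ?_
      gcongr
      exact hv'.2.2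
  have heq : StokesPDE.dt f w z - ∑ n ∈ Finset.range N, formalDt a n z * exp w ^ n =
      exp (-w) * deriv Q w := by
    rw [hder, Finset.sum_range_succ', mul_sub, StokesPDE.dt]
    congr 1
    simp only [formalDt, Nat.cast_zero, zero_mul, mul_zero, add_zero, Finset.mul_sum]
    refine Finset.sum_congr rfl fun n _ => ?_
    have : exp (-w) * exp w = 1 := by rw [← Complex.exp_add]; simp
    push_cast
    linear_combination (-((n : ℂ) + 1) * a (n + 1) z * exp w ^ n) * this
  rw [heq, norm_mul, norm_exp, neg_re]
  have hfac : ((N + 1).factorial : ℝ) ^ s ≤ Real.exp s ^ N * (N.factorial : ℝ) ^ s := by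
    rw [Nat.factorial_succ]; push_cast
    rw [Real.mul_rpow (by positivity) (by positivity)]
    gcongr
    exact add_one_rpow_le hs N
  calc Real.exp (-w.re) * ‖deriv Q w‖
      ≤ Real.exp (-w.re) * (A * B ^ (N + 1) * (Real.exp s ^ N * (N.factorial : ℝ) ^ s) *
          Real.exp (w.re + δ) ^ (N + 1) / δ) := by
        gcongr
        refine hc.trans ?_
        gcongr
    _ = _ := by
        have : Real.exp (-w.re) * Real.exp w.re = 1 := by rw [← Real.exp_add]; simp
        rw [Real.exp_add, mul_pow (Real.exp w.re), mul_pow, mul_pow, pow_succ (Real.exp w.re),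
          pow_succ B, pow_succ (Real.exp δ)]
        field_simp
        linear_combination this

theorem HasGevreyExpansion.dt_iterate {s α β r ρ₀ : ℝ} (hs : 0 ≤ s) (hr : 0 < r) (hρ₀ : 0 < ρ₀)
    {f : ℂ → ℂ → ℂ} {a : ℕ → ℂ → ℂ} (hf : HolomorphicOn (puncturedDisc r) ρ₀ f)
    (h : HasGevreyExpansion s f a α β) (j : ℕ) :
    HasGevreyExpansion s (StokesPDE.dt^[j] f) (formalDt^[j] a) α β := by
  induction j with
  | zero => exact h
  | succ j ih =>
    simp only [Function.iterate_succ_apply']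
    exact ih.dt hs hr hρ₀ (hf.dt_iterate (isOpen_puncturedDisc r) j)

/-- An expansion may be differentiated in `z`, by Cauchy's estimate. -/
theorem HasGevreyExpansion.deriv_snd {s α β r ρ₀ ρ₁ : ℝ} (hr : 0 < r) (hρ₀ : 0 < ρ₀)
    (hρ₁ : 0 < ρ₁) {f : ℂ → ℂ → ℂ} {a : ℕ → ℂ → ℂ} (hf : HolomorphicOn (puncturedDisc r) ρ₀ f)
    (ha : ∀ n, DifferentiableOn ℂ (a n) (disc ρ₁)) (h : HasGevreyExpansion s f a α β) :
    HasGevreyExpansion s (fun w z => deriv (f w) z) (fun n z => deriv (a n) z) α β := by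
  intro α' β' hα hβ
  obtain ⟨ℓ, ρ, hρ, A, hA, B, hB, hb⟩ := h α' β' hα hβ
  set δ := min ρ (min ρ₀ ρ₁) / 3 with hδ
  have hδ0 : 0 < δ := by positivity
  have hm1 := min_le_left ρ (min ρ₀ ρ₁)
  have hm2 := (min_le_right ρ (min ρ₀ ρ₁)).trans (min_le_left _ _)
  have hm3 := (min_le_right ρ (min ρ₀ ρ₁)).trans (min_le_right _ _)
  have hmem : ∀ z ∈ disc δ, ∀ y ∈ closedBall z δ, y ∈ disc ρ ∧ y ∈ disc ρ₀ ∧ y ∈ disc ρ₁ := by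
    intro z hz y hy
    simp only [mem_ball_zero_iff, mem_closedBall, dist_eq] at hz hy ⊢
    have : ‖y‖ ≤ ‖y - z‖ + ‖z‖ := by simpa using norm_add_le (y - z) z
    exact ⟨by linarith, by linarith, by linarith⟩
  refine ⟨min ℓ (Real.log r), δ, hδ0, A / δ, by positivity, B, hB, fun N w hw z hz => ?_⟩
  have hw1 : w ∈ strip α' β' ℓ := strip_mono le_rfl le_rfl (min_le_left _ _) hw
  have hw2 := strip_subset_puncturedDisc α' β' hr (min_le_right ℓ (Real.log r)) hw
  set Q : ℂ → ℂ := fun y => f w y - ∑ n ∈ Finset.range N, a n y * exp w ^ n with hQ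
  have hzz := hmem z hz z (mem_closedBall_self hδ0.le)
  have hder : deriv Q z = deriv (f w) z - ∑ n ∈ Finset.range N, deriv (a n) z * exp w ^ n := by
    refine HasDerivAt.deriv (HasDerivAt.sub
      ((hf.snd hw2).differentiableAt (isOpen_ball.mem_nhds hzz.2.1)).hasDerivAt
      (HasDerivAt.fun_sum fun n _ => HasDerivAt.mul_const ?_ _))
    exact ((ha n).differentiableAt (isOpen_ball.mem_nhds hzz.2.2)).hasDerivAt
  simp only
  rw [← hder]
  have hQd : DifferentiableOn ℂ Q (closedBall z δ) := by
    refine DifferentiableOn.sub ((hf.snd hw2).mono fun y hy => (hmem z hz y hy).2.1)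
      (DifferentiableOn.fun_sum fun n _ => DifferentiableOn.mul_const ?_ _)
    exact (ha n).mono fun y hy => (hmem z hz y hy).2.2
  refine (norm_deriv_le_of_forall_mem_sphere_norm_le hδ0
    (C := A * B ^ N * (N.factorial : ℝ) ^ s * Real.exp w.re ^ N) ?_ fun y hy => ?_).trans_eq
      (by ring)
  · exact (hQd.mono closure_ball_subset_closedBall).diffContOnCl
  · exact hb N w hw1 y (hmem z hz y (sphere_subset_closedBall hy)).1

theorem differentiableOn_iteratedDeriv {f : ℂ → ℂ} {U : Set ℂ} (hU : IsOpen U)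
    (hf : DifferentiableOn ℂ f U) (l : ℕ) : DifferentiableOn ℂ (iteratedDeriv l f) U := by
  induction l with
  | zero => simpa using hf
  | succ l ih => rw [iteratedDeriv_succ]; exact ih.deriv hU

theorem HasGevreyExpansion.iteratedDeriv_snd {s α β r ρ₀ ρ₁ : ℝ} (hr : 0 < r) (hρ₀ : 0 < ρ₀)
    (hρ₁ : 0 < ρ₁) {f : ℂ → ℂ → ℂ} {a : ℕ → ℂ → ℂ} (hf : HolomorphicOn (puncturedDisc r) ρ₀ f)
    (ha : ∀ n, DifferentiableOn ℂ (a n) (disc ρ₁)) (h : HasGevreyExpansion s f a α β) (l : ℕ) :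
    HasGevreyExpansion s (fun w z => iteratedDeriv l (f w) z)
      (fun n z => iteratedDeriv l (a n) z) α β := by
  induction l with
  | zero => simpa using h
  | succ l ih =>
    simp only [iteratedDeriv_succ]
    exact ih.deriv_snd hr hρ₀ hρ₁ (hf.iteratedDeriv_snd (isOpen_puncturedDisc r) l)
      fun n => differentiableOn_iteratedDeriv isOpen_ball (ha n) l

theorem differentiableOn_formalDt_iterate {a : ℕ → ℂ → ℂ} {U : Set ℂ}
    (ha : ∀ n, DifferentiableOn ℂ (a n) U) (j n : ℕ) :
    DifferentiableOn ℂ ((formalDt^[j] a) n) U := by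
  induction j generalizing n with
  | zero => exact ha n
  | succ j ih =>
    rw [Function.iterate_succ_apply']
    exact (ih (n + 1)).const_mul _

/-- An expansion may be inserted into the equation. -/
theorem HasGevreyExpansion.op {pb : CauchyProblem} {s α β r ρ₀ : ℝ} (hs : 0 ≤ s) (hr : 0 < r)
    (hρ₀ : 0 < ρ₀) {f : ℂ → ℂ → ℂ} {a : ℕ → ℂ → ℂ} (hf : HolomorphicOn (puncturedDisc r) ρ₀ f)
    (ha : ∀ n, DifferentiableOn ℂ (a n) (disc pb.R)) (h : HasGevreyExpansion s f a α β) :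
    HasGevreyExpansion s (pb.op f) (fun n z => (formalDt^[pb.order] a) n z
      - ∑ j : Fin pb.order, zOp (pb.P j) ((formalDt^[pb.order - 1 - (j : ℕ)] a) n) z) α β := by
  have hz : ∀ j : ℕ, ∀ p : Polynomial ℂ, HasGevreyExpansion s
      (fun w z => zOp p ((StokesPDE.dt^[j] f) w) z) (fun n z => zOp p ((formalDt^[j] a) n) z) α β := by
    intro j p
    simp only [zOp, Polynomial.sum]
    refine HasGevreyExpansion.sum _ fun l _ => HasGevreyExpansion.const_mul ?_ _
    exact (h.dt_iterate hs hr hρ₀ hf j).iteratedDeriv_snd hr hρ₀ pb.R_pos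
      (hf.dt_iterate (isOpen_puncturedDisc r) j) (differentiableOn_formalDt_iterate ha j) l
  have := (h.dt_iterate hs hr hρ₀ hf pb.order).add
    ((HasGevreyExpansion.sum Finset.univ fun (j : Fin pb.order) _ =>
      hz (pb.order - 1 - (j : ℕ)) (pb.P j)).const_mul (-1))
  unfold CauchyProblem.op
  simpa only [neg_one_mul, ← sub_eq_add_neg] using this

/-! ### Watson's lemma -/

/-- **Watson's lemma**: a holomorphic function with vanishing Gevrey expansion of order `1/k` in a
sector of opening larger than `π/k` vanishes. -/
theorem eq_zero_of_gevreyBound_zero {k α β ℓ A B : ℝ} (hk : 0 < k) (hA : 0 < A) (hB : 0 < B)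
    (hαβ : Real.pi / k < β - α) {h : ℂ → ℂ} (hd : DifferentiableOn ℂ h (strip α β ℓ))
    (hb : ∀ N : ℕ, ∀ w ∈ strip α β ℓ,
      ‖h w‖ ≤ A * B ^ N * (N.factorial : ℝ) ^ (1 / k) * Real.exp w.re ^ N) :
    EqOn h 0 (strip α β ℓ) := by
  have hπ := Real.pi_pos
  have hbα : 0 < β - α := (by positivity : 0 < Real.pi / k).trans hαβ
  -- a sector of opening `π / k₁` with `k₁ < k` is still contained in the given one
  obtain ⟨k₁, hk₁0, hk₁, hk₁'⟩ : ∃ k₁, 0 < k₁ ∧ k₁ < k ∧ Real.pi / k₁ < β - α := by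
    have h1 : Real.pi / (β - α) < k := by
      rw [div_lt_iff₀ hbα]; rwa [div_lt_iff₀ hk, mul_comm] at hαβ
    obtain ⟨k₁, h2, h3⟩ := exists_between h1
    have h4 : 0 < k₁ := (by positivity : 0 < Real.pi / (β - α)).trans h2
    refine ⟨k₁, h4, h3, ?_⟩
    rw [div_lt_iff₀ h4]; rwa [div_lt_iff₀ hbα, mul_comm] at h2
  -- the bounds for all `N` amount to exponential decay
  set c := 1 / (2 * k * B ^ k) with hc
  have hc0 : 0 < c := by positivity
  have hdecay : ∀ w ∈ strip α β ℓ,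
      ‖h w‖ ≤ A * 2 ^ (1 / k) * Real.exp (-(c * Real.exp (-(k * w.re)))) := by
    intro w hw
    set x := ‖h w‖ / A with hx
    have hx0 : 0 ≤ x := by positivity
    set y := (B * Real.exp w.re) ^ k with hy
    have hy0 : 0 < y := by positivity
    have h1 : ∀ N : ℕ, x ^ k * ((1 / (2 * y)) ^ N / (N.factorial : ℝ)) ≤ (1 / 2) ^ N := by
      intro N
      have h2 : x ≤ (B * Real.exp w.re) ^ N * (N.factorial : ℝ) ^ (1 / k) := by
        rw [hx, div_le_iff₀ hA]
        refine (hb N w hw).trans_eq ?_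
        rw [mul_pow]; ring
      have e1 : ((B * Real.exp w.re) ^ N) ^ k = y ^ N := by
        rw [hy, ← Real.rpow_natCast, ← Real.rpow_natCast, ← Real.rpow_mul (by positivity),
          ← Real.rpow_mul (by positivity), mul_comm (N : ℝ)]
      have e2 : ((N.factorial : ℝ) ^ (1 / k)) ^ k = N.factorial := by
        rw [← Real.rpow_mul (by positivity), one_div_mul_cancel hk.ne', Real.rpow_one]
      have h3 := Real.rpow_le_rpow hx0 h2 hk.le
      rw [Real.mul_rpow (by positivity) (by positivity), e1, e2] at h3
      rw [one_div, mul_inv, mul_pow, inv_pow y]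
      have hf : (0 : ℝ) < N.factorial := by positivity
      calc x ^ k * (2⁻¹ ^ N * (y ^ N)⁻¹ / (N.factorial : ℝ))
          ≤ (y ^ N * N.factorial) * (2⁻¹ ^ N * (y ^ N)⁻¹ / (N.factorial : ℝ)) := by gcongr
        _ = (1 / 2) ^ N := by
            have : y ^ N ≠ 0 := by positivity
            rw [one_div]
            field_simp
    have hs1 : HasSum (fun N : ℕ => x ^ k * ((1 / (2 * y)) ^ N / (N.factorial : ℝ)))
        (x ^ k * Real.exp (1 / (2 * y))) := by
      refine HasSum.mul_left _ ?_
      rw [Real.exp_eq_exp_ℝ]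
      exact NormedSpace.expSeries_div_hasSum_exp _
    have h2 := hasSum_le h1 hs1 hasSum_geometric_two
    have h3 : x ^ k ≤ 2 * Real.exp (-(1 / (2 * y))) := by
      rw [Real.exp_neg, ← div_eq_mul_inv, le_div_iff₀ (Real.exp_pos _)]; exact h2
    have h4 := Real.rpow_le_rpow (by positivity) h3 (by positivity : 0 ≤ 1 / k)
    rw [← Real.rpow_mul hx0, mul_one_div_cancel hk.ne', Real.rpow_one,
      Real.mul_rpow (by positivity) (by positivity), ← Real.exp_mul] at h4
    have h5 : -(1 / (2 * y)) * (1 / k) = -(c * Real.exp (-(k * w.re))) := by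
      rw [hy, hc, Real.mul_rpow (by positivity) (by positivity), ← Real.exp_mul, Real.exp_neg,
        mul_comm w.re k]
      field_simp
    rw [h5, hx, div_le_iff₀ hA] at h4
    linarith
  -- transplant to a right half-plane by `ζ + M = e^{-k₁ (w - iθ)}`
  set θ := (α + β) / 2 with hθ
  set M := 2 + Real.exp (-(k₁ * ℓ)) with hM
  have hM0 := Real.exp_pos (-(k₁ * ℓ))
  set W : ℂ → ℂ := fun ζ => θ * I - log (ζ + M) / k₁ with hW
  have hWre : ∀ ζ, (W ζ).re = -(Real.log ‖ζ + M‖ / k₁) := by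
    intro ζ
    simp [hW, Complex.div_ofReal_re, log_re]
  have hWim : ∀ ζ, (W ζ).im = θ - arg (ζ + M) / k₁ := by
    intro ζ
    simp [hW, Complex.div_ofReal_im, log_im]
  have hWmem : ∀ ζ : ℂ, -1 < ζ.re → W ζ ∈ strip α β ℓ := by
    intro ζ hζ
    have h1 : ζ.re + M ≤ ‖ζ + M‖ := by simpa using re_le_norm (ζ + M)
    have h2 : |arg (ζ + M)| < Real.pi / 2 :=
      abs_arg_lt_pi_div_two_iff.2 (Or.inl (by simp; linarith))
    have h3 : |arg (ζ + M) / k₁| < (β - α) / 2 := by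
      rw [abs_div, abs_of_pos hk₁0, div_lt_iff₀ hk₁0]
      rw [div_lt_iff₀ hk₁0] at hk₁'
      linarith
    rw [abs_lt] at h3
    have h4 : -(k₁ * ℓ) < Real.log ‖ζ + M‖ := by
      rw [Real.lt_log_iff_exp_lt (by linarith)]; linarith
    refine ⟨⟨?_, ?_⟩, ?_⟩
    · rw [hWim]; linarith [h3.2]
    · rw [hWim]; linarith [h3.1]
    · rw [hWre, neg_lt, lt_div_iff₀ hk₁0]; linarith
  have hfd : DifferentiableOn ℂ (fun ζ => h (W ζ)) {ζ | -1 < ζ.re} := by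
    refine hd.comp (t := strip α β ℓ) (f := W) ?_ hWmem
    intro ζ hζ
    have h1 : ζ + M ∈ slitPlane := Or.inl (by simp; simp only [Set.mem_ofPred_eq] at hζ; linarith)
    exact (((differentiableAt_id.add_const _).clog h1).div_const _).const_sub _
      |>.differentiableWithinAt
  have hbd : ∀ ζ : ℂ, -1 < ζ.re → ‖h (W ζ)‖ ≤ A := fun ζ hζ => by
    simpa using hb 0 _ (hWmem ζ hζ)
  have hcl : closure {z : ℂ | 0 < z.re} ⊆ {ζ | -1 < ζ.re} := by
    rw [closure_setOfPred_lt_re]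
    intro z hz
    simp only [Set.mem_ofPred_eq] at hz ⊢
    linarith
  have hzero : EqOn (fun ζ => h (W ζ)) 0 {z : ℂ | 0 ≤ z.re} := by
    refine PhragmenLindelof.eq_zero_on_right_half_plane_of_superexponential_decay
      (hfd.mono hcl).diffContOnCl ⟨0, by norm_num, 0, ?_⟩ ?_ ⟨A, fun x => hbd _ (by simp)⟩
    · refine Asymptotics.IsBigO.of_bound A ?_
      refine eventually_inf_principal.2 (Eventually.of_forall fun ζ hζ => ?_)
      simpa using hbd ζ (by simp only [Set.mem_ofPred_eq] at hζ; linarith)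
    · intro n
      set p := k / k₁ with hp
      have hp1 : 1 < p := by rw [hp, one_lt_div hk₁0]; exact hk₁
      have hlim : Tendsto (fun x : ℝ => A * 2 ^ (1 / k) *
          Real.exp (-(x * (c * x ^ (p - 1) - n)))) atTop (𝓝 0) := by
        rw [← mul_zero (A * 2 ^ (1 / k))]
        refine (Real.tendsto_exp_neg_atTop_nhds_zero.comp ?_).const_mul _
        refine tendsto_id.atTop_mul_atTop₀ (tendsto_atTop_add_const_right _ _ ?_)
        exact (tendsto_rpow_atTop (by linarith)).const_mul_atTop hc0
      refine squeeze_zero' (Eventually.of_forall fun x => by positivity) ?_ hlim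
      filter_upwards [eventually_gt_atTop 0] with x hx
      have h1 := hdecay _ (hWmem x (by simp; linarith))
      have h2 : x ^ p ≤ Real.exp (-(k * (W x).re)) := by
        have hxM : ‖(x : ℂ) + M‖ = x + M := by
          rw [← ofReal_add, norm_real, Real.norm_of_nonneg (by linarith)]
        rw [hWre, hxM]
        have : -(k * -(Real.log (x + M) / k₁)) = Real.log (x + M) * p := by
          rw [hp]; ring
        rw [this, ← Real.rpow_def_of_pos (by linarith)]
        exact Real.rpow_le_rpow hx.le (by linarith) (by linarith)
      have h3 : x ^ p = x * x ^ (p - 1) := by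
        rw [← Real.rpow_one_add' hx.le (by linarith)]; congr 1; ring
      calc Real.exp x ^ n * ‖h (W x)‖
          ≤ Real.exp x ^ n * (A * 2 ^ (1 / k) * Real.exp (-(c * x ^ p))) := by
            gcongr
            refine h1.trans ?_
            gcongr
        _ = _ := by
            rw [← Real.exp_nat_mul, mul_left_comm, ← Real.exp_add, h3]
            congr 2; ring
  set E : ℂ → ℂ := fun w => exp (-(k₁ * (w - θ * I))) - M with hE
  have hEc : Continuous E := by fun_prop
  refine eqOn_of_eqOn_open (isOpen_strip α β ℓ) (convex_strip α β ℓ) hd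
    (differentiableOn_const 0)
    (V := {w | |w.im - θ| < Real.pi / k₁} ∩ {w | 0 < (E w).re})
    ((isOpen_lt (continuous_im.sub continuous_const).abs continuous_const).inter
      (isOpen_lt continuous_const (continuous_re.comp hEc))) ?_ fun w hw => ?_
  · obtain ⟨x, hx1, hx2⟩ : ∃ x : ℝ, x < ℓ ∧ M < -(k₁ * x) := by
      refine ⟨min (ℓ - 1) (-(M + 1) / k₁), ?_, ?_⟩
      · linarith [min_le_left (ℓ - 1) (-(M + 1) / k₁)]
      · have := min_le_right (ℓ - 1) (-(M + 1) / k₁)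
        rw [le_div_iff₀ hk₁0] at this
        linarith
    refine ⟨⟨x, θ⟩, ⟨⟨by simp [hθ]; linarith, by simp [hθ]; linarith⟩, hx1⟩, ?_, ?_⟩
    · simp; positivity
    · have : (-(k₁ * ((⟨x, θ⟩ : ℂ) - θ * I)) : ℂ) = ((-(k₁ * x) : ℝ) : ℂ) := by
        apply Complex.ext <;> simp
      simp only [Set.mem_ofPred_eq, hE, this, ← ofReal_exp, ← ofReal_sub, ofReal_re]
      linarith [Real.add_one_le_exp (-(k₁ * x))]
  · have h1 : W (E w) = w := by
      have h2 : |w.im - θ| < Real.pi / k₁ := hw.2.1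
      rw [lt_div_iff₀ hk₁0] at h2
      have h3 : |(-(k₁ * (w - θ * I)) : ℂ).im| < Real.pi := by
        simpa [abs_mul, abs_of_pos hk₁0, mul_comm] using h2
      rw [abs_lt] at h3
      simp only [hW, hE, sub_add_cancel]
      rw [log_exp h3.1 h3.2.le]
      have : (k₁ : ℂ) ≠ 0 := ofReal_ne_zero.2 hk₁0.ne'
      field_simp
      ring
    have := hzero (show E w ∈ {z : ℂ | 0 ≤ z.re} from le_of_lt (show 0 < (E w).re from hw.2.2))
    simpa [h1] using this

/-- A function with the expansion `û` in a sector of opening larger than `π/k` solves the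
equation, by Watson's lemma. -/
theorem HasGevreyExpansion.op_eq_zero {pb : CauchyProblem} {k α β r ρ₀ : ℝ} (hk : 0 < k)
    (hr : 0 < r) (hρ₀ : 0 < ρ₀) (hαβ : Real.pi / k < β - α) {f : ℂ → ℂ → ℂ} {a : ℕ → ℂ → ℂ}
    (hf : HolomorphicOn (puncturedDisc r) ρ₀ f) (ha : pb.IsFormalSolution a)
    (h : HasGevreyExpansion (1 / k) f a α β) :
    ∀ w ∈ puncturedDisc r, ∀ z ∈ disc ρ₀, pb.op f w z = 0 := by
  obtain ⟨δ, hδ0, hδ⟩ : ∃ δ, 0 < δ ∧ 2 * δ < β - α - Real.pi / k :=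
    ⟨(β - α - Real.pi / k) / 3, by linarith, by linarith⟩
  obtain ⟨ℓ, ρ, hρ, A, hA, B, hB, hb⟩ :=
    h.op (one_div_pos.2 hk).le hr hρ₀ hf ha.holo (α + δ) (β - δ) (by linarith) (by linarith)
  have hop := hf.op (pb := pb) (isOpen_puncturedDisc r)
  have hsub := strip_subset_puncturedDisc (α + δ) (β - δ) hr (min_le_right ℓ (Real.log r))
  have hπk : 0 < Real.pi / k := by have := Real.pi_pos; positivity
  refine HolomorphicOn.eq_of_eqOn (g := fun _ _ => 0) (isOpen_puncturedDisc r)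
    (convex_puncturedDisc hr) hop (differentiableOn_const 0)
    (isOpen_strip (α + δ) (β - δ) (min ℓ (Real.log r)))
    (by rw [inter_eq_right.2 hsub]; exact strip_nonempty (by linarith) _) hρ₀
    (lt_min hρ pb.R_pos) fun w hw z hz => ?_
  have hz0 := ball_subset_ball (min_le_left _ _) hz
  have hz1 := ball_subset_ball ((min_le_right _ _).trans (min_le_left _ _)) hz
  have hz2 := ball_subset_ball ((min_le_right _ _).trans (min_le_right _ _)) hz
  refine eq_zero_of_gevreyBound_zero hk hA hB (by linarith) ((hop.fst hz0).mono hsub)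
    (fun N v hv => ?_) hw.2
  simpa [ha.eqn _ z hz2] using hb N v (strip_mono le_rfl le_rfl (min_le_left _ _) hv) z hz1

/-! ### Inversion of the Ecalle operator -/

/-- The integrand `(1 + (k+1) Z q) e^{Z q}` of the kernel `inverseKernel`. -/
noncomputable def inverseIntegrand (k : ℝ) (Z : ℂ) (q : ℝ) : ℂ :=
  (1 + (k + 1) * Z * q) * exp (Z * q)

/-- The kernel that inverts the Ecalle operator: `∫ (1 + (k+1) Z q) e^{Z q} dx` over `(0, 1)`,
with `q = x^k (1 - x)`. It is the entire function `∑ Γ(1 + k n) / Γ(1 + (k+1) n) Z^n`; the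
integral shows that it is bounded where `Re Z ≤ -c |Z|`. -/
noncomputable def inverseKernel (k : ℝ) (Z : ℂ) : ℂ :=
  ∫ x in Ioo (0 : ℝ) 1, inverseIntegrand k Z (x ^ k * (1 - x))

theorem rpow_mul_one_sub_mem {k x : ℝ} (hk : 0 < k) (hx : x ∈ Ioo (0 : ℝ) 1) :
    x ^ k * (1 - x) ∈ Ioc (0 : ℝ) 1 := by
  have h1 := Real.rpow_pos_of_pos hx.1 k
  have h2 := Real.rpow_le_one hx.1.le hx.2.le hk.le
  have h3 := hx.1
  have h4 := hx.2
  exact ⟨mul_pos h1 (by linarith), mul_le_one₀ h2 (by linarith) (by linarith)⟩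

theorem norm_inverseIntegrand_le {k q : ℝ} (hk : 0 < k) (hq0 : 0 ≤ q) (hq1 : q ≤ 1) (Z : ℂ) :
    ‖inverseIntegrand k Z q‖ ≤ (k + 2) * Real.exp (2 * ‖Z‖) := by
  have hZ := norm_nonneg Z
  have h1 : ‖Z * q‖ ≤ ‖Z‖ := by
    rw [norm_mul, norm_real, Real.norm_of_nonneg hq0]; exact mul_le_of_le_one_right hZ hq1
  have h2 : ‖(1 + (k + 1) * Z * q : ℂ)‖ ≤ 1 + (k + 1) * ‖Z‖ := by
    refine (norm_add_le _ _).trans ?_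
    rw [norm_one, mul_assoc, norm_mul]
    have : ‖(k + 1 : ℂ)‖ = k + 1 := by
      rw [← ofReal_one, ← ofReal_add, norm_real, Real.norm_of_nonneg (by linarith)]
    rw [this]; gcongr
  have h3 : ‖exp (Z * q)‖ ≤ Real.exp ‖Z‖ := by
    rw [norm_exp]; exact Real.exp_le_exp.2 ((re_le_norm _).trans h1)
  have h4 := Real.one_le_exp hZ
  have h5 := Real.add_one_le_exp ‖Z‖
  calc ‖inverseIntegrand k Z q‖ ≤ (1 + (k + 1) * ‖Z‖) * Real.exp ‖Z‖ := by
        rw [inverseIntegrand, norm_mul]; gcongr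
    _ ≤ ((k + 2) * Real.exp ‖Z‖) * Real.exp ‖Z‖ := by gcongr; nlinarith
    _ = _ := by rw [mul_assoc, ← Real.exp_add]; ring_nf

theorem norm_inverseIntegrand_le_of_re_le {k q c : ℝ} (hk : 0 < k) (hc : 0 < c) (hq0 : 0 ≤ q)
    {Z : ℂ} (hZ : Z.re ≤ -c * ‖Z‖) : ‖inverseIntegrand k Z q‖ ≤ 1 + (k + 1) / c := by
  set y := ‖Z‖ * q with hy
  have hy0 : 0 ≤ y := by positivity
  have h2 : ‖(1 + (k + 1) * Z * q : ℂ)‖ ≤ 1 + (k + 1) * y := by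
    refine (norm_add_le _ _).trans ?_
    rw [norm_one, mul_assoc, norm_mul, norm_mul, norm_real, Real.norm_of_nonneg hq0]
    have : ‖(k + 1 : ℂ)‖ = k + 1 := by
      rw [← ofReal_one, ← ofReal_add, norm_real, Real.norm_of_nonneg (by linarith)]
    rw [this]
  have h3 : ‖exp (Z * q)‖ ≤ Real.exp (-(c * y)) := by
    rw [norm_exp, re_mul_ofReal]
    refine Real.exp_le_exp.2 ((mul_le_mul_of_nonneg_right hZ hq0).trans_eq (by rw [hy]; ring))
  have h4 := Real.exp_le_one_iff.2 (by nlinarith : -(c * y) ≤ 0)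
  have h5 : c * y * Real.exp (-(c * y)) ≤ 1 := by
    rw [Real.exp_neg, ← div_eq_mul_inv, div_le_one (Real.exp_pos _)]
    linarith [Real.add_one_le_exp (c * y)]
  calc ‖inverseIntegrand k Z q‖ ≤ (1 + (k + 1) * y) * Real.exp (-(c * y)) := by
        rw [inverseIntegrand, norm_mul]; gcongr
    _ = Real.exp (-(c * y)) + (k + 1) / c * (c * y * Real.exp (-(c * y))) := by field_simp
    _ ≤ 1 + (k + 1) / c * 1 := by gcongr
    _ = _ := by ring

/-- The bound of the integrand on a Hankel contour, translated by `μ`. -/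
theorem norm_inverseIntegrand_hankel_le {k c x₀ φm φp q : ℝ} {μ : ℂ} (hk : 0 < k) (hc : 0 < c)
    (h : φm ≤ φp) (hm : Real.cos (φm + μ.im) ≤ -c) (hp : Real.cos (φp + μ.im) ≤ -c)
    (hq0 : 0 ≤ q) (hq1 : q ≤ 1) (y : ℝ) :
    ‖inverseIntegrand k (exp (μ + hankelPath x₀ φm φp y)) q‖ ≤
      (k + 3 + (k + 1) / c) * Real.exp (2 * Real.exp (μ.re + x₀)) := by
  have hkc : 0 < (k + 1) / c := by positivity
  have hE : 1 ≤ Real.exp (2 * Real.exp (μ.re + x₀)) := Real.one_le_exp (by positivity)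
  have hside : ∀ φ : ℝ, Real.cos (φ + μ.im) ≤ -c → (hankelPath x₀ φm φp y).im = φ →
      ‖inverseIntegrand k (exp (μ + hankelPath x₀ φm φp y)) q‖ ≤
        (k + 3 + (k + 1) / c) * Real.exp (2 * Real.exp (μ.re + x₀)) := by
    intro φ hφ hi
    refine (norm_inverseIntegrand_le_of_re_le hk hc hq0 ?_).trans ?_
    · rw [exp_re, norm_exp, add_im, hi, add_comm μ.im, mul_comm (-c)]
      gcongr
    · nlinarith
  rcases lt_or_ge y φm with hy | hy
  · exact hside φm hm (by rw [hankelPath_of_lt h hy]; simp)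
  rcases lt_or_ge φp y with hy' | hy'
  · exact hside φp hp (by rw [hankelPath_of_gt h hy']; simp)
  · refine (norm_inverseIntegrand_le hk hq0 hq1 _).trans ?_
    rw [norm_exp, hankelPath_of_mem ⟨hy, hy'⟩]
    simp only [add_re, ofReal_re, mul_re, I_re, mul_zero, ofReal_im, I_im, mul_one, sub_self,
      add_zero]
    exact mul_le_mul_of_nonneg_right (by linarith) (Real.exp_pos _).le

theorem integrable_exp_neg_mul_abs_sub_hankelIm {φm φp a : ℝ} (h : φm ≤ φp) (ha : 0 < a) :
    Integrable fun y : ℝ => Real.exp (-(a * |y - hankelIm φm φp y|)) := by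
  set L := max |φm| |φp| with hL
  have h1 : Integrable fun y : ℝ => Real.exp (a * L) * Real.exp (-|a * y|) :=
    (integrable_exp_neg_abs.comp_mul_left' ha.ne').const_mul _
  refine h1.mono' (by unfold hankelIm; fun_prop) (Eventually.of_forall fun y => ?_)
  rw [Real.norm_of_nonneg (Real.exp_pos _).le, ← Real.exp_add, abs_mul, abs_of_pos ha]
  refine Real.exp_le_exp.2 ?_
  have h2 : |hankelIm φm φp y| ≤ L := by
    have := hankelIm_mem h y
    exact abs_le_max_abs_abs this.1 this.2
  have h3 : |y| ≤ |y - hankelIm φm φp y| + |hankelIm φm φp y| := by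
    simpa using abs_add_le (y - hankelIm φm φp y) (hankelIm φm φp y)
  nlinarith

theorem integrable_exp_neg_mul_hankelRe {x₀ φm φp a : ℝ} (h : φm ≤ φp) (ha : 0 < a) :
    Integrable fun y : ℝ => Real.exp (-(a * hankelRe x₀ φm φp y)) := by
  refine ((integrable_exp_neg_mul_abs_sub_hankelIm h ha).const_mul (Real.exp (-(a * x₀)))).congr
    (Eventually.of_forall fun y => ?_)
  simp only [hankelRe, ← Real.exp_add]
  ring_nf

theorem hankelPath_add (x₀ φm φp y : ℝ) (μ : ℂ) :
    μ + hankelPath x₀ φm φp y =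
      hankelPath (x₀ + μ.re) (φm + μ.im) (φp + μ.im) (y + μ.im) := by
  have h1 : hankelIm (φm + μ.im) (φp + μ.im) (y + μ.im) = hankelIm φm φp y + μ.im := by
    rw [hankelIm, hankelIm, min_add_add_right, max_add_add_right]
  have h2 : hankelRe (x₀ + μ.re) (φm + μ.im) (φp + μ.im) (y + μ.im) =
      hankelRe x₀ φm φp y + μ.re := by
    rw [hankelRe, hankelRe, h1, add_sub_add_right_eq_sub]; ring
  apply Complex.ext
  · rw [hankelPath_re, h2, add_re, hankelPath_re, add_comm]
  · rw [hankelPath_im, h1, add_im, hankelPath_im, add_comm]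

theorem hankelDir_add (φm φp y s : ℝ) :
    hankelDir (φm + s) (φp + s) (y + s) = hankelDir φm φp y := by
  simp [hankelDir]

section moments

variable {x₀ φm φp c : ℝ} {μ : ℂ}

theorem exp_shift_eq (ν y : ℝ) :
    exp (exp (μ + hankelPath x₀ φm φp y) - ν * hankelPath x₀ φm φp y) * hankelDir φm φp y =
      exp (ν * μ) * (exp (exp (hankelPath (x₀ + μ.re) (φm + μ.im) (φp + μ.im) (y + μ.im)) -
        ν * hankelPath (x₀ + μ.re) (φm + μ.im) (φp + μ.im) (y + μ.im)) *
        hankelDir (φm + μ.im) (φp + μ.im) (y + μ.im)) := by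
  rw [hankelDir_add, ← hankelPath_add, ← mul_assoc, ← Complex.exp_add]
  congr 2; ring

theorem integrable_hankel_shift (hc : 0 < c) (h : φm ≤ φp) (hm : Real.cos (φm + μ.im) ≤ -c)
    (hp : Real.cos (φp + μ.im) ≤ -c) (ν : ℝ) :
    Integrable fun y => exp (exp (μ + hankelPath x₀ φm φp y) - ν * hankelPath x₀ φm φp y) *
      hankelDir φm φp y := by
  simp_rw [exp_shift_eq]
  exact ((integrable_hankel hc (by linarith) hm hp ν).comp_add_right μ.im).const_mul _

theorem integral_hankel_shift (hc : 0 < c) (hm : Real.cos (φm + μ.im) ≤ -c)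
    (hp : Real.cos (φp + μ.im) ≤ -c) (hm' : φm + μ.im ∈ Icc (-Real.pi) 0)
    (hp' : φp + μ.im ∈ Icc 0 Real.pi) (ν : ℝ) :
    ∫ y, exp (exp (μ + hankelPath x₀ φm φp y) - ν * hankelPath x₀ φm φp y) * hankelDir φm φp y =
      exp (ν * μ) * (2 * Real.pi * I * ((Real.Gamma (1 + ν))⁻¹ : ℝ)) := by
  simp_rw [exp_shift_eq]
  rw [integral_const_mul, integral_add_right_eq_self (fun y =>
    exp (exp (hankelPath (x₀ + μ.re) (φm + μ.im) (φp + μ.im) y) -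
        ν * hankelPath (x₀ + μ.re) (φm + μ.im) (φp + μ.im) y) *
        hankelDir (φm + μ.im) (φp + μ.im) y) μ.im, integral_hankel hc hm hp hm' hp']

theorem integral_inverseIntegrand (hc : 0 < c) (hm : Real.cos (φm + μ.im) ≤ -c)
    (hp : Real.cos (φp + μ.im) ≤ -c) (hm' : φm + μ.im ∈ Icc (-Real.pi) 0)
    (hp' : φp + μ.im ∈ Icc 0 Real.pi) (k : ℝ) {ν q : ℝ} (hν : 0 < ν) (hq : 0 < q) :
    ∫ y, inverseIntegrand k (exp (μ + hankelPath x₀ φm φp y)) q *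
        (exp (-ν * hankelPath x₀ φm φp y) * hankelDir φm φp y) =
      exp (ν * μ) * (2 * Real.pi * I) * ((1 + (k + 1) * ν) / Real.Gamma (1 + ν) * q ^ ν : ℝ) := by
  set μ' : ℂ := μ + Real.log q with hμ'
  have him : μ'.im = μ.im := by simp [hμ']
  have hle : φm ≤ φp := by linarith [hm'.2, hp'.1]
  have hq' : exp μ' = exp μ * q := by
    rw [hμ', Complex.exp_add, ← ofReal_exp, Real.exp_log hq]
  have h1 : ∀ y : ℝ, inverseIntegrand k (exp (μ + hankelPath x₀ φm φp y)) q *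
        (exp (-ν * hankelPath x₀ φm φp y) * hankelDir φm φp y) =
      exp (exp (μ' + hankelPath x₀ φm φp y) - ν * hankelPath x₀ φm φp y) * hankelDir φm φp y +
      (k + 1) * exp μ' * (exp (exp (μ' + hankelPath x₀ φm φp y) -
        (ν - 1 : ℝ) * hankelPath x₀ φm φp y) * hankelDir φm φp y) := by
    intro y
    set γ := hankelPath x₀ φm φp y
    have e1 : exp (μ' + γ) = exp (μ + γ) * q := by
      rw [Complex.exp_add, hq', Complex.exp_add]; ring
    have e2 : exp (exp (μ' + γ) - (ν - 1 : ℝ) * γ) =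
        exp (exp (μ + γ) * q) * exp (-ν * γ) * exp γ := by
      rw [← Complex.exp_add, ← Complex.exp_add, e1]; congr 1; push_cast; ring
    have e3 : exp (exp (μ' + γ) - ν * γ) = exp (exp (μ + γ) * q) * exp (-ν * γ) := by
      rw [← Complex.exp_add, e1]; congr 1; ring
    rw [e2, e3, hq', inverseIntegrand]
    have e4 : exp (μ + γ) = exp μ * exp γ := Complex.exp_add _ _
    linear_combination ((k + 1) * q * exp (exp (μ + γ) * q) * exp (-ν * γ) *
      hankelDir φm φp y) * e4
  simp_rw [h1]
  rw [← him] at hm hp hm' hp'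
  rw [integral_add (integrable_hankel_shift hc hle hm hp ν)
    ((integrable_hankel_shift hc hle hm hp _).const_mul _), integral_const_mul,
    integral_hankel_shift hc hm hp hm' hp', integral_hankel_shift hc hm hp hm' hp']
  have hG : Real.Gamma (1 + ν) = ν * Real.Gamma ν := by rw [add_comm, Real.Gamma_add_one hν.ne']
  have hG0 : Real.Gamma ν ≠ 0 := (Real.Gamma_pos_of_pos hν).ne'
  have e5 : exp (ν * μ') = exp (ν * μ) * ((q ^ ν : ℝ) : ℂ) := by
    rw [hμ', mul_add, Complex.exp_add, Real.rpow_def_of_pos hq, ofReal_exp]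
    congr 2; push_cast; ring
  have e6 : exp μ' * exp (((ν - 1 : ℝ) : ℂ) * μ') = exp (ν * μ') := by
    rw [← Complex.exp_add]; congr 1; push_cast; ring
  have e7 : (1 : ℝ) + (ν - 1) = ν := by ring
  rw [e7, mul_assoc ((k : ℂ) + 1), ← mul_assoc (exp μ') (exp _), e6, e5, hG]
  have : (Real.Gamma ν : ℂ) ≠ 0 := ofReal_ne_zero.2 hG0
  have : (ν : ℂ) ≠ 0 := ofReal_ne_zero.2 hν.ne'
  push_cast
  field_simp

theorem integral_rpow_mul_one_sub {k : ℝ} (hk : 0 < k) (n : ℕ) :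
    ∫ x in Ioo (0 : ℝ) 1, (x ^ k * (1 - x)) ^ (n / k) =
      n.factorial * Real.Gamma (1 + n / k) / Real.Gamma (n + n / k + 2) := by
  have hn : (0 : ℝ) ≤ n / k := by positivity
  have h1 := Complex.Gamma_mul_Gamma_eq_betaIntegral (s := (n + 1 : ℝ)) (t := (1 + n / k : ℝ))
    (by simp; positivity) (by simp only [ofReal_re]; positivity)
  have h2 : betaIntegral (n + 1 : ℝ) (1 + n / k : ℝ) =
      ((∫ x in Ioo (0 : ℝ) 1, (x ^ k * (1 - x)) ^ (n / k) : ℝ) : ℂ) := by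
    rw [betaIntegral, intervalIntegral.integral_of_le zero_le_one, integral_Ioc_eq_integral_Ioo,
      ← integral_complex_ofReal]
    refine setIntegral_congr_fun measurableSet_Ioo fun x hx => ?_
    have hx1 : 0 ≤ 1 - x := by linarith [hx.2]
    rw [Real.mul_rpow (Real.rpow_nonneg hx.1.le _) hx1, ← Real.rpow_mul hx.1.le,
      mul_div_cancel₀ _ hk.ne', ofReal_mul, ofReal_cpow hx.1.le, ofReal_cpow hx1]
    push_cast
    congr 2 <;> ring
  rw [h2, ← ofReal_add, Complex.Gamma_ofReal, Complex.Gamma_ofReal, Complex.Gamma_ofReal,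
    ← ofReal_mul, ← ofReal_mul, ofReal_inj, Real.Gamma_nat_eq_factorial] at h1
  rw [show (n : ℝ) + n / k + 2 = n + 1 + (1 + n / k) by ring, h1,
    mul_div_cancel_left₀ _ (Real.Gamma_pos_of_pos (by positivity)).ne']

theorem continuous_inverseIntegrand {k : ℝ} (hk : 0 < k) (x₀ φm φp : ℝ) (μ : ℂ) :
    Continuous fun p : ℝ × ℝ => inverseIntegrand k (exp (μ + hankelPath x₀ φm φp p.1))
      (p.2 ^ k * (1 - p.2)) := by
  have h1 : Continuous fun p : ℝ × ℝ => p.2 ^ k :=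
    continuous_snd.rpow_const fun _ => Or.inr hk.le
  have h2 : Continuous fun p : ℝ × ℝ => hankelPath x₀ φm φp p.1 := by
    unfold hankelPath hankelRe hankelIm; fun_prop
  unfold inverseIntegrand
  fun_prop

/-- The moments of the kernel are the factors of the modified Borel transform: Hankel's formula
in the outer integral leaves a beta integral over `(0, 1)`. -/
theorem integral_inverseKernel {k : ℝ} (hk : 0 < k) (hc : 0 < c)
    (hm : Real.cos (φm + μ.im) ≤ -c)
    (hp : Real.cos (φp + μ.im) ≤ -c) (hm' : φm + μ.im ∈ Icc (-Real.pi) 0)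
    (hp' : φp + μ.im ∈ Icc 0 Real.pi) {n : ℕ} (hn : 0 < n) :
    ∫ y, inverseKernel k (exp (μ + hankelPath x₀ φm φp y)) *
        (exp (-(n / k : ℝ) * hankelPath x₀ φm φp y) * hankelDir φm φp y) =
      exp ((n / k : ℝ) * μ) * (2 * Real.pi * I) *
        (n.factorial / Real.Gamma (1 + n * (1 + 1 / k)) : ℝ) := by
  have hle : φm ≤ φp := by linarith [hm'.2, hp'.1]
  set ν : ℝ := n / k with hν
  have hν0 : 0 < ν := by positivity
  set b : ℝ → ℂ := fun y => exp (-ν * hankelPath x₀ φm φp y) * hankelDir φm φp y with hb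
  have hbm : Measurable b := by
    have := measurable_hankelDir (φm := φm) (φp := φp)
    have h2 : Continuous fun y : ℝ => hankelPath x₀ φm φp y := by
      unfold hankelPath hankelRe hankelIm; fun_prop
    exact (by fun_prop : Continuous fun y : ℝ => exp (-ν * hankelPath x₀ φm φp y)).measurable.mul this
  have hbn : ∀ y, ‖b y‖ = Real.exp (-(ν * hankelRe x₀ φm φp y)) := by
    intro y
    simp [hb, norm_hankelDir, norm_exp]
  have hswap : ∫ y, (∫ x in Ioo (0 : ℝ) 1, inverseIntegrand k (exp (μ + hankelPath x₀ φm φp y))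
      (x ^ k * (1 - x)) * b y) = ∫ x in Ioo (0 : ℝ) 1, ∫ y,
      inverseIntegrand k (exp (μ + hankelPath x₀ φm φp y)) (x ^ k * (1 - x)) * b y := by
    refine integral_integral_swap (f := fun y x =>
      inverseIntegrand k (exp (μ + hankelPath x₀ φm φp y)) (x ^ k * (1 - x)) * b y) ?_
    have hi : Integrable (fun p : ℝ × ℝ => ((k + 3 + (k + 1) / c) *
        Real.exp (2 * Real.exp (μ.re + x₀)) * Real.exp (-(ν * hankelRe x₀ φm φp p.1))) * 1)
        ((volume : Measure ℝ).prod (volume.restrict (Ioo (0 : ℝ) 1))) :=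
      Integrable.mul_prod ((integrable_exp_neg_mul_hankelRe hle hν0).const_mul _)
        (integrable_const 1)
    refine hi.mono' (((continuous_inverseIntegrand hk x₀ φm φp μ).measurable.mul
      (hbm.comp measurable_fst)).aestronglyMeasurable) ?_
    have hae : ∀ᵐ p : ℝ × ℝ ∂((volume : Measure ℝ).prod (volume.restrict (Ioo (0 : ℝ) 1))),
        p.2 ∈ Ioo (0 : ℝ) 1 :=
      Measure.quasiMeasurePreserving_snd.ae (ae_restrict_mem measurableSet_Ioo)
    filter_upwards [hae] with p hp2
    have hq := rpow_mul_one_sub_mem hk hp2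
    rw [Function.uncurry_def, norm_mul, hbn, mul_one]
    gcongr
    exact norm_inverseIntegrand_hankel_le hk hc hle hm hp hq.1.le hq.2 _
  simp only [inverseKernel, ← integral_mul_const]
  rw [hswap, setIntegral_congr_fun measurableSet_Ioo fun x hx =>
    integral_inverseIntegrand hc hm hp hm' hp' k hν0 (rpow_mul_one_sub_mem hk hx).1]
  rw [integral_const_mul, integral_complex_ofReal, integral_const_mul,
    integral_rpow_mul_one_sub hk n, ← hν]
  congr 2
  have hG : Real.Gamma (n + ν + 2) = (n + ν + 1) * Real.Gamma (n + ν + 1) := by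
    rw [← Real.Gamma_add_one (by positivity)]; congr 1; ring
  have hn2 : (1 : ℝ) + n * (1 + 1 / k) = n + ν + 1 := by rw [hν]; ring
  have hkν : k * ν = n := by rw [hν]; field_simp
  rw [hn2, hG]
  have g1 := (Real.Gamma_pos_of_pos (by positivity : 0 < (n : ℝ) + ν + 1)).ne'
  have g2 := (Real.Gamma_pos_of_pos (by positivity : 0 < 1 + ν)).ne'
  have g3 : (n : ℝ) + ν + 1 ≠ 0 := by positivity
  field_simp
  linear_combination hkν

end moments

theorem norm_inverseKernel_hankel_le {k c x₀ φm φp : ℝ} {μ : ℂ} (hk : 0 < k) (hc : 0 < c)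
    (h : φm ≤ φp) (hm : Real.cos (φm + μ.im) ≤ -c) (hp : Real.cos (φp + μ.im) ≤ -c) (y : ℝ) :
    ‖inverseKernel k (exp (μ + hankelPath x₀ φm φp y))‖ ≤
      (k + 3 + (k + 1) / c) * Real.exp (2 * Real.exp (μ.re + x₀)) := by
  refine (norm_setIntegral_le_of_norm_le_const (s := Ioo (0 : ℝ) 1) (by simp) fun x hx =>
    norm_inverseIntegrand_hankel_le hk hc h hm hp (rpow_mul_one_sub_mem hk hx).1.le
      (rpow_mul_one_sub_mem hk hx).2 y).trans_eq ?_
  simp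

theorem differentiable_inverseKernel {k : ℝ} (hk : 0 < k) : Differentiable ℂ (inverseKernel k) := by
  rw [← differentiableOn_univ]
  set cl : ℝ → ℝ := fun x => max 0 (min x 1) with hcl
  have hcl0 : ∀ x, 0 ≤ cl x := fun x => le_max_left _ _
  have hcl1 : ∀ x, cl x ≤ 1 := fun x => max_le zero_le_one (min_le_right _ _)
  have hmem : ∀ x, 0 ≤ cl x ^ k * (1 - cl x) ∧ cl x ^ k * (1 - cl x) ≤ 1 := fun x =>
    ⟨mul_nonneg (Real.rpow_nonneg (hcl0 x) _) (by linarith [hcl1 x]),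
      mul_le_one₀ (Real.rpow_le_one (hcl0 x) (hcl1 x) hk.le) (by linarith [hcl1 x])
        (by linarith [hcl0 x])⟩
  have hclc : Continuous fun x => cl x ^ k :=
    (by fun_prop : Continuous cl).rpow_const fun _ => Or.inr hk.le
  have : inverseKernel k = fun Z => ∫ x in Ioo (0 : ℝ) 1,
      inverseIntegrand k Z (cl x ^ k * (1 - cl x)) := by
    ext Z
    refine setIntegral_congr_fun measurableSet_Ioo fun x hx => ?_
    have : cl x = x := by simp [hcl, min_eq_left hx.2.le, max_eq_right hx.1.le]
    simp only [this]
  rw [this]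
  refine differentiableOn_integral_one isOpen_univ (fun x => ?_) (fun Z _ => ?_)
    fun Z _ => ⟨1, one_pos, fun _ => (k + 2) * Real.exp (2 * (‖Z‖ + 1)), integrable_const _,
      fun Y hY x => ?_⟩
  · unfold inverseIntegrand; fun_prop
  · refine Continuous.aestronglyMeasurable ?_
    unfold inverseIntegrand
    fun_prop
  · refine (norm_inverseIntegrand_le hk (hmem x).1 (hmem x).2 Y).trans ?_
    have : ‖Y‖ ≤ ‖Z‖ + 1 := by
      have h1 : ‖Y - Z‖ < 1 := by simpa [dist_eq] using hY.1
      have h2 : ‖Y‖ ≤ ‖Y - Z‖ + ‖Z‖ := by simpa using norm_add_le (Y - Z) Z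
      linarith
    show (k + 2) * Real.exp (2 * ‖Y‖) ≤ (k + 2) * Real.exp (2 * (‖Z‖ + 1))
    gcongr

/-- A Hankel contour may be moved along the real axis. -/
theorem integral_hankelPath_eq {φm φp x₀ x₁ : ℝ} (h : φm ≤ φp) (hx : x₀ ≤ x₁) {G : ℂ → ℂ}
    (hG : DifferentiableOn ℂ G (Ici x₀ ×ℂ Icc φm φp))
    (h₀ : Integrable fun y => G (hankelPath x₀ φm φp y) * hankelDir φm φp y)
    (hp : IntegrableOn (fun x : ℝ => G (x + φp * I)) (Ioi x₀))
    (hm : IntegrableOn (fun x : ℝ => G (x + φm * I)) (Ioi x₀))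
    (h₁ : Integrable fun y => G (hankelPath x₁ φm φp y) * hankelDir φm φp y) :
    ∫ y, G (hankelPath x₀ φm φp y) * hankelDir φm φp y =
      ∫ y, G (hankelPath x₁ φm φp y) * hankelDir φm φp y := by
  rw [integral_hankelPath h h₀, integral_hankelPath h h₁]
  have hsplit : ∀ φ : ℝ, IntegrableOn (fun x : ℝ => G (x + φ * I)) (Ioi x₀) →
      ∫ x in Ioi x₀, G (x + φ * I) =
        (∫ x in x₀..x₁, G (x + φ * I)) + ∫ x in Ioi x₁, G (x + φ * I) := by
    intro φ hi
    exact (intervalIntegral.integral_interval_add_Ioi hi (hi.mono_set (Ioi_subset_Ioi hx))).symm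
  have hr := integral_boundary_rect_eq_zero_of_differentiableOn G ⟨x₀, φm⟩ ⟨x₁, φp⟩ (by
    refine hG.mono ?_
    simp only [uIcc_of_le h, uIcc_of_le hx]
    exact fun v hv => ⟨hv.1.1, hv.2⟩)
  simp only [smul_eq_mul] at hr
  rw [hsplit φp hp, hsplit φm hm]
  linear_combination -hr

/-! ### Summability of functions with a Gevrey expansion in a wide sector -/

/-- The integral of `inverseKernel k (e^{μ+γ}) H(γ)` along a Hankel contour with vertices
`x₀ ± iφ`. -/
noncomputable def inverseIntegral (k φ x₀ : ℝ) (μ : ℂ) (H : ℂ → ℂ) : ℂ :=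
  ∫ y, inverseKernel k (exp (μ + hankelPath x₀ (-φ) φ y)) * H (hankelPath x₀ (-φ) φ y) *
    hankelDir (-φ) φ y

theorem hankelPath_mem {x₀ φ : ℝ} (hφ : 0 ≤ φ) (y : ℝ) :
    hankelPath x₀ (-φ) φ y ∈ Ici x₀ ×ℂ Icc (-φ) φ := by
  refine ⟨?_, ?_⟩
  · simpa using le_hankelRe y
  · simpa using hankelIm_mem (by linarith : -φ ≤ φ) y

section inverseIntegral

variable {k c φ x₀ D b : ℝ} {μ : ℂ} {H : ℂ → ℂ}

theorem continuous_inverseIntegral_integrand (hk : 0 < k) (hφ : 0 ≤ φ)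
    (hH : ContinuousOn H (Ici x₀ ×ℂ Icc (-φ) φ)) (μ : ℂ) :
    Continuous fun y => inverseKernel k (exp (μ + hankelPath x₀ (-φ) φ y)) *
      H (hankelPath x₀ (-φ) φ y) := by
  have h1 := (differentiable_inverseKernel hk).continuous
  have h2 : Continuous (hankelPath x₀ (-φ) φ) := continuous_hankelPath
  exact (h1.comp (by fun_prop)).mul (hH.comp_continuous h2 fun y => hankelPath_mem hφ y)

theorem norm_inverseIntegral_integrand_le (hk : 0 < k) (hc : 0 < c) (hφ : 0 ≤ φ)
    (hm : Real.cos (-φ + μ.im) ≤ -c) (hp : Real.cos (φ + μ.im) ≤ -c)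
    (hHb : ∀ γ ∈ Ici x₀ ×ℂ Icc (-φ) φ, ‖H γ‖ ≤ D * Real.exp (-(b * γ.re))) (y : ℝ) :
    ‖inverseKernel k (exp (μ + hankelPath x₀ (-φ) φ y)) * H (hankelPath x₀ (-φ) φ y)‖ ≤
      (k + 3 + (k + 1) / c) * Real.exp (2 * Real.exp (μ.re + x₀)) *
        (D * Real.exp (-(b * hankelRe x₀ (-φ) φ y))) := by
  rw [norm_mul]
  have h1 := hHb _ (hankelPath_mem hφ y)
  rw [hankelPath_re] at h1
  gcongr
  exact norm_inverseKernel_hankel_le hk hc (by linarith) hm hp y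

theorem integrable_inverseIntegral (hk : 0 < k) (hc : 0 < c) (hφ : 0 ≤ φ) (hb : 0 < b)
    (hm : Real.cos (-φ + μ.im) ≤ -c) (hp : Real.cos (φ + μ.im) ≤ -c)
    (hH : ContinuousOn H (Ici x₀ ×ℂ Icc (-φ) φ))
    (hHb : ∀ γ ∈ Ici x₀ ×ℂ Icc (-φ) φ, ‖H γ‖ ≤ D * Real.exp (-(b * γ.re))) :
    Integrable fun y => inverseKernel k (exp (μ + hankelPath x₀ (-φ) φ y)) *
      H (hankelPath x₀ (-φ) φ y) * hankelDir (-φ) φ y := by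
  have hi : Integrable fun y => (k + 3 + (k + 1) / c) * Real.exp (2 * Real.exp (μ.re + x₀)) *
        (D * Real.exp (-(b * hankelRe x₀ (-φ) φ y))) :=
    ((integrable_exp_neg_mul_hankelRe (by linarith) hb).const_mul _).const_mul _
  refine hi.mono' ((continuous_inverseIntegral_integrand hk hφ hH μ).measurable.mul
    measurable_hankelDir).aestronglyMeasurable (Eventually.of_forall fun y => ?_)
  rw [norm_mul, norm_hankelDir, mul_one]
  exact norm_inverseIntegral_integrand_le hk hc hφ hm hp hHb y

theorem norm_inverseIntegral_le (hk : 0 < k) (hc : 0 < c) (hφ : 0 ≤ φ)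
    (hm : Real.cos (-φ + μ.im) ≤ -c) (hp : Real.cos (φ + μ.im) ≤ -c) (hD : 0 ≤ D)
    (hHb : ∀ γ ∈ Ici x₀ ×ℂ Icc (-φ) φ, ‖H γ‖ ≤ D * Real.exp (-(b * γ.re))) {b₀ : ℝ}
    (hb₀ : 0 < b₀) (hbb : b₀ ≤ b) :
    ‖inverseIntegral k φ x₀ μ H‖ ≤ (k + 3 + (k + 1) / c) *
      (∫ y, Real.exp (-(b₀ * |y - hankelIm (-φ) φ y|))) *
        Real.exp (2 * Real.exp (μ.re + x₀)) * (D * Real.exp (-(b * x₀))) := by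
  have hle : -φ ≤ φ := by linarith
  have hi := (integrable_exp_neg_mul_abs_sub_hankelIm hle hb₀).const_mul
    ((k + 3 + (k + 1) / c) * Real.exp (2 * Real.exp (μ.re + x₀)) * (D * Real.exp (-(b * x₀))))
  refine (norm_integral_le_of_norm_le hi (Eventually.of_forall fun y => ?_)).trans_eq ?_
  · rw [norm_mul, norm_hankelDir, mul_one]
    refine (norm_inverseIntegral_integrand_le hk hc hφ hm hp hHb y).trans ?_
    rw [mul_assoc _ (D * _), mul_assoc D, ← Real.exp_add]
    gcongr
    rw [hankelRe]
    have := mul_le_mul_of_nonneg_right hbb (abs_nonneg (y - hankelIm (-φ) φ y))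
    linarith
  · rw [integral_const_mul]; ring

/-- The integral does not depend on the vertices of the contour. -/
theorem inverseIntegral_eq {x₁ : ℝ} (hk : 0 < k) (hc : 0 < c) (hφ : 0 ≤ φ) (hb : 0 < b)
    (hm : Real.cos (-φ + μ.im) ≤ -c) (hp : Real.cos (φ + μ.im) ≤ -c)
    (hH : DifferentiableOn ℂ H (Ici x₀ ×ℂ Icc (-φ) φ))
    (hHb : ∀ γ ∈ Ici x₀ ×ℂ Icc (-φ) φ, ‖H γ‖ ≤ D * Real.exp (-(b * γ.re))) (hx : x₀ ≤ x₁) :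
    inverseIntegral k φ x₀ μ H = inverseIntegral k φ x₁ μ H := by
  have hle : -φ ≤ φ := by linarith
  have hsub : Ici x₁ ×ℂ Icc (-φ) φ ⊆ Ici x₀ ×ℂ Icc (-φ) φ := fun γ hγ => ⟨hx.trans hγ.1, hγ.2⟩
  set G : ℂ → ℂ := fun γ => inverseKernel k (exp (μ + γ)) * H γ with hG
  have hGd : DifferentiableOn ℂ G (Ici x₀ ×ℂ Icc (-φ) φ) := by
    refine DifferentiableOn.mul (Differentiable.differentiableOn ?_) hH
    exact (differentiable_inverseKernel hk).comp (by fun_prop)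
  have hline : ∀ s : ℝ, s ∈ Icc (-φ) φ → (∀ x : ℝ, x₀ < x →
      ∃ y, (x + s * I : ℂ) = hankelPath x₀ (-φ) φ y) →
      IntegrableOn (fun x : ℝ => G (x + s * I)) (Ioi x₀) := by
    intro s hs hy
    have hi := ((integrableOn_exp_mul_Ioi (neg_neg_of_pos hb) x₀).const_mul D).const_mul
      ((k + 3 + (k + 1) / c) * Real.exp (2 * Real.exp (μ.re + x₀)))
    refine Integrable.mono' hi (ContinuousOn.aestronglyMeasurable (hGd.continuousOn.comp
      (by fun_prop) fun x hx => ⟨?_, ?_⟩) measurableSet_Ioi) ?_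
    · simpa using (le_of_lt hx : x₀ ≤ x)
    · simpa using hs
    · filter_upwards [ae_restrict_mem measurableSet_Ioi] with x hx
      obtain ⟨y, hy⟩ := hy x hx
      have h1 := norm_inverseIntegral_integrand_le hk hc hφ hm hp hHb y
      have h2 : hankelRe x₀ (-φ) φ y = x := by
        rw [← hankelPath_re, ← hy]; simp
      rw [← hy, h2] at h1
      rwa [neg_mul]
  refine integral_hankelPath_eq hle hx hGd
    (integrable_inverseIntegral hk hc hφ hb hm hp hH.continuousOn hHb) ?_ ?_
    (integrable_inverseIntegral hk hc hφ hb hm hp (hH.continuousOn.mono hsub)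
      fun γ hγ => hHb γ (hsub hγ))
  · refine hline φ ⟨hle, le_rfl⟩ fun x hx => ⟨x - x₀ + φ, ?_⟩
    rw [hankelPath_of_gt hle (by linarith)]
    congr 2; ring
  · refine hline (-φ) ⟨le_rfl, hle⟩ fun x hx => ⟨x₀ - φ - x, ?_⟩
    rw [hankelPath_of_lt hle (by linarith)]
    congr 2; ring

end inverseIntegral

/-- The coefficients of a Gevrey expansion satisfy Gevrey estimates, as differences of successive
remainders. -/
theorem GevreyBound.isGevrey {s : ℝ} (hs : 0 ≤ s) {f : ℂ → ℂ → ℂ} {a : ℕ → ℂ → ℂ} {S : Set ℂ}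
    {ρ : ℝ} (h : GevreyBound s f a S ρ) (hS : S.Nonempty) : IsGevrey s a ρ := by
  obtain ⟨A, hA, B, hB, h⟩ := h
  obtain ⟨w, hw⟩ := hS
  set E := Real.exp w.re
  refine ⟨A * (1 + B * E), by positivity, B * Real.exp s, by positivity, fun n z hz => ?_⟩
  have h1 := h n w hw z hz
  have h2 := h (n + 1) w hw z hz
  rw [Finset.sum_range_succ] at h2
  have h3 : ‖a n z * exp w ^ n‖ ≤ A * B ^ n * (n.factorial : ℝ) ^ s * E ^ n +
      A * B ^ (n + 1) * ((n + 1).factorial : ℝ) ^ s * E ^ (n + 1) := by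
    refine le_trans (le_of_eq ?_) ((norm_sub_le _ _).trans (add_le_add h1 h2))
    congr 1; ring
  rw [norm_mul, norm_pow, norm_exp] at h3
  have hfac : ((n + 1).factorial : ℝ) ^ s ≤ Real.exp s ^ n * (n.factorial : ℝ) ^ s := by
    rw [Nat.factorial_succ]; push_cast
    rw [Real.mul_rpow (by positivity) (by positivity)]
    gcongr
    exact add_one_rpow_le hs n
  have h4 : (1 : ℝ) ≤ Real.exp s ^ n := one_le_pow₀ (Real.one_le_exp hs)
  refine le_of_mul_le_mul_right (h3.trans ?_) (by positivity : 0 < E ^ n)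
  calc A * B ^ n * (n.factorial : ℝ) ^ s * E ^ n +
      A * B ^ (n + 1) * ((n + 1).factorial : ℝ) ^ s * E ^ (n + 1)
      ≤ A * B ^ n * (Real.exp s ^ n * (n.factorial : ℝ) ^ s) * E ^ n +
      A * B ^ (n + 1) * (Real.exp s ^ n * (n.factorial : ℝ) ^ s) * E ^ (n + 1) := by
        gcongr
        exact le_mul_of_one_le_left (by positivity) h4
    _ = _ := by ring

theorem factorial_rpow_le (s : ℝ) (hs : 0 ≤ s) (N : ℕ) :
    (N.factorial : ℝ) ^ s ≤ Real.exp (s * (N * Real.log N)) := by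
  rcases Nat.eq_zero_or_pos N with rfl | hN
  · simp
  · have h1 : (N.factorial : ℝ) ≤ (N : ℝ) ^ N := by exact_mod_cast Nat.factorial_le_pow N
    calc (N.factorial : ℝ) ^ s ≤ ((N : ℝ) ^ N) ^ s := by gcongr
      _ = Real.exp (s * (N * Real.log N)) := by
        rw [← Real.rpow_natCast, ← Real.rpow_mul (by positivity),
          Real.rpow_def_of_pos (by exact_mod_cast hN)]
        congr 1; ring

/-- A function with a Gevrey expansion of order `1/k` in a sector of opening larger than `π/k`
around `d` has a `k`-summable expansion in the direction `d`. The continued Borel transform is the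
integral of `f` against `inverseKernel`, with the constant term split off for convergence at
`t = 0`; it is the sum of its Taylor series by the estimates of the remainders. -/
theorem GevreyBound.isSummableIn {k R d α β ℓ ρ : ℝ} (hk : 0 < k) (hR : 0 < R)
    (hα : α < d - Real.pi / (2 * k)) (hβ : d + Real.pi / (2 * k) < β) (hρ : 0 < ρ)
    {f : ℂ → ℂ → ℂ} {a : ℕ → ℂ → ℂ} (ha : ∀ n, DifferentiableOn ℂ (a n) (disc R))
    (hf : HolomorphicOn (strip α β ℓ) ρ f) (hb : GevreyBound (1 / k) f a (strip α β ℓ) ρ) :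
    IsSummableIn k R a d := by
  have hπ := Real.pi_pos
  have hpk : 0 < Real.pi / (2 * k) := by positivity
  -- the opening of the contour
  set m := min (β - d) (d - α) with hm
  have hm1 : m ≤ β - d := min_le_left _ _
  have hm2 : m ≤ d - α := min_le_right _ _
  have hmk : Real.pi / 2 < k * m := by
    have : Real.pi / (2 * k) < m := lt_min (by linarith) (by linarith)
    rw [div_lt_iff₀ (by positivity)] at this
    linarith
  set η := min (Real.pi / 8) ((k * m - Real.pi / 2) / 4) with hη
  have hη0 : 0 < η := lt_min (by linarith) (by linarith)
  have hη1 : η ≤ Real.pi / 8 := min_le_left _ _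
  have hη2 : η ≤ (k * m - Real.pi / 2) / 4 := min_le_right _ _
  set φ := Real.pi / 2 + 2 * η with hφ
  have hφ0 : 0 ≤ φ := by positivity
  have hφm : φ / k < m := by rw [div_lt_iff₀ hk]; linarith
  set c := -Real.cos (Real.pi / 2 + η) with hc
  have hc0 : 0 < c := by
    rw [hc, neg_pos]; exact Real.cos_neg_of_pi_div_two_lt_of_lt (by linarith) (by linarith)
  have hcp : ∀ s : ℝ, |s| ≤ η → Real.cos (φ + s) ≤ -c := by
    intro s hs
    rw [hc, neg_neg]
    have := abs_le.1 hs
    exact Real.cos_le_cos_of_nonneg_of_le_pi (by linarith) (by linarith) (by linarith)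
  have hcm : ∀ s : ℝ, |s| ≤ η → Real.cos (-φ + s) ≤ -c := by
    intro s hs
    rw [← Real.cos_neg, neg_add, neg_neg]
    exact hcp (-s) (by rwa [abs_neg])
  obtain ⟨A, hA, B, hB, hrem⟩ := id hb
  set x₀ := -(k * ℓ) + 1 with hx₀
  have hmem : ∀ x ≥ x₀, ∀ γ ∈ Ici x ×ℂ Icc (-φ) φ, d * I - γ / k ∈ strip α β ℓ := by
    intro x hx γ hγ
    have h1 : x ≤ γ.re := hγ.1
    have h2 : |γ.im| ≤ φ := abs_le.2 hγ.2
    have h3 : |γ.im / k| < m := by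
      rw [abs_div, abs_of_pos hk]; exact (div_le_div_of_nonneg_right h2 hk.le).trans_lt hφm
    rw [abs_lt] at h3
    refine ⟨⟨?_, ?_⟩, ?_⟩
    · simp [div_ofReal_im]; linarith
    · simp [div_ofReal_im]; linarith
    · simp only [sub_re, mul_re, ofReal_re, I_re, mul_zero, ofReal_im, I_im, mul_one, sub_self,
        div_ofReal_re, zero_sub]
      rw [neg_lt, lt_div_iff₀ hk]; linarith
  -- the remainders on the contour
  set H : ℕ → ℂ → ℂ → ℂ := fun N z γ =>
    f (d * I - γ / k) z - ∑ n ∈ Finset.range N, a n z * exp (d * I - γ / k) ^ n with hH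
  have hHd : ∀ N, ∀ z ∈ disc ρ, ∀ x ≥ x₀,
      DifferentiableOn ℂ (H N z) (Ici x ×ℂ Icc (-φ) φ) := by
    intro N z hz x hx
    refine DifferentiableOn.sub ((hf.fst hz).comp (by fun_prop) (hmem x hx)) (by fun_prop)
  have hHb : ∀ N, ∀ z ∈ disc ρ, ∀ x ≥ x₀, ∀ γ ∈ Ici x ×ℂ Icc (-φ) φ, ‖H N z γ‖ ≤
      A * B ^ N * (N.factorial : ℝ) ^ (1 / k) * Real.exp (-(N / k * γ.re)) := by
    intro N z hz x hx γ hγ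
    refine (hrem N _ (hmem x hx γ hγ) z hz).trans_eq ?_
    rw [← Real.exp_nat_mul]
    congr 2
    simp [div_ofReal_re]; ring
  have hD : ∀ N : ℕ, 0 ≤ A * B ^ N * (N.factorial : ℝ) ^ (1 / k) := fun N => by positivity
  have hNk : ∀ N : ℕ, 1 ≤ N → (0 : ℝ) < N / k := fun N hN =>
    div_pos (by exact_mod_cast hN) hk
  set μ : ℂ → ℂ := fun σ => k * (σ - d * I) with hμ
  have hμre : ∀ σ, (μ σ).re = k * σ.re := fun σ => by simp [hμ]
  have hμim : ∀ σ, (μ σ).im = k * (σ.im - d) := fun σ => by simp [hμ]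
  set S := unboundedSector d (2 * η / k) with hS
  have hSμ : ∀ σ ∈ S, |(μ σ).im| < η := by
    intro σ hσ
    rw [hμim, abs_mul, abs_of_pos hk, ← lt_div_iff₀' hk, abs_lt]
    have h1 := hσ.1
    have h2 := hσ.2
    have h3 : 2 * η / k / 2 = η / k := by ring
    rw [h3] at h1 h2
    constructor <;> linarith
  set K := (k + 3 + (k + 1) / c) *
      (∫ y, Real.exp (-(1 / k * |y - hankelIm (-φ) φ y|))) with hK
  have hK0 : 0 ≤ K := by
    have : 0 ≤ ∫ y, Real.exp (-(1 / k * |y - hankelIm (-φ) φ y|)) :=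
      integral_nonneg fun y => (Real.exp_pos _).le
    positivity
  have hJ : ∀ N : ℕ, 1 ≤ N → ∀ σ ∈ S, ∀ z ∈ disc ρ, ∀ x ≥ x₀,
      ‖inverseIntegral k φ x (μ σ) (H N z)‖ ≤ K * Real.exp (2 * Real.exp (k * σ.re + x)) *
        (A * B ^ N * (N.factorial : ℝ) ^ (1 / k) * Real.exp (-(N / k * x))) := by
    intro N hN σ hσ z hz x hx
    have := norm_inverseIntegral_le hk hc0 hφ0 (hcm _ (hSμ σ hσ).le)
      (hcp _ (hSμ σ hσ).le) (hD N) (hHb N z hz x hx) (one_div_pos.2 hk)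
      (by gcongr; exact_mod_cast hN)
    rwa [hμre] at this
  -- successive remainders differ by the terms of the modified Borel transform
  have hJs : ∀ N : ℕ, 1 ≤ N → ∀ σ ∈ S, ∀ z ∈ disc ρ,
      inverseIntegral k φ x₀ (μ σ) (H N z) - inverseIntegral k φ x₀ (μ σ) (H (N + 1) z) =
        2 * Real.pi * I * (borelCoeff k a N z * exp σ ^ N) := by
    intro N hN σ hσ z hz
    have hi : ∀ N, 1 ≤ N → Integrable fun y =>
        inverseKernel k (exp (μ σ + hankelPath x₀ (-φ) φ y)) *
        H N z (hankelPath x₀ (-φ) φ y) * hankelDir (-φ) φ y := fun N hN =>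
      integrable_inverseIntegral hk hc0 hφ0 (hNk N hN) (hcm _ (hSμ σ hσ).le)
        (hcp _ (hSμ σ hσ).le) (hHd N z hz x₀ le_rfl).continuousOn (hHb N z hz x₀ le_rfl)
    have hs := abs_lt.1 (hSμ σ hσ)
    have hmom := integral_inverseKernel (x₀ := x₀) hk hc0 (hcm _ (hSμ σ hσ).le)
      (hcp _ (hSμ σ hσ).le) ⟨by linarith, by linarith⟩ ⟨by linarith, by linarith⟩
      (Nat.lt_of_lt_of_le Nat.zero_lt_one hN)
    rw [inverseIntegral, inverseIntegral, ← integral_sub (hi N hN) (hi (N + 1) (by omega))]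
    have hpt : ∀ y, inverseKernel k (exp (μ σ + hankelPath x₀ (-φ) φ y)) *
        H N z (hankelPath x₀ (-φ) φ y) * hankelDir (-φ) φ y -
        inverseKernel k (exp (μ σ + hankelPath x₀ (-φ) φ y)) *
        H (N + 1) z (hankelPath x₀ (-φ) φ y) * hankelDir (-φ) φ y =
        a N z * exp (d * I) ^ N * (inverseKernel k (exp (μ σ + hankelPath x₀ (-φ) φ y)) *
        (exp (-(N / k : ℝ) * hankelPath x₀ (-φ) φ y) * hankelDir (-φ) φ y)) := by
      intro y
      set γ := hankelPath x₀ (-φ) φ y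
      have h1 : H N z γ - H (N + 1) z γ = a N z * exp (d * I - γ / k) ^ N := by
        simp only [hH, Finset.sum_range_succ]; ring
      have h2 : exp (d * I - γ / k) ^ N = exp (d * I) ^ N * exp (-(N / k : ℝ) * γ) := by
        rw [← Complex.exp_nat_mul, ← Complex.exp_nat_mul, ← Complex.exp_add]
        congr 1; push_cast; ring
      linear_combination (inverseKernel k (exp (μ σ + γ)) * hankelDir (-φ) φ y) * (h1.trans
        (congrArg (a N z * ·) h2))
    simp_rw [hpt]
    rw [integral_const_mul, hmom, borelCoeff]
    have h3 : exp (d * I) ^ N * exp ((N / k : ℝ) * μ σ) = exp σ ^ N := by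
      rw [← Complex.exp_nat_mul, ← Complex.exp_nat_mul, ← Complex.exp_add]
      congr 1
      have : (k : ℂ) ≠ 0 := ofReal_ne_zero.2 hk.ne'
      simp only [hμ]; push_cast; field_simp; ring
    rw [← h3]; push_cast; ring
  have h2π : (2 * Real.pi * I : ℂ) ≠ 0 := by simp [hπ.ne']
  set g : ℂ → ℂ → ℂ := fun σ z =>
    a 0 z + (2 * Real.pi * I)⁻¹ * inverseIntegral k φ x₀ (μ σ) (H 1 z) with hg
  have hgN : ∀ N : ℕ, 1 ≤ N → ∀ σ ∈ S, ∀ z ∈ disc ρ,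
      g σ z - ∑ n ∈ Finset.range N, borelCoeff k a n z * exp σ ^ n =
        (2 * Real.pi * I)⁻¹ * inverseIntegral k φ x₀ (μ σ) (H N z) := by
    intro N hN σ hσ z hz
    induction N, hN using Nat.le_induction with
    | base => simp [hg, borelCoeff]
    | succ N hN ih =>
      rw [Finset.sum_range_succ, ← sub_sub, ih, ← mul_right_inj' h2π, mul_sub,
        mul_inv_cancel_left₀ h2π, mul_inv_cancel_left₀ h2π]
      linear_combination hJs N hN σ hσ z hz
  have hgev := hb.isGevrey (one_div_pos.2 hk).le (strip_nonempty (by linarith) ℓ)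
  have hdisc : disc (min ρ R) ⊆ disc ρ := ball_subset_ball (min_le_left _ _)
  refine ⟨min ρ R, lt_min hρ hR, min_le_right _ _, 2 * η / k, by positivity, g, ?_, ⟨?_, ?_⟩, ?_⟩
  · obtain ⟨A', hA', B', hB', h⟩ := hgev
    exact ⟨A', hA', B', hB', fun n z hz => h n z (hdisc hz)⟩
  · have h0 : DifferentiableOn ℂ (fun p : ℂ × ℂ => a 0 p.2) (S ×ˢ disc (min ρ R)) :=
      (ha 0).comp differentiableOn_snd fun p hp => ball_subset_ball (min_le_right _ _) hp.2
    refine DifferentiableOn.add h0 (DifferentiableOn.const_mul ?_ _)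
    refine differentiableOn_integral ((isOpen_unboundedSector _ _).prod isOpen_ball)
      (F := fun p y => inverseKernel k (exp (μ p.1 + hankelPath x₀ (-φ) φ y)) *
        H 1 p.2 (hankelPath x₀ (-φ) φ y) * hankelDir (-φ) φ y)
      (fun y => ?_) (fun p hp => ?_) fun p hp => ⟨1, one_pos, fun y =>
        (k + 3 + (k + 1) / c) * Real.exp (2 * Real.exp (k * (p.1.re + 1) + x₀)) *
        (A * B ^ 1 * ((1 : ℕ).factorial : ℝ) ^ (1 / k) *
          Real.exp (-(((1 : ℕ) : ℝ) / k * hankelRe x₀ (-φ) φ y))), ?_, fun q hq y => ?_⟩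
    · refine DifferentiableOn.mul_const (DifferentiableOn.mul ?_ ?_) _
      · exact ((differentiable_inverseKernel hk).comp (by fun_prop)).differentiableOn
      · simp only [hH, Finset.range_one, Finset.sum_singleton, pow_zero, mul_one]
        refine DifferentiableOn.sub (DifferentiableOn.comp (g := f _)
          (hf.snd (hmem x₀ le_rfl _ (hankelPath_mem hφ0 y))) differentiableOn_snd
          fun p hp => hdisc hp.2) h0
    · exact ((continuous_inverseIntegral_integrand hk hφ0
        (hHd 1 p.2 (hdisc hp.2) x₀ le_rfl).continuousOn (μ p.1)).measurable.mul
        measurable_hankelDir).aestronglyMeasurable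
    · exact ((integrable_exp_neg_mul_hankelRe (by linarith) (hNk 1 le_rfl)).const_mul _).const_mul _
    · have hqS := hSμ q.1 hq.2.1
      rw [norm_mul, norm_hankelDir, mul_one]
      refine (norm_inverseIntegral_integrand_le hk hc0 hφ0 (hcm _ hqS.le) (hcp _ hqS.le)
        (hHb 1 q.2 (hdisc hq.2.2) x₀ le_rfl) y).trans ?_
      have hre : q.1.re ≤ p.1.re + 1 := by
        have h1 : dist q.1 p.1 < 1 := (le_max_left _ _).trans_lt hq.1
        have h2 := (le_abs_self _).trans (abs_re_le_norm (q.1 - p.1))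
        rw [dist_eq] at h1
        rw [sub_re] at h2
        linarith
      rw [hμre]
      beta_reduce
      gcongr
  · intro α' _ hα'
    obtain ⟨A', hA', B', hB', h⟩ := hgev
    refine ⟨A' + (2 * Real.pi)⁻¹ * (K * (A * B * Real.exp (-(1 / k * x₀)))), by positivity,
      2 * Real.exp x₀, by positivity, fun σ hσ z hz => ?_⟩
    have hσS : σ ∈ S := ⟨by linarith [hσ.1], by linarith [hσ.2]⟩
    have h1 := hJ 1 le_rfl σ hσS z (hdisc hz) x₀ le_rfl
    have h2 := h 0 z (hdisc hz)
    simp only [pow_zero, pow_one, Nat.factorial_zero, Nat.factorial_one, Nat.cast_one,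
      Real.one_rpow, mul_one] at h1 h2
    have h3 : ‖(2 * Real.pi * I : ℂ)⁻¹‖ = (2 * Real.pi)⁻¹ := by
      simp [abs_of_pos hπ]
    have h4 : 2 * Real.exp (k * σ.re + x₀) = 2 * Real.exp x₀ * Real.exp (k * σ.re) := by
      rw [Real.exp_add]; ring
    have h5 : 1 ≤ Real.exp (2 * Real.exp x₀ * Real.exp (k * σ.re)) :=
      Real.one_le_exp (by positivity)
    rw [exp_rpow_eq, add_mul]
    refine (norm_add_le _ _).trans (add_le_add (h2.trans (le_mul_of_one_le_right hA'.le h5)) ?_)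
    rw [norm_mul, h3, mul_assoc]
    gcongr
    refine h1.trans_eq ?_
    rw [h4]; ring
  · obtain ⟨A₀, hA₀, B₀, hB₀, hbc⟩ := hgev.borelCoeff_le hk
    refine ⟨min (Real.exp (-(x₀ / k))) (min (1 / (Real.exp 2 * B)) (1 / B₀)), by positivity,
      fun σ hσ z hz => ?_⟩
    have hσS : σ ∈ S := hσ.1
    have hσ2 : Real.exp σ.re < min (Real.exp (-(x₀ / k))) (min (1 / (Real.exp 2 * B)) (1 / B₀)) :=
      hσ.2
    obtain ⟨h1, h2, h3⟩ : Real.exp σ.re < Real.exp (-(x₀ / k)) ∧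
        Real.exp σ.re < 1 / (Real.exp 2 * B) ∧ Real.exp σ.re < 1 / B₀ := by
      simpa only [lt_min_iff] using hσ2
    rw [Real.exp_lt_exp, lt_neg, div_lt_iff₀ hk] at h1
    rw [lt_div_iff₀ (by positivity)] at h2 h3
    have hsum : Summable fun n => borelCoeff k a n z * exp σ ^ n := by
      refine Summable.of_norm_bounded (g := fun n => A₀ * (Real.exp σ.re * B₀) ^ n)
        ((summable_geometric_of_lt_one (by positivity) h3).mul_left A₀) fun n => ?_
      rw [norm_mul, norm_pow, norm_exp, mul_pow, mul_left_comm]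
      have := hbc n z (hdisc hz)
      calc ‖borelCoeff k a n z‖ * Real.exp σ.re ^ n ≤ A₀ * B₀ ^ n * Real.exp σ.re ^ n := by gcongr
        _ = _ := by ring
    rw [hsum.hasSum_iff_tendsto_nat, tendsto_iff_norm_sub_tendsto_zero]
    have hlim : Tendsto (fun N : ℕ => (2 * Real.pi)⁻¹ * (K * A) *
        (Real.exp σ.re * (Real.exp 2 * B)) ^ N) atTop (𝓝 0) := by
      rw [← mul_zero ((2 * Real.pi)⁻¹ * (K * A))]
      exact (tendsto_pow_atTop_nhds_zero_of_lt_one (by positivity) h2).const_mul _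
    refine squeeze_zero' (Eventually.of_forall fun N => norm_nonneg _) ?_ hlim
    filter_upwards [eventually_ge_atTop 1] with N hN
    have hN0 : (1 : ℝ) ≤ N := by exact_mod_cast hN
    -- the vertices of the contour are placed where `e^{μ+γ}` has modulus `N`,
    -- so that `e^{-N x / k}` compensates `(N!)^{1/k}`
    set x := Real.log N - k * σ.re with hx
    have hxx : x₀ ≤ x := by
      have := Real.log_nonneg hN0
      linarith
    have hs := hSμ σ hσS
    have h4 : ‖(2 * Real.pi * I : ℂ)⁻¹‖ = (2 * Real.pi)⁻¹ := by
      simp [abs_of_pos hπ]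
    rw [norm_sub_rev, hgN N hN σ hσS z (hdisc hz), norm_mul, h4, inverseIntegral_eq hk hc0 hφ0
      (hNk N hN) (hcm _ hs.le) (hcp _ hs.le) (hHd N z (hdisc hz) x₀ le_rfl)
      (hHb N z (hdisc hz) x₀ le_rfl) hxx, mul_assoc _ (K * A)]
    gcongr
    refine (hJ N hN σ hσS z (hdisc hz) x hxx).trans ?_
    have h5 : Real.exp (k * σ.re + x) = N := by
      rw [hx, add_sub_cancel, Real.exp_log (by linarith)]
    have h6 : (N.factorial : ℝ) ^ (1 / k) * Real.exp (-(N / k * x)) ≤ Real.exp σ.re ^ N := by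
      calc (N.factorial : ℝ) ^ (1 / k) * Real.exp (-(N / k * x))
          ≤ Real.exp (1 / k * (N * Real.log N)) * Real.exp (-(N / k * x)) := by
            gcongr
            exact factorial_rpow_le _ (one_div_pos.2 hk).le N
        _ = Real.exp σ.re ^ N := by
            rw [← Real.exp_add, ← Real.exp_nat_mul, hx]
            congr 1
            field_simp
            ring
    rw [h5]
    calc K * Real.exp (2 * N) * (A * B ^ N * (N.factorial : ℝ) ^ (1 / k) *
          Real.exp (-(N / k * x)))
        = K * Real.exp (2 * N) * (A * B ^ N) * ((N.factorial : ℝ) ^ (1 / k) *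
          Real.exp (-(N / k * x))) := by ring
      _ ≤ K * Real.exp (2 * N) * (A * B ^ N) * Real.exp σ.re ^ N := by gcongr
      _ = K * A * (Real.exp σ.re * (Real.exp 2 * B)) ^ N := by
        rw [mul_pow, mul_pow, mul_comm (2 : ℝ), Real.exp_nat_mul]; ring

/-! ### Properties of `k`-sums -/

theorem IsBorelContinuation.mono {k d ε ρ d' ε' ρ' : ℝ} {a : ℕ → ℂ → ℂ} {g : ℂ → ℂ → ℂ}
    (h : IsBorelContinuation k a d ε ρ g) (hd : |d' - d| + ε' / 2 ≤ ε / 2) (hρ : ρ' ≤ ρ) :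
    IsBorelContinuation k a d' ε' ρ' g := by
  have hz : disc ρ' ⊆ disc ρ := ball_subset_ball hρ
  have hsub : ∀ α α' : ℝ, |d' - d| + α' / 2 ≤ α / 2 →
      unboundedSector d' α' ⊆ unboundedSector d α := by
    intro α α' h w hw
    have h1 := le_abs_self (d' - d)
    have h2 := neg_abs_le (d' - d)
    exact ⟨by linarith [hw.1], by linarith [hw.2]⟩
  obtain ⟨⟨A, hA, B, hB, hg⟩, ⟨hh, hgr⟩, δ, hδ, hs⟩ := h
  refine ⟨⟨A, hA, B, hB, fun n z hz' => hg n z (hz hz')⟩, ⟨hh.mono (hsub _ _ hd) hρ,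
    fun α hα hαε => ?_⟩, δ, hδ, fun w hw z hz' => hs w ⟨hsub _ _ hd hw.1, hw.2⟩ z (hz hz')⟩
  have hab := abs_nonneg (d' - d)
  obtain ⟨C₁, h1, C₂, h2, hb⟩ := hgr (2 * |d' - d| + α) (by linarith) (by linarith)
  exact ⟨C₁, h1, C₂, h2, fun w hw z hz' => hb w (hsub _ _ (by linarith) hw) z (hz hz')⟩

/-- The modified Borel transform has at most one continuation. -/
theorem IsBorelContinuation.eq {k d ε₁ ε₂ ρ₁ ρ₂ : ℝ} {a : ℕ → ℂ → ℂ} {g₁ g₂ : ℂ → ℂ → ℂ}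
    (hε₁ : 0 < ε₁) (hε₂ : 0 < ε₂) (h₁ : IsBorelContinuation k a d ε₁ ρ₁ g₁)
    (h₂ : IsBorelContinuation k a d ε₂ ρ₂ g₂) {z : ℂ} (hz₁ : z ∈ disc ρ₁) (hz₂ : z ∈ disc ρ₂) :
    EqOn (fun w => g₁ w z) (fun w => g₂ w z) (unboundedSector d (min ε₁ ε₂)) := by
  have hsub : ∀ ε, min ε₁ ε₂ ≤ ε → unboundedSector d (min ε₁ ε₂) ⊆ unboundedSector d ε :=
    fun ε h w hw => ⟨by linarith [hw.1], by linarith [hw.2]⟩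
  have hs₁ := hsub ε₁ (min_le_left _ _)
  have hs₂ := hsub ε₂ (min_le_right _ _)
  obtain ⟨δ₁, hδ₁, hsum₁⟩ := h₁.series
  obtain ⟨δ₂, hδ₂, hsum₂⟩ := h₂.series
  have hε : 0 < min ε₁ ε₂ := lt_min hε₁ hε₂
  refine eqOn_of_eqOn_open (isOpen_unboundedSector _ _) (convex_unboundedSector _ _)
    ((h₁.growth.1.fst hz₁).mono hs₁) ((h₂.growth.1.fst hz₂).mono hs₂)
    (isOpen_puncturedDisc (min δ₁ δ₂)) ?_ fun w hw => ?_
  · refine ⟨⟨Real.log (min δ₁ δ₂) - 1, d⟩, ⟨sub_lt_self _ (half_pos hε),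
      lt_add_of_pos_right _ (half_pos hε)⟩, ?_⟩
    rw [mem_puncturedDisc_iff (lt_min hδ₁ hδ₂)]
    simp
  · have hw2 : Real.exp w.re < min δ₁ δ₂ := hw.2
    exact (hsum₁ w ⟨hs₁ hw.1, hw2.trans_le (min_le_left _ _)⟩ z hz₁).unique
      (hsum₂ w ⟨hs₂ hw.1, hw2.trans_le (min_le_right _ _)⟩ z hz₂)

theorem ecalle_congr {k θ : ℝ} {g₁ g₂ : ℂ → ℂ} (h : ∀ x : ℝ, g₁ (x + θ * I) = g₂ (x + θ * I))
    (w : ℂ) : ecalle k θ g₁ w = ecalle k θ g₂ w := by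
  simp only [ecalle, h]

theorem sector_mono {d η η' r r' : ℝ} (hη : η' ≤ η) (hr : r' ≤ r) :
    sector d η' r' ⊆ sector d η r := fun w hw =>
  ⟨⟨by linarith [hw.1.1], by linarith [hw.1.2]⟩, (show Real.exp w.re < r' from hw.2).trans_le hr⟩

theorem sector_nonempty {d η r : ℝ} (hη : 0 < η) (hr : 0 < r) : (sector d η r).Nonempty := by
  refine ⟨⟨Real.log r - 1, d⟩, ⟨by simp; linarith, by simp; linarith⟩, ?_⟩
  rw [mem_puncturedDisc_iff hr]
  simp

theorem IsSum.congr {k R d η r ρ : ℝ} {a : ℕ → ℂ → ℂ} {S S' : Set ℂ} {f f' : ℂ → ℂ → ℂ}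
    (h : IsSum k R a d S f) (hη : 0 < η) (hr : 0 < r) (hρ : 0 < ρ) (hS : sector d η r ⊆ S')
    (hff : ∀ w ∈ sector d η r, ∀ z ∈ disc ρ, f' w z = f w z) : IsSum k R a d S' f' := by
  obtain ⟨ρ₁, hρ₁, hρR, ε, hε, g, hg, η₁, hη₁, r₁, hr₁, _, hf⟩ := h
  have hm : sector d (min η η₁) (min r r₁) ⊆ sector d η r :=
    sector_mono (min_le_left _ _) (min_le_left _ _)
  refine ⟨min ρ ρ₁, lt_min hρ hρ₁, (min_le_right _ _).trans hρR, ε, hε, g,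
    hg.mono (by simp) (min_le_right _ _), min η η₁, lt_min hη hη₁, min r r₁, lt_min hr hr₁,
    hm.trans hS, fun w hw z hz => ?_⟩
  rw [hff w (hm hw) z (ball_subset_ball (min_le_left _ _) hz)]
  exact hf w (sector_mono (min_le_right _ _) (min_le_right _ _) hw) z
    (ball_subset_ball (min_le_right _ _) hz)

/-- Two `k`-sums in the same direction agree near `t = 0`. -/
theorem IsSum.eq {k R d : ℝ} {a : ℕ → ℂ → ℂ} {S S' : Set ℂ} {f f' : ℂ → ℂ → ℂ}
    (h : IsSum k R a d S f) (h' : IsSum k R a d S' f') :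
    ∃ η > 0, ∃ r > 0, ∃ ρ > 0, sector d η r ⊆ S ∩ S' ∧
      ∀ w ∈ sector d η r, ∀ z ∈ disc ρ, f w z = f' w z := by
  obtain ⟨ρ₁, hρ₁, _, ε₁, hε₁, g₁, hg₁, η₁, hη₁, r₁, hr₁, hs₁, hf₁⟩ := h
  obtain ⟨ρ₂, hρ₂, _, ε₂, hε₂, g₂, hg₂, η₂, hη₂, r₂, hr₂, hs₂, hf₂⟩ := h'
  have hm₁ : sector d (min η₁ η₂) (min r₁ r₂) ⊆ sector d η₁ r₁ :=
    sector_mono (min_le_left _ _) (min_le_left _ _)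
  have hm₂ : sector d (min η₁ η₂) (min r₁ r₂) ⊆ sector d η₂ r₂ :=
    sector_mono (min_le_right _ _) (min_le_right _ _)
  refine ⟨min η₁ η₂, lt_min hη₁ hη₂, min r₁ r₂, lt_min hr₁ hr₂, min ρ₁ ρ₂, lt_min hρ₁ hρ₂,
    subset_inter (hm₁.trans hs₁) (hm₂.trans hs₂), fun w hw z hz => ?_⟩
  have hz₁ : z ∈ disc ρ₁ := ball_subset_ball (min_le_left _ _) hz
  have hz₂ : z ∈ disc ρ₂ := ball_subset_ball (min_le_right _ _) hz
  rw [hf₁ w (hm₁ hw) z hz₁, hf₂ w (hm₂ hw) z hz₂]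
  exact ecalle_congr (fun x => hg₁.eq hε₁ hε₂ hg₂ hz₁ hz₂
    (mem_unboundedSector_line (by simpa using ⟨hε₁, hε₂⟩) x)) w

/-- `k`-sums in the same direction that are holomorphic on convex domains agree on the
intersection of their domains. -/
theorem IsSum.eqOn {k R d ρ ρ' : ℝ} {a : ℕ → ℂ → ℂ} {S S' : Set ℂ} {f f' : ℂ → ℂ → ℂ}
    (hS : IsOpen S) (hSc : Convex ℝ S) (hS' : IsOpen S') (hSc' : Convex ℝ S')
    (hρ : 0 < ρ) (hρ' : 0 < ρ')
    (hf : HolomorphicOn S ρ f) (hf' : HolomorphicOn S' ρ' f')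
    (h : IsSum k R a d S f) (h' : IsSum k R a d S' f') :
    ∀ w ∈ S ∩ S', ∀ z ∈ disc (min ρ ρ'), f w z = f' w z := by
  obtain ⟨η, hη, r, hr, ρ₁, hρ₁, hsub, heq⟩ := h.eq h'
  refine (hf.mono inter_subset_left (min_le_left _ _)).eq_of_eqOn (hS.inter hS')
    (hSc.inter hSc') (hf'.mono inter_subset_right (min_le_right _ _)) (isOpen_sector d η r)
    ?_ (lt_min hρ hρ') hρ₁ fun w hw z hz => heq w hw.2 z (ball_subset_ball (min_le_right _ _) hz)
  obtain ⟨w, hw⟩ := sector_nonempty hη hr (d := d)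
  exact ⟨w, hsub hw, hw⟩

/-- The `k`-sum in the direction `d` is also the `k`-sum in the nearby directions, and has the
Gevrey expansion `û` in a sector of opening larger than `π/k` around `d`. -/
theorem IsSum.exists_gevreyBound {k R d r ρ₀ : ℝ} (hk : 0 < k) (hr : 0 < r) (hρ₀ : 0 < ρ₀)
    {a : ℕ → ℂ → ℂ} {f : ℂ → ℂ → ℂ} (hf : HolomorphicOn (puncturedDisc r) ρ₀ f)
    (h : IsSum k R a d (puncturedDisc r) f) :
    ∃ η > 0, (∀ θ, |θ - d| < η → IsSum k R a θ (puncturedDisc r) f) ∧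
      ∃ ℓ, ∃ ρ > 0, GevreyBound (1 / k) f a
        (strip (d - Real.pi / (2 * k) - η) (d + Real.pi / (2 * k) + η) ℓ) ρ := by
  have hπ := Real.pi_pos
  have hpk : 0 < Real.pi / (2 * k) := by positivity
  obtain ⟨ρ₁, hρ₁, hρR, ε, hε, g, hg, η₁, hη₁, r₁, hr₁, hs₁, hf₁⟩ := h
  obtain ⟨η, hη, hηε, ℓ, A, hA, B, hB, F, hFd, hFe, hFb⟩ := hg.exists_sum hk hε
  set ℓ' := min ℓ (Real.log r) with hℓ'
  have hℓ1 : ℓ' ≤ ℓ := min_le_left _ _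
  have hℓ2 : ℓ' ≤ Real.log r := min_le_right _ _
  set S := strip (d - Real.pi / (2 * k) - η) (d + Real.pi / (2 * k) + η) ℓ' with hS
  have hSr : S ⊆ puncturedDisc r := strip_subset_puncturedDisc _ _ hr hℓ2
  have hSF : ∀ w ∈ S, |w.im - d| < Real.pi / (2 * k) + η ∧ w.re < ℓ := fun w hw =>
    ⟨abs_lt.2 ⟨by linarith [hw.1.1], by linarith [hw.1.2]⟩, hw.2.trans_le hℓ1⟩
  set ρ := min ρ₀ ρ₁ with hρ
  have hρ0 : 0 < ρ := lt_min hρ₀ hρ₁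
  have heq : ∀ z ∈ disc ρ, EqOn (fun w => f w z) (fun w => F w z) S := by
    intro z hz
    have hz0 : z ∈ disc ρ₀ := ball_subset_ball (min_le_left _ _) hz
    have hz1 : z ∈ disc ρ₁ := ball_subset_ball (min_le_right _ _) hz
    refine eqOn_of_eqOn_open (isOpen_strip _ _ _) (convex_strip _ _ _) ((hf.fst hz0).mono hSr)
      ((hFd z hz1).mono hSF) (isOpen_sector d (min η₁ η) r₁) ?_ fun w hw => ?_
    · refine ⟨⟨min ℓ' (Real.log r₁) - 1, d⟩, ⟨⟨by simp; linarith, by simp; linarith⟩, ?_⟩,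
        ⟨?_, ?_⟩, ?_⟩
      · have := min_le_left ℓ' (Real.log r₁); simp only; linarith
      · simpa using lt_min hη₁ hη
      · simpa using lt_min hη₁ hη
      · rw [mem_puncturedDisc_iff hr₁]
        have := min_le_right ℓ' (Real.log r₁); simp only; linarith
    · have h1 := hw.2.1.1
      have h2 := hw.2.1.2
      have h3 := min_le_right η₁ η
      rw [hf₁ w (sector_mono (min_le_left _ _) le_rfl hw.2) z hz1,
        hFe d (by simpa using hη.le) w (abs_lt.2 ⟨by linarith, by linarith⟩) (hSF w hw.1).2 z hz1]
  refine ⟨η, hη, fun θ hθ => ?_, ℓ', ρ, hρ0, A, hA, B, hB, fun N w hw z hz => ?_⟩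
  · set η' := min η (Real.pi / (2 * k)) with hη'
    have h1 : η' ≤ η := min_le_left _ _
    have h2 : η' ≤ Real.pi / (2 * k) := min_le_right _ _
    have h0 : 0 < η' := lt_min hη hpk
    have hsub : sector θ η' (Real.exp ℓ') ⊆ S := by
      intro w hw
      have h3 : w.re < ℓ' := Real.exp_lt_exp.1 hw.2
      have h4 := hw.1.1
      have h5 := hw.1.2
      have h6 := abs_lt.1 hθ
      exact ⟨⟨by linarith, by linarith⟩, h3⟩
    refine ⟨ρ, hρ0, (min_le_right _ _).trans hρR, ε / 2, by positivity, g,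
      hg.mono (by linarith) (min_le_right _ _), η', h0, Real.exp ℓ', Real.exp_pos _,
      hsub.trans hSr, fun w hw z hz => ?_⟩
    rw [← hFe θ hθ.le w (abs_lt.2 ⟨by linarith [hw.1.1], by linarith [hw.1.2]⟩)
      (hSF w (hsub hw)).2 z (ball_subset_ball (min_le_right _ _) hz)]
    exact heq z hz (hsub hw)
  · have h1 := heq z hz hw
    simp only at h1
    rw [h1]
    exact hFb N w (hSF w hw).1 (hSF w hw).2 z (ball_subset_ball (min_le_right _ _) hz)

theorem GevreyBound.union {s ρ : ℝ} {f : ℂ → ℂ → ℂ} {a : ℕ → ℂ → ℂ} {S S' : Set ℂ}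
    (h : GevreyBound s f a S ρ) (h' : GevreyBound s f a S' ρ) : GevreyBound s f a (S ∪ S') ρ := by
  obtain ⟨A, hA, B, hB, h⟩ := h
  obtain ⟨A', hA', B', hB', h'⟩ := h'
  refine ⟨max A A', lt_max_of_lt_left hA, max B B', lt_max_of_lt_left hB, fun N w hw z hz => ?_⟩
  rcases hw with hw | hw
  · refine (h N w hw z hz).trans ?_
    gcongr
    exacts [le_max_left _ _, le_max_left _ _]
  · refine (h' N w hw z hz).trans ?_
    gcongr
    exacts [le_max_right _ _, le_max_right _ _]

/-- A function that is the `k`-sum in all directions `θ ∈ (d₁, d₂)` has the expansion `û` for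
`d₁ - π/(2k) < arg t < d₂ + π/(2k)`, by compactness of the intervals of directions. -/
theorem hasGevreyExpansion_of_isSum {k R r ρ₀ d₁ d₂ : ℝ} (hk : 0 < k) (hr : 0 < r)
    (hρ₀ : 0 < ρ₀) (hd : d₁ < d₂) {a : ℕ → ℂ → ℂ} {f : ℂ → ℂ → ℂ}
    (hf : HolomorphicOn (puncturedDisc r) ρ₀ f)
    (h : ∀ θ, d₁ < θ → θ < d₂ → IsSum k R a θ (puncturedDisc r) f) :
    HasGevreyExpansion (1 / k) f a (d₁ - Real.pi / (2 * k)) (d₂ + Real.pi / (2 * k)) := by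
  intro α β hα hβ
  set x₁ := min (α + Real.pi / (2 * k)) ((d₁ + d₂) / 2) with hx₁
  set x₂ := max (β - Real.pi / (2 * k)) ((d₁ + d₂) / 2) with hx₂
  have h1 : d₁ < x₁ := lt_min (by linarith) (by linarith)
  have h2 : x₂ < d₂ := max_lt (by linarith) (by linarith)
  have h3 : x₁ ≤ x₂ := (min_le_right _ _).trans (le_max_right _ _)
  have h4 : x₁ ≤ α + Real.pi / (2 * k) := min_le_left _ _
  have h5 : β - Real.pi / (2 * k) ≤ x₂ := le_max_left _ _
  have key : ∃ ℓ, ∃ ρ > 0, GevreyBound (1 / k) f a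
      {w | (∃ θ ∈ Icc x₁ x₂, |w.im - θ| < Real.pi / (2 * k)) ∧ w.re < ℓ} ρ := by
    refine isCompact_Icc.induction_on (p := fun T => ∃ ℓ, ∃ ρ > 0, GevreyBound (1 / k) f a
      {w | (∃ θ ∈ T, |w.im - θ| < Real.pi / (2 * k)) ∧ w.re < ℓ} ρ) ?_ ?_ ?_ ?_
    · exact ⟨0, 1, one_pos, 1, one_pos, 1, one_pos, fun N w hw => by simp at hw⟩
    · rintro T T' hT ⟨ℓ, ρ, hρ, hb⟩
      exact ⟨ℓ, ρ, hρ, hb.mono (fun w ⟨⟨θ, hθ, h⟩, h'⟩ => ⟨⟨θ, hT hθ, h⟩, h'⟩) le_rfl⟩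
    · rintro T T' ⟨ℓ, ρ, hρ, hb⟩ ⟨ℓ', ρ', hρ', hb'⟩
      refine ⟨min ℓ ℓ', min ρ ρ', lt_min hρ hρ', ((hb.mono subset_rfl (min_le_left _ _)).union
        (hb'.mono subset_rfl (min_le_right _ _))).mono ?_ le_rfl⟩
      rintro w ⟨⟨θ, hθ | hθ, h⟩, h'⟩
      · exact Or.inl ⟨⟨θ, hθ, h⟩, lt_of_lt_of_le h' (min_le_left _ _)⟩
      · exact Or.inr ⟨⟨θ, hθ, h⟩, lt_of_lt_of_le h' (min_le_right _ _)⟩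
    · intro θ hθ
      obtain ⟨η, hη, -, ℓ, ρ, hρ, hb⟩ := (h θ (by linarith [hθ.1]) (by linarith [hθ.2])
        ).exists_gevreyBound hk hr hρ₀ hf
      refine ⟨ball θ η, mem_nhdsWithin_of_mem_nhds (ball_mem_nhds θ hη), ℓ, ρ, hρ,
        hb.mono ?_ le_rfl⟩
      rintro w ⟨⟨θ', hθ', h'⟩, hw⟩
      rw [mem_ball, Real.dist_eq] at hθ'
      rw [abs_lt] at hθ' h'
      exact ⟨⟨by linarith, by linarith⟩, hw⟩
  obtain ⟨ℓ, ρ, hρ, hb⟩ := key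
  refine ⟨ℓ, ρ, hρ, hb.mono (fun w hw => ⟨⟨max x₁ (min w.im x₂),
    ⟨le_max_left _ _, max_le h3 (min_le_right _ _)⟩, ?_⟩, hw.2⟩) le_rfl⟩
  have h6 := hw.1.1
  have h7 := hw.1.2
  have hpk : 0 < Real.pi / (2 * k) := by have := Real.pi_pos; positivity
  rw [abs_lt]
  rcases max_cases x₁ (min w.im x₂) with h8 | h8 <;> rcases min_cases w.im x₂ with h9 | h9 <;>
    constructor <;> linarith

/-- A `k`-sum in one direction of an interval of nonsingular directions is the `k`-sum in all of
them, since the set of these directions is open and closed in the interval. -/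
theorem IsSum.of_mem_Ioo {k R r ρ₀ d₁ d₂ θ₀ : ℝ} (hk : 0 < k) (hr : 0 < r) (hρ₀ : 0 < ρ₀)
    {a : ℕ → ℂ → ℂ} {f : ℂ → ℂ → ℂ} (hf : HolomorphicOn (puncturedDisc r) ρ₀ f)
    (hsum : ∀ θ ∈ Ioo d₁ d₂, ∃ r' > 0, ∃ ρ' > 0, ∃ f', HolomorphicOn (puncturedDisc r') ρ' f' ∧
      IsSum k R a θ (puncturedDisc r') f')
    (hθ₀ : θ₀ ∈ Ioo d₁ d₂) (h : IsSum k R a θ₀ (puncturedDisc r) f) :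
    ∀ θ ∈ Ioo d₁ d₂, IsSum k R a θ (puncturedDisc r) f := by
  have hopen : IsOpen {θ | IsSum k R a θ (puncturedDisc r) f} := by
    rw [Metric.isOpen_iff]
    intro θ hθ
    obtain ⟨η, hη, h', -⟩ := IsSum.exists_gevreyBound hk hr hρ₀ hf hθ
    exact ⟨η, hη, fun θ' hθ' => h' θ' (by rwa [mem_ball, Real.dist_eq] at hθ')⟩
  refine isPreconnected_Ioo.subset_of_closure_inter_subset hopen ⟨θ₀, hθ₀, h⟩ ?_
  rintro θ ⟨hcl, hθ⟩
  obtain ⟨r', hr', ρ', hρ', f', hf', hs'⟩ := hsum θ hθ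
  obtain ⟨η, hη, hnear, -⟩ := hs'.exists_gevreyBound hk hr' hρ' hf'
  obtain ⟨θ', hθ', hdist⟩ := Metric.mem_closure_iff.1 hcl η hη
  have heq := IsSum.eqOn (isOpen_puncturedDisc r) (convex_puncturedDisc hr)
    (isOpen_puncturedDisc r') (convex_puncturedDisc hr') hρ₀ hρ' hf hf' hθ'
    (hnear θ' (by rwa [dist_comm, Real.dist_eq] at hdist))
  have hsub : sector θ 1 (min r r') ⊆ puncturedDisc r ∩ puncturedDisc r' := fun w hw =>
    ⟨(show Real.exp w.re < _ from hw.2).trans_le (min_le_left _ _),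
      (show Real.exp w.re < _ from hw.2).trans_le (min_le_right _ _)⟩
  exact hs'.congr one_pos (lt_min hr hr') (lt_min hρ₀ hρ')
    (hsub.trans inter_subset_left) fun w hw z hz => heq w (hsub hw) z hz

/-! ### Rotation by the period -/

/-- The terms of `û` are invariant under the rotations by all multiples of the period. -/
theorem mul_exp_pow_eq {z : ℂ} {a : ℕ → ℂ → ℂ} {P : ℝ}
    (h : ∀ n : ℕ, a n z * exp (P * I) ^ n = a n z) (l : ℤ) (n : ℕ) :
    a n z * exp ((l * P : ℝ) * I) ^ n = a n z := by
  have e : exp ((l * P : ℝ) * I) ^ n = (exp (P * I) ^ n) ^ l := by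
    rw [← Complex.exp_nat_mul, ← Complex.exp_nat_mul, ← Complex.exp_int_mul]
    congr 1; push_cast; ring
  rw [e]
  by_cases h0 : a n z = 0
  · simp [h0]
  · have : exp (P * I) ^ n = 1 := by
      have := h n
      rwa [mul_eq_left₀ h0] at this
    simp [this]

theorem mem_puncturedDisc_add_I {r c : ℝ} {w : ℂ} :
    w + c * I ∈ puncturedDisc r ↔ w ∈ puncturedDisc r := by
  simp [puncturedDisc]

theorem periodic_int {r P : ℝ} {h : ℂ → ℂ} (hP : ∀ w ∈ puncturedDisc r, h (w + P * I) = h w)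
    (l : ℤ) : ∀ w ∈ puncturedDisc r, h (w + (l * P : ℝ) * I) = h w := by
  induction l with
  | zero => simp
  | succ n ih =>
    intro w hw
    have := hP (w + ((n : ℤ) * P : ℝ) * I) (mem_puncturedDisc_add_I.2 hw)
    rw [← ih w hw, ← this]
    congr 1; push_cast; ring
  | pred n ih =>
    intro w hw
    have := hP (w + ((-(n : ℤ) - 1 : ℤ) * P : ℝ) * I) (mem_puncturedDisc_add_I.2 hw)
    rw [← ih w hw, ← this]
    congr 1; push_cast; ring

theorem dt_congr {S : Set ℂ} (hS : IsOpen S) {ρ : ℝ} {f g : ℂ → ℂ → ℂ}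
    (h : ∀ w ∈ S, ∀ z ∈ disc ρ, f w z = g w z) :
    ∀ w ∈ S, ∀ z ∈ disc ρ, dt f w z = dt g w z := by
  intro w hw z hz
  simp only [dt]
  congr 1
  refine Filter.EventuallyEq.deriv_eq ?_
  filter_upwards [hS.mem_nhds hw] with v hv using h v hv z hz

theorem dt_iterate_congr {S : Set ℂ} (hS : IsOpen S) {ρ : ℝ} {f g : ℂ → ℂ → ℂ}
    (h : ∀ w ∈ S, ∀ z ∈ disc ρ, f w z = g w z) (j : ℕ) :
    ∀ w ∈ S, ∀ z ∈ disc ρ, (dt^[j] f) w z = (dt^[j] g) w z := by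
  induction j with
  | zero => exact h
  | succ j ih => simp only [Function.iterate_succ_apply']; exact dt_congr hS ih

theorem CauchyProblem.op_congr (pb : CauchyProblem) {S : Set ℂ} (hS : IsOpen S) {ρ : ℝ}
    {f g : ℂ → ℂ → ℂ} (h : ∀ w ∈ S, ∀ z ∈ disc ρ, f w z = g w z) :
    ∀ w ∈ S, ∀ z ∈ disc ρ, pb.op f w z = pb.op g w z := by
  intro w hw z hz
  simp only [CauchyProblem.op]
  rw [dt_iterate_congr hS h _ w hw z hz]
  congr 1
  refine Finset.sum_congr rfl fun j _ => ?_
  simp only [zOp, Polynomial.sum]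
  refine Finset.sum_congr rfl fun l _ => ?_
  congr 1
  refine Filter.EventuallyEq.iteratedDeriv_eq l ?_
  filter_upwards [isOpen_ball.mem_nhds hz] with y hy using dt_iterate_congr hS h _ w hw y hy

theorem dt_iterate_add_I {r ρ c : ℝ} {f : ℂ → ℂ → ℂ}
    (h : ∀ w ∈ puncturedDisc r, ∀ z ∈ disc ρ, f (w + c * I) z = f w z) (j : ℕ) :
    ∀ w ∈ puncturedDisc r, ∀ z ∈ disc ρ,
      exp (c * I) ^ j * (dt^[j] f) (w + c * I) z = (dt^[j] f) w z := by
  induction j with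
  | zero => simpa using h
  | succ j ih =>
    intro w hw z hz
    simp only [Function.iterate_succ_apply', dt]
    have h1 : (fun v => exp (c * I) ^ j * (dt^[j] f) (v + c * I) z) =ᶠ[𝓝 w]
        fun v => (dt^[j] f) v z := by
      filter_upwards [(isOpen_puncturedDisc r).mem_nhds hw] with v hv using ih v hv z hz
    rw [← h1.deriv_eq, deriv_const_mul_field,
      deriv_comp_add_const (fun v => (dt^[j] f) v z)]
    have : exp (c * I) * exp (-(w + c * I)) = exp (-w) := by
      rw [← Complex.exp_add]; congr 1; ring
    rw [pow_succ]
    linear_combination (exp (c * I) ^ j *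
      deriv (fun v => (dt^[j] f) v z) (w + c * I)) * this

/-- The coefficients of `∂ₜʲ û` are multiples of shifted coefficients of `û`. -/
theorem formalDt_iterate_apply (a : ℕ → ℂ → ℂ) (j n : ℕ) :
    ∃ c : ℂ, ∀ z, (formalDt^[j] a) n z = c * a (n + j) z := by
  induction j generalizing n with
  | zero => exact ⟨1, by simp⟩
  | succ j ih =>
    obtain ⟨c, hc⟩ := ih (n + 1)
    refine ⟨(n + 1) * c, fun z => ?_⟩
    rw [Function.iterate_succ_apply', formalDt, hc, mul_assoc]
    congr 3; ring

theorem GevreyBound.periodic {s r ρ₀ ρ R P : ℝ} {f : ℂ → ℂ → ℂ} {a : ℕ → ℂ → ℂ} {S : Set ℂ}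
    (h : GevreyBound s f a S ρ) (hS : S ⊆ puncturedDisc r)
    (hf : ∀ w ∈ puncturedDisc r, ∀ z ∈ disc ρ₀, f (w + P * I) z = f w z)
    (ha : ∀ n : ℕ, ∀ z ∈ disc R, a n z * exp (P * I) ^ n = a n z) :
    GevreyBound s f a {w | ∃ l : ℤ, w + (l * P : ℝ) * I ∈ S} (min ρ (min ρ₀ R)) := by
  obtain ⟨A, hA, B, hB, h⟩ := h
  refine ⟨A, hA, B, hB, fun N w ⟨l, hw⟩ z hz => ?_⟩
  have hz1 := ball_subset_ball (min_le_left _ _) hz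
  have hz2 := ball_subset_ball ((min_le_right _ _).trans (min_le_left _ _)) hz
  have hz3 := ball_subset_ball ((min_le_right _ _).trans (min_le_right _ _)) hz
  have h1 := h N _ hw z hz1
  rw [periodic_int (h := fun w => f w z) (fun w hw => hf w hw z hz2) l w
    (mem_puncturedDisc_add_I.1 (hS hw))] at h1
  have h2 : ∀ n : ℕ, a n z * exp (w + (l * P : ℝ) * I) ^ n = a n z * exp w ^ n := by
    intro n
    rw [Complex.exp_add, mul_pow, mul_left_comm, mul_exp_pow_eq (fun n => ha n z hz3) l n, mul_comm]
  simp only [h2] at h1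
  simpa using h1

/-- Rotation of a `k`-sum by an angle that leaves `û` and the sum invariant. -/
theorem IsSum.rotate {k R d r ρ₀ c : ℝ} (hρ₀ : 0 < ρ₀) {a : ℕ → ℂ → ℂ} {f : ℂ → ℂ → ℂ}
    (h : IsSum k R a d (puncturedDisc r) f)
    (hf : ∀ w ∈ puncturedDisc r, ∀ z ∈ disc ρ₀, f (w + c * I) z = f w z)
    (ha : ∀ n : ℕ, ∀ z ∈ disc R, a n z * exp (c * I) ^ n = a n z) :
    IsSum k R a (d + c) (puncturedDisc r) f := by
  obtain ⟨ρ, hρ, hρR, ε, hε, g, ⟨⟨A, hA, B, hB, hgev⟩, ⟨hgh, hgr⟩, δ, hδ, hser⟩, η, hη, r₁, hr₁,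
    hsub, hfe⟩ := h
  set T : ℂ → ℂ := fun w => w - c * I with hT
  have hTre : ∀ w, (T w).re = w.re := fun w => by simp [hT]
  have hsec : ∀ α, ∀ w ∈ unboundedSector (d + c) α, T w ∈ unboundedSector d α := by
    intro α w hw
    have h1 := hw.1
    have h2 := hw.2
    exact ⟨by simp [hT]; linarith, by simp [hT]; linarith⟩
  have hsec' : ∀ α r, ∀ w ∈ sector (d + c) α r, T w ∈ sector d α r := fun α r w hw =>
    ⟨hsec α w hw.1, by
      show Real.exp (T w).re < r
      rw [hTre]; exact hw.2⟩
  have hz : disc (min ρ₀ ρ) ⊆ disc ρ := ball_subset_ball (min_le_right _ _)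
  have hzR : disc (min ρ₀ ρ) ⊆ disc R := ball_subset_ball ((min_le_right _ _).trans hρR)
  refine ⟨min ρ₀ ρ, lt_min hρ₀ hρ, (min_le_right _ _).trans hρR, ε, hε, fun w z => g (T w) z,
    ⟨⟨A, hA, B, hB, fun n z hz' => hgev n z (hz hz')⟩, ⟨?_, fun α h0 hα => ?_⟩, δ, hδ,
      fun w hw z hz' => ?_⟩, η, hη, r₁, hr₁, fun w hw => ?_, fun w hw z hz' => ?_⟩
  · exact DifferentiableOn.comp (g := Function.uncurry g) hgh
      (by fun_prop : DifferentiableOn ℂ (fun p : ℂ × ℂ => (p.1 - c * I, p.2)) _)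
      fun p hp => ⟨hsec ε p.1 hp.1, hz hp.2⟩
  · obtain ⟨C₁, h1, C₂, h2, hb⟩ := hgr α h0 hα
    refine ⟨C₁, h1, C₂, h2, fun w hw z hz' => ?_⟩
    have := hb _ (hsec α w hw) z (hz hz')
    rwa [hTre] at this
  · have h1 := hser _ (hsec' ε δ w hw) z (hz hz')
    refine h1.congr_fun fun n => ?_
    have h2 : exp w = exp (c * I) * exp (T w) := by
      rw [← Complex.exp_add]; congr 1; simp [hT]
    rw [h2, borelCoeff, mul_pow]
    linear_combination ((n.factorial : ℂ) / (Real.Gamma (1 + n * (1 + 1 / k)) : ℂ) *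
      exp (T w) ^ n) * ha n z (hzR hz')
  · have := hsub (hsec' η r₁ w hw)
    simpa [puncturedDisc, hTre] using this
  · have h1 := hsub (hsec' η r₁ w hw)
    have h2 := hf _ h1 z (ball_subset_ball (min_le_left _ _) hz')
    simp only [hT, sub_add_cancel] at h2
    rw [h2, hfe _ (hsec' η r₁ w hw) z (hz hz'), ecalle_eq_integral, ecalle_eq_integral]
    congr 1; ext x
    simp only [hT]
    congr 2
    · push_cast; ring
    · push_cast; ring

/-! ### The Riemann surface of `t^{1/q}` -/

theorem toRoot_eq_iff {q : ℚ} {v w : ℂ} :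
    toRoot q v = toRoot q w ↔ ∃ l : ℤ, w = v + (l * (2 * q * Real.pi) : ℝ) * I := by
  rw [toRoot, toRoot, QuotientAddGroup.eq, AddSubgroup.mem_zmultiples_iff]
  refine exists_congr fun l => ?_
  rw [zsmul_eq_mul]
  constructor <;> intro h
  · rw [← neg_add_cancel_left (-v) w, ← h]; push_cast; ring
  · rw [h]; push_cast; ring

theorem mem_preimage_toRoot_image {q : ℚ} {S : Set ℂ} {w : ℂ} :
    w ∈ toRoot q ⁻¹' (toRoot q '' S) ↔ ∃ l : ℤ, w + (l * (2 * q * Real.pi) : ℝ) * I ∈ S := by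
  constructor
  · rintro ⟨v, hv, hvw⟩
    obtain ⟨l, rfl⟩ := toRoot_eq_iff.1 hvw.symm
    exact ⟨l, hv⟩
  · rintro ⟨l, hl⟩
    exact ⟨_, hl, (toRoot_eq_iff.2 ⟨l, rfl⟩).symm⟩

/-- The function on `W` defined by a function on the universal covering, by the choice of a
preimage of every point. It is of use for functions with period `2qπi`. -/
noncomputable def descend (q : ℚ) (f : ℂ → ℂ → ℂ) (t : RootSurface q) (z : ℂ) : ℂ :=
  f (Quotient.out t) z

theorem pull_descend {q : ℚ} {r ρ : ℝ} {f : ℂ → ℂ → ℂ}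
    (hf : ∀ w ∈ puncturedDisc r, ∀ z ∈ disc ρ, f (w + (2 * q * Real.pi : ℝ) * I) z = f w z) :
    ∀ w ∈ puncturedDisc r, ∀ z ∈ disc ρ, pull (descend q f) w z = f w z := by
  intro w hw z hz
  have h : toRoot q w = toRoot q (Quotient.out (toRoot q w)) :=
    (QuotientAddGroup.out_eq' (toRoot q w)).symm
  obtain ⟨l, hl⟩ := toRoot_eq_iff.1 h
  rw [pull, descend, hl]
  exact periodic_int (h := fun w => f w z) (fun w hw => hf w hw z hz) l w hw

/-! ### The arrangement of the singular directions -/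

theorem exists_pos_le {ι : Type*} [Finite ι] (x : ι → ℝ) (h : ∀ i, 0 < x i) :
    ∃ y > 0, ∀ i, y ≤ x i := by
  cases isEmpty_or_nonempty ι
  · exact ⟨1, one_pos, fun i => isEmptyElim i⟩
  · obtain ⟨i, hi⟩ := Finite.exists_min x
    exact ⟨x i, h i, hi⟩

section directions

variable {n : ℕ} {d : Fin (n + 1) → ℝ} {P : ℝ}

theorem exists_mem_Ico_castSucc_succ {φ : ℝ} (h0 : d 0 ≤ φ) (h1 : φ < d (Fin.last n)) :
    ∃ i : Fin n, d i.castSucc ≤ φ ∧ φ < d i.succ := by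
  by_contra! h
  have : ∀ j, d j ≤ φ := fun j => by
    induction j using Fin.induction with
    | zero => exact h0
    | succ i ih => exact h i ih
  exact absurd h1 (not_lt.2 (this _))

theorem exists_mem_Ico_add_int_mul (hP : 0 < P) (hlast : d (Fin.last n) = d 0 + P) (φ : ℝ) :
    ∃ i : Fin n, ∃ l : ℤ, d i.castSucc + l * P ≤ φ ∧ φ < d i.succ + l * P := by
  have h1 := Int.floor_le ((φ - d 0) / P)
  have h2 := Int.lt_floor_add_one ((φ - d 0) / P)
  rw [le_div_iff₀ hP] at h1
  rw [div_lt_iff₀ hP] at h2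
  obtain ⟨i, h3, h4⟩ := exists_mem_Ico_castSucc_succ (d := d) (φ := φ - ⌊(φ - d 0) / P⌋ * P)
    (by linarith) (by linarith)
  exact ⟨i, ⌊(φ - d 0) / P⌋, by linarith, by linarith⟩

theorem int_eq_zero_of_abs_mul_lt (hP : 0 < P) {l : ℤ} (h1 : -P < l * P) (h2 : l * P < P) :
    l = 0 := by
  have h3 : (-1 : ℝ) < l := by nlinarith
  have h4 : (l : ℝ) < 1 := by nlinarith
  have h5 : (-1 : ℤ) < l := by exact_mod_cast h3
  have h6 : l < (1 : ℤ) := by exact_mod_cast h4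
  omega

theorem eq_of_add_int_mul_eq (hmono : StrictMono d) (hP : 0 < P)
    (hlast : d (Fin.last n) = d 0 + P) {i j : Fin n} {l : ℤ}
    (h : d i.castSucc = d j.castSucc + l * P) : i = j := by
  have h1 := hmono.monotone (Fin.zero_le i.castSucc)
  have h2 := hmono.monotone (Fin.zero_le j.castSucc)
  have h3 := hmono (Fin.castSucc_lt_last i)
  have h4 := hmono (Fin.castSucc_lt_last j)
  have h5 := int_eq_zero_of_abs_mul_lt hP (l := l) (by linarith) (by linarith)
  rw [h5] at h
  exact Fin.castSucc_injective n (hmono.injective (by simpa using h))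

/-- No singular direction lies between two consecutive ones. -/
theorem not_mem_Ioo_castSucc_succ (hmono : StrictMono d) (hP : 0 < P)
    (hlast : d (Fin.last n) = d 0 + P) (i j : Fin n) (l : ℤ) :
    ¬ (d i.castSucc < d j.castSucc + l * P ∧ d j.castSucc + l * P < d i.succ) := by
  rintro ⟨h1, h2⟩
  have h3 := hmono.monotone (Fin.zero_le i.castSucc)
  have h4 := hmono.monotone (Fin.zero_le j.castSucc)
  have h5 := hmono.monotone (Fin.le_last i.succ)
  have h6 := hmono (Fin.castSucc_lt_last j)
  have h7 := int_eq_zero_of_abs_mul_lt hP (l := l) (by linarith) (by linarith)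
  rw [h7, Int.cast_zero, zero_mul, add_zero] at h1 h2
  have h8 := hmono.lt_iff_lt.1 h1
  have h9 := hmono.lt_iff_lt.1 h2
  rw [Fin.lt_def] at h8 h9
  simp at h8 h9
  omega

/-- The intervals between consecutive singular directions do not overlap. -/
theorem succ_le_or_succ_le (hmono : StrictMono d) (hP : 0 < P)
    (hlast : d (Fin.last n) = d 0 + P) {i j : Fin n} (hij : i ≠ j) (l : ℤ) :
    d i.succ ≤ d j.castSucc + l * P ∨ d j.succ + l * P ≤ d i.castSucc := by
  by_contra! h
  have h1 := not_mem_Ioo_castSucc_succ hmono hP hlast i j l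
  have h2 := not_mem_Ioo_castSucc_succ hmono hP hlast j i (-l)
  push_cast at h2
  rw [not_and_or, not_lt, not_lt] at h1 h2
  have h3 : d j.castSucc + l * P ≤ d i.castSucc := by
    rcases h1 with h1 | h1 <;> linarith
  have h4 : d i.castSucc ≤ d j.castSucc + l * P := by
    rcases h2 with h2 | h2 <;> linarith
  exact hij (eq_of_add_int_mul_eq hmono hP hlast (le_antisymm h4 h3))

end directions

theorem argLine_injective : Function.Injective argLine := by
  intro φ ψ h
  have : (⟨0, φ⟩ : ℂ) ∈ argLine ψ := h ▸ (rfl : (⟨0, φ⟩ : ℂ).im = φ)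
  exact this

/-! ### Stokes lines -/

section stokes

variable {k R P : ℝ} {a : ℕ → ℂ → ℂ} {n : ℕ} {d : Fin (n + 1) → ℝ}

theorem isSummableIn_of_mem_Ioo (hmono : StrictMono d) (hP : 0 < P)
    (hlast : d (Fin.last n) = d 0 + P)
    (hsing : ∀ φ : ℝ, ¬ IsSummableIn k R a φ ↔
      ∃ i : Fin n, ∃ l : ℤ, φ = d i.castSucc + l * P) {i : Fin n} {l : ℤ} {θ : ℝ}
    (h1 : d i.castSucc + l * P < θ) (h2 : θ < d i.succ + l * P) : IsSummableIn k R a θ := by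
  by_contra h
  obtain ⟨j, m, rfl⟩ := (hsing θ).1 h
  refine not_mem_Ioo_castSucc_succ hmono hP hlast i j (m - l) ⟨?_, ?_⟩ <;> push_cast <;> linarith

theorem isStokesLine_iff (hmono : StrictMono d) (hP : 0 < P)
    (hlast : d (Fin.last n) = d 0 + P)
    (hsing : ∀ φ : ℝ, ¬ IsSummableIn k R a φ ↔
      ∃ i : Fin n, ∃ l : ℤ, φ = d i.castSucc + l * P) (L : Set ℂ) :
    IsStokesLine k R a L ↔ ∃ i : Fin n, ∃ l : ℤ, L = argLine (d i.castSucc + l * P) := by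
  constructor
  · rintro ⟨-, φ, rfl, hφ, -⟩
    obtain ⟨i, l, rfl⟩ := (hsing φ).1 hφ
    exact ⟨i, l, rfl⟩
  · rintro ⟨i, l, rfl⟩
    obtain ⟨δ, hδ, hgap⟩ := exists_pos_le (fun i : Fin n => d i.succ - d i.castSucc)
      fun i => sub_pos.2 (hmono Fin.castSucc_lt_succ)
    have hright : ∀ (j : Fin n) (m : ℤ) (θ : ℝ), d j.castSucc + m * P < θ →
        θ < d j.castSucc + m * P + δ → IsSummableIn k R a θ := fun j m θ h1 h2 =>
      isSummableIn_of_mem_Ioo hmono hP hlast hsing h1 (by linarith [hgap j])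
    obtain ⟨ρ, hρ, hρR, _, _, g, hg⟩ :=
      hright i l (d i.castSucc + l * P + δ / 2) (by linarith) (by linarith)
    refine ⟨⟨ρ, hρ, hρR, hg.gevrey⟩, _, rfl, (hsing _).2 ⟨i, l, rfl⟩, δ, hδ,
      fun θ h1 h2 hne => ?_⟩
    rcases lt_or_gt_of_ne hne with h | h
    · by_contra hθ
      obtain ⟨j, m, rfl⟩ := (hsing θ).1 hθ
      exact (hsing _).2 ⟨i, l, rfl⟩ (hright j m _ h (by linarith))
    · exact hright i l θ h h2

theorem isAntiStokesLine_iff (hmono : StrictMono d) (hP : 0 < P)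
    (hlast : d (Fin.last n) = d 0 + P)
    (hsing : ∀ φ : ℝ, ¬ IsSummableIn k R a φ ↔
      ∃ i : Fin n, ∃ l : ℤ, φ = d i.castSucc + l * P) (L : Set ℂ) :
    IsAntiStokesLine k R a L ↔ ∃ i : Fin n, ∃ l : ℤ,
      L = argLine (d i.castSucc + Real.pi / (2 * k) + l * P) ∨
        L = argLine (d i.castSucc - Real.pi / (2 * k) + l * P) := by
  simp only [IsAntiStokesLine, isStokesLine_iff hmono hP hlast hsing]
  constructor
  · rintro ⟨φ, ⟨i, l, h⟩, hL⟩
    rw [argLine_injective h] at hL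
    refine ⟨i, l, hL.imp (fun h => ?_) fun h => ?_⟩ <;> rw [h] <;> congr 1 <;> ring
  · rintro ⟨i, l, hL⟩
    refine ⟨_, ⟨i, l, rfl⟩, hL.imp (fun h => ?_) fun h => ?_⟩ <;> rw [h] <;> congr 1 <;> ring

end stokes

/-! ### Maximal families -/

/-- If `f` has the expansion `û` in two overlapping sectors whose union contains a sector of
opening larger than `π/k` around `d`, then `d` is a nonsingular direction. -/
theorem isSummableIn_of_overlap {k R d r ρ₀ ρ₁ ρ₂ α₁ β₁ ℓ₁ α₂ β₂ ℓ₂ : ℝ} (hk : 0 < k)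
    (hR : 0 < R) (hr : 0 < r) (hρ₀ : 0 < ρ₀) (hρ₁ : 0 < ρ₁) (hρ₂ : 0 < ρ₂)
    {f : ℂ → ℂ → ℂ} {a : ℕ → ℂ → ℂ} (ha : ∀ n, DifferentiableOn ℂ (a n) (disc R))
    (hf : HolomorphicOn (puncturedDisc r) ρ₀ f)
    (h₁ : GevreyBound (1 / k) f a (strip α₁ β₁ ℓ₁) ρ₁)
    (h₂ : GevreyBound (1 / k) f a (strip α₂ β₂ ℓ₂) ρ₂)
    (hα : α₁ < d - Real.pi / (2 * k)) (h : α₂ < β₁) (hβ : d + Real.pi / (2 * k) < β₂) :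
    IsSummableIn k R a d := by
  set ℓ := min (min ℓ₁ ℓ₂) (Real.log r)
  set ρ := min (min ρ₁ ρ₂) ρ₀
  have hℓ₁ : ℓ ≤ ℓ₁ := (min_le_left _ _).trans (min_le_left _ _)
  have hℓ₂ : ℓ ≤ ℓ₂ := (min_le_left _ _).trans (min_le_right _ _)
  have hρ₁' : ρ ≤ ρ₁ := (min_le_left _ _).trans (min_le_left _ _)
  have hρ₂' : ρ ≤ ρ₂ := (min_le_left _ _).trans (min_le_right _ _)
  refine GevreyBound.isSummableIn (ℓ := ℓ) (ρ := ρ) hk hR hα hβ (lt_min (lt_min hρ₁ hρ₂) hρ₀) ha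
    (hf.mono (strip_subset_puncturedDisc _ _ hr (min_le_right _ _)) (min_le_right _ _))
    (((h₁.mono (strip_mono le_rfl le_rfl hℓ₁) hρ₁').union
      (h₂.mono (strip_mono le_rfl le_rfl hℓ₂) hρ₂')).mono (fun w hw => ?_) le_rfl)
  rcases lt_or_ge w.im β₁ with h' | h'
  · exact Or.inl ⟨⟨hw.1.1, h'⟩, hw.2⟩
  · exact Or.inr ⟨⟨h.trans_le h', hw.1.2⟩, hw.2⟩

theorem exists_int_mem_Ioo {P α β : ℝ} (hP : 0 < P) (h : α + P < β) (x : ℝ) :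
    ∃ l : ℤ, α < x + l * P ∧ x + l * P < β := by
  refine ⟨⌊(α - x) / P⌋ + 1, ?_, ?_⟩
  · have := Int.lt_floor_add_one ((α - x) / P)
    rw [div_lt_iff₀ hP] at this
    push_cast; linarith
  · have := Int.floor_le ((α - x) / P)
    rw [le_div_iff₀ hP] at this
    push_cast; linarith

/-- The initial conditions hold on all sheets of the preimage of a sector on `W`. The rotations
multiply `∂ₜʲ f` by a root of unity, which is `1` unless `φ_j` vanishes. -/
theorem HasGevreyExpansion.tendsto_dt_iterate {s α β α' β' r ρ₀ R P : ℝ} (hs : 0 ≤ s)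
    (hr : 0 < r) (hρ₀ : 0 < ρ₀) (hR : 0 < R) {f : ℂ → ℂ → ℂ} {a : ℕ → ℂ → ℂ}
    (hf : HolomorphicOn (puncturedDisc r) ρ₀ f)
    (hfP : ∀ w ∈ puncturedDisc r, ∀ z ∈ disc ρ₀, f (w + P * I) z = f w z)
    (haP : ∀ n : ℕ, ∀ z ∈ disc R, a n z * exp (P * I) ^ n = a n z)
    (h : HasGevreyExpansion s f a α β) (hα : α < α') (hβ : β' < β) (j : ℕ) :
    ∃ ρ > 0, ∀ z ∈ disc ρ, ∀ S : Set ℂ,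
      (∀ w ∈ S, w ∈ puncturedDisc r ∧ ∃ l : ℤ, α' < w.im + l * P ∧ w.im + l * P < β') →
      Tendsto (fun w => (StokesPDE.dt^[j] f) w z) (comap re atBot ⊓ 𝓟 S)
        (𝓝 ((formalDt^[j] a) 0 z)) := by
  obtain ⟨ℓ, ρ, hρ, A, hA, B, hB, hb⟩ := h.dt_iterate hs hr hρ₀ hf j α' β' hα hβ
  refine ⟨min ρ (min ρ₀ R), by positivity, fun z hz S hS => ?_⟩
  have hz1 := ball_subset_ball (min_le_left _ _) hz
  have hz2 := ball_subset_ball ((min_le_right _ _).trans (min_le_left _ _)) hz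
  have hz3 := ball_subset_ball ((min_le_right _ _).trans (min_le_right _ _)) hz
  obtain ⟨c, hc⟩ := formalDt_iterate_apply a j 0
  rw [zero_add] at hc
  rw [tendsto_iff_norm_sub_tendsto_zero]
  have hlim : Tendsto (fun w : ℂ => A * B * Real.exp w.re) (comap re atBot ⊓ 𝓟 S) (𝓝 0) := by
    rw [← mul_zero (A * B)]
    exact ((Real.tendsto_exp_atBot.comp tendsto_comap).mono_left inf_le_left).const_mul _
  refine squeeze_zero' (Eventually.of_forall fun w => norm_nonneg _) ?_ hlim
  refine eventually_inf_principal.2 ?_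
  filter_upwards [tendsto_comap.eventually (eventually_lt_atBot ℓ)] with w hw hwS
  obtain ⟨hwr, l, hl1, hl2⟩ := hS w hwS
  have h1 := dt_iterate_add_I (c := l * P) (ρ := min ρ₀ R) (fun w hw z hz =>
    periodic_int (h := fun w => f w z) (fun w hw => hfP w hw z
      (ball_subset_ball (min_le_left _ _) hz)) l w hw) j w hwr z
    (ball_subset_ball (min_le_right _ _) hz)
  have h2 : exp ((l * P : ℝ) * I) ^ j * (formalDt^[j] a) 0 z = (formalDt^[j] a) 0 z := by
    rw [hc]
    linear_combination c * mul_exp_pow_eq (fun n => haP n z hz3) l j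
  have h3 := hb 1 (w + (l * P : ℝ) * I) ⟨by simpa using ⟨hl1, hl2⟩, by simpa using hw⟩ z hz1
  rw [← h1, ← h2, ← mul_sub, norm_mul, norm_pow, norm_exp_ofReal_mul_I, one_pow, one_mul]
  simpa using h3

/-- The family of the `k`-sums in the intervals between the singular directions is a maximal
family of solutions. -/
theorem exists_isMaximalFamily (pb : CauchyProblem) {k : ℝ} (hk : 0 < k) {a : ℕ → ℂ → ℂ}
    (ha : pb.IsFormalSolution a) (hsum : IsSummable k pb.R a) {q : ℚ} (hq0 : 0 < q)
    (hper : HasPeriod k pb.R a q) {n : ℕ} {d : Fin (n + 1) → ℝ} (hmono : StrictMono d)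
    (hlast : d (Fin.last n) = d 0 + 2 * q * Real.pi)
    (hsing : ∀ φ : ℝ, ¬ IsSummableIn k pb.R a φ ↔
      ∃ i : Fin n, ∃ l : ℤ, φ = d i.castSucc + l * (2 * q * Real.pi)) :
    ∃ u : Fin n → RootSurface q → ℂ → ℂ, ∃ ε₀ > 0, ∀ ε, 0 < ε → ε < ε₀ →
      ∃ r > 0, ∃ ρ, 0 < ρ ∧ ρ ≤ pb.R ∧
        ∃ V : Fin n → Set (RootSurface q),
          (∀ i, V i = toRoot q '' {w : ℂ | w ∈ puncturedDisc r ∧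
            d i.castSucc - Real.pi / (2 * k) + ε / 2 < w.im ∧
            w.im < d i.succ + Real.pi / (2 * k) - ε / 2}) ∧
          (∀ i, HolomorphicOn (toRoot q ⁻¹' V i) ρ (pull (u i))) ∧
          (∀ i, ∀ θ, d i.castSucc < θ → θ < d i.succ →
            IsSum k pb.R a θ (toRoot q ⁻¹' V i) (pull (u i))) ∧
          IsMaximalFamily pb k a q (toRoot q '' puncturedDisc r) ρ V u := by
  have hπ := Real.pi_pos
  have hpk : 0 < Real.pi / (2 * k) := by positivity
  have hpk2 : Real.pi / k = 2 * (Real.pi / (2 * k)) := by field_simp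
  have hqR : (0 : ℝ) < q := by exact_mod_cast hq0
  have hPI : 2 * (q : ℂ) * (Real.pi : ℂ) * I = ((2 * q * Real.pi : ℝ) : ℂ) * I := by push_cast; ring
  obtain ⟨haP, hper⟩ := hper
  rw [hPI] at haP
  simp only [hPI] at hper
  set P : ℝ := 2 * q * Real.pi with hPdef
  have hP : 0 < P := by positivity
  have hgap0 : ∀ i : Fin n, d i.castSucc < d i.succ := fun i => hmono Fin.castSucc_lt_succ
  have hns : ∀ (i : Fin n) (θ : ℝ), θ ∈ Ioo (d i.castSucc) (d i.succ) →
      IsSummableIn k pb.R a θ := fun i θ hθ =>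
    isSummableIn_of_mem_Ioo hmono hP hlast hsing (i := i) (l := 0) (by simpa using hθ.1)
      (by simpa using hθ.2)
  -- the `k`-sums in the middle of the intervals, continued around `t = 0`
  have hmid : ∀ i : Fin n, (d i.castSucc + d i.succ) / 2 ∈ Ioo (d i.castSucc) (d i.succ) :=
    fun i => ⟨by linarith [hgap0 i], by linarith [hgap0 i]⟩
  choose r hr ρ hρ f hf hfs hfP using fun i => hper _ (hns i _ (hmid i))
  have hfsum : ∀ i, ∀ θ ∈ Ioo (d i.castSucc) (d i.succ),
      IsSum k pb.R a θ (puncturedDisc (r i)) (f i) := fun i =>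
    (hfs i).of_mem_Ioo hk (hr i) (hρ i) (hf i) (fun θ hθ => by
      obtain ⟨r', hr', ρ', hρ', f', hf', hs', -⟩ := hper θ (hns i θ hθ)
      exact ⟨r', hr', ρ', hρ', f', hf', hs'⟩) (hmid i)
  have hexp : ∀ i, HasGevreyExpansion (1 / k) (f i) a (d i.castSucc - Real.pi / (2 * k))
      (d i.succ + Real.pi / (2 * k)) := fun i =>
    hasGevreyExpansion_of_isSum hk (hr i) (hρ i) (hgap0 i) (hf i) fun θ h1 h2 =>
      hfsum i θ ⟨h1, h2⟩
  -- otherwise a sum with its translates by the period has the expansion in all directions, and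
  -- no direction is singular
  have hPk : Real.pi / k < P := by
    by_contra! hle
    obtain ⟨i, -, -, -⟩ := exists_mem_Ico_add_int_mul hP hlast (d := d) 0
    have hg := hgap0 i
    obtain ⟨ℓ, ρ', hρ', hb⟩ := hexp i
      (d i.castSucc - Real.pi / (2 * k) + (d i.succ - d i.castSucc) / 4)
      (d i.succ + Real.pi / (2 * k) - (d i.succ - d i.castSucc) / 4) (by linarith) (by linarith)
    have hb' := (hb.mono (strip_mono le_rfl le_rfl (min_le_left ℓ (Real.log (r i))))
      le_rfl).periodic (strip_subset_puncturedDisc _ _ (hr i) (min_le_right _ _)) (hfP i) haP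
    refine (hsing (d i.castSucc)).2 ⟨i, 0, by simp⟩ (GevreyBound.isSummableIn
      (α := d i.castSucc - Real.pi / (2 * k) - 1) (β := d i.castSucc + Real.pi / (2 * k) + 1)
      (ℓ := min ℓ (Real.log (r i))) (ρ := min ρ' (min (ρ i) pb.R)) hk pb.R_pos
      (by linarith) (by linarith) (lt_min hρ' (lt_min (hρ i) pb.R_pos)) ha.holo
      ((hf i).mono (strip_subset_puncturedDisc _ _ (hr i) (min_le_right _ _))
        ((min_le_right _ _).trans (min_le_left _ _)))
      (hb'.mono (fun w hw => ?_) le_rfl))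
    obtain ⟨l, h1, h2⟩ := exists_int_mem_Ioo hP
      (show d i.castSucc - Real.pi / (2 * k) + (d i.succ - d i.castSucc) / 4 + P <
        d i.succ + Real.pi / (2 * k) - (d i.succ - d i.castSucc) / 4 by linarith) w.im
    exact ⟨l, by simpa using ⟨h1, h2⟩, by simpa using hw.2⟩
  have hfop : ∀ i, ∀ w ∈ puncturedDisc (r i), ∀ z ∈ disc (ρ i), pb.op (f i) w z = 0 := fun i =>
    (hexp i).op_eq_zero hk (hr i) (hρ i) (by linarith [hgap0 i]) (hf i) ha
  have hpull : ∀ i, ∀ w ∈ puncturedDisc (r i), ∀ z ∈ disc (ρ i),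
      pull (descend q (f i)) w z = f i w z := fun i => pull_descend (hfP i)
  obtain ⟨δ, hδ, hgap⟩ := exists_pos_le (fun i : Fin n => d i.succ - d i.castSucc)
      fun i => sub_pos.2 (hgap0 i)
  refine ⟨fun i => descend q (f i), min δ (Real.pi / k), lt_min hδ (by positivity),
    fun ε hε hεε => ?_⟩
  have hε1 : ε < δ := hεε.trans_le (min_le_left _ _)
  have hε2 : ε / 2 < Real.pi / (2 * k) := by linarith [hεε.trans_le (min_le_right _ _)]
  -- the endpoints of the sectors
  set α : Fin n → ℝ := fun i => d i.castSucc - Real.pi / (2 * k) + ε / 2 with hα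
  set β : Fin n → ℝ := fun i => d i.succ + Real.pi / (2 * k) - ε / 2 with hβ
  have hαβ : ∀ i, Real.pi / k < β i - α i := fun i => by
    simp only [hα, hβ]; linarith [hgap i]
  choose ρ' hρ' hinit using fun p : Fin n × Fin pb.order =>
    (hexp p.1).tendsto_dt_iterate (one_div_pos.2 hk).le (hr p.1) (hρ p.1) pb.R_pos (hf p.1)
      (hfP p.1) haP (show d p.1.castSucc - Real.pi / (2 * k) < α p.1 by simp only [hα]; linarith)
      (show β p.1 < d p.1.succ + Real.pi / (2 * k) by simp only [hβ]; linarith) (p.2 : ℕ)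
  obtain ⟨r₀, hr₀, hrr⟩ := exists_pos_le r hr
  obtain ⟨ρ₁, hρ₁, hρρ⟩ := exists_pos_le ρ hρ
  obtain ⟨ρ₂, hρ₂, hρρ'⟩ := exists_pos_le ρ' hρ'
  set ρ₀ := min (min ρ₁ ρ₂) pb.R with hρ₀
  have hρ₀0 : 0 < ρ₀ := lt_min (lt_min hρ₁ hρ₂) pb.R_pos
  have hρi : ∀ i, ρ₀ ≤ ρ i := fun i =>
    ((min_le_left _ _).trans (min_le_left _ _)).trans (hρρ i)
  have hρp : ∀ p, ρ₀ ≤ ρ' p := fun p =>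
    ((min_le_left _ _).trans (min_le_right _ _)).trans (hρρ' p)
  have hρR : ρ₀ ≤ pb.R := min_le_right _ _
  set C : Fin n → Set ℂ := fun i => {w | w ∈ puncturedDisc r₀ ∧ α i < w.im ∧ w.im < β i} with hC
  have hdisc : ∀ i, puncturedDisc r₀ ⊆ puncturedDisc (r i) := fun i w hw =>
    (show Real.exp w.re < r₀ from hw).trans_le (hrr i)
  have hVmem : ∀ i w, w ∈ toRoot q ⁻¹' (toRoot q '' C i) ↔
      w ∈ puncturedDisc r₀ ∧ ∃ l : ℤ, α i < w.im + l * P ∧ w.im + l * P < β i := by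
    intro i w
    rw [mem_preimage_toRoot_image]
    constructor
    · rintro ⟨l, h1, h2⟩
      exact ⟨mem_puncturedDisc_add_I.1 h1, l, by simpa using h2⟩
    · rintro ⟨h1, l, h2⟩
      exact ⟨l, mem_puncturedDisc_add_I.2 h1, by simpa using h2⟩
  have hVr : ∀ i, toRoot q ⁻¹' (toRoot q '' C i) ⊆ puncturedDisc r₀ := fun i w hw =>
    ((hVmem i w).1 hw).1
  have hWr : toRoot q ⁻¹' (toRoot q '' puncturedDisc r₀) ⊆ puncturedDisc r₀ := by
    intro w hw
    obtain ⟨l, h⟩ := mem_preimage_toRoot_image.1 hw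
    exact mem_puncturedDisc_add_I.1 h
  have hpull₀ : ∀ i, ∀ w ∈ puncturedDisc r₀, ∀ z ∈ disc ρ₀,
      pull (descend q (f i)) w z = f i w z := fun i w hw z hz =>
    hpull i w (hdisc i hw) z (ball_subset_ball (hρi i) hz)
  have hhol : ∀ i, HolomorphicOn (puncturedDisc r₀) ρ₀ (pull (descend q (f i))) := fun i =>
    DifferentiableOn.congr ((hf i).mono (hdisc i) (hρi i)) fun p hp => hpull₀ i p.1 hp.1 p.2 hp.2
  refine ⟨r₀, hr₀, ρ₀, hρ₀0, hρR, fun i => toRoot q '' C i, fun i => rfl,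
    fun i => (hhol i).mono (hVr i) le_rfl, fun i θ h1 h2 => ?_, hsum,
    ⟨P, hPk, r₀, hr₀, Or.inr ⟨rfl, rfl⟩⟩, fun i => ⟨image_mono fun w hw => hw.1, ?_⟩, ?_,
    fun i => ⟨(hhol i).mono (hVr i) le_rfl, fun w hw z hz => ?_, fun j z hz => ?_⟩,
    fun i j hij hne => ?_, fun V' u' hV' => ?_⟩
  · refine (hfsum i θ ⟨h1, h2⟩).congr (η := 2 * (Real.pi / (2 * k) - ε / 2)) (by linarith) hr₀ hρ₀0
      (fun w hw => (hVmem i w).2 ⟨hw.2, 0, ?_⟩) fun w hw z hz => hpull₀ i w hw.2 z hz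
    have h3 := hw.1.1
    have h4 := hw.1.2
    simp only [hα, hβ]
    constructor <;> push_cast <;> linarith
  · -- a sector of opening larger than `2qπ` covers `W_r`
    rcases le_or_gt (β i - α i) P with hle | hlt
    · refine ⟨β i - α i, hαβ i, r₀, hr₀, Or.inl ⟨(by positivity : 0 < Real.pi / k).trans (hαβ i),
        hle, (α i + β i) / 2, ?_⟩⟩
      congr 1
      ext w
      have e1 : (α i + β i) / 2 - (β i - α i) / 2 = α i := by ring
      have e2 : (α i + β i) / 2 + (β i - α i) / 2 = β i := by ring
      simp only [hC, sector, unboundedSector, e1, e2]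
      exact and_comm
    · refine ⟨P, hPk, r₀, hr₀, Or.inr ⟨rfl, subset_antisymm (image_mono fun w hw => hw.1) ?_⟩⟩
      rintro _ ⟨w, hw, rfl⟩
      exact (hVmem i w).2 ⟨hw, exists_int_mem_Ioo hP (by linarith) _⟩
  · rintro _ ⟨w, hw, rfl⟩
    obtain ⟨i, l, h1, h2⟩ := exists_mem_Ico_add_int_mul hP hlast (d := d) w.im
    refine mem_iUnion.2 ⟨i, (hVmem i w).2 ⟨hw, -l, ?_⟩⟩
    simp only [hα, hβ]
    constructor <;> push_cast <;> linarith
  · rw [pb.op_congr (isOpen_puncturedDisc r₀) (hpull₀ i) w (hVr i hw) z hz]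
    exact hfop i w (hdisc i (hVr i hw)) z (ball_subset_ball (hρi i) hz)
  · rw [← ha.init j z (ball_subset_ball hρR hz)]
    refine (hinit (i, j) z (ball_subset_ball (hρp _) hz) _ fun w hw =>
      ⟨hdisc i (hVr i hw), ((hVmem i w).1 hw).2⟩).congr' ?_
    refine eventually_inf_principal.2 (Eventually.of_forall fun w hw => ?_)
    exact (dt_iterate_congr (isOpen_puncturedDisc r₀) (hpull₀ i) j w (hVr i hw) z hz).symm
  · by_contra! hcon
    obtain ⟨_, ⟨w, hwi, rfl⟩, hwj⟩ := hne
    obtain ⟨hw0, l, hl1, hl2⟩ := (hVmem j w).1 hwj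
    -- the two sums agree near `w`, hence everywhere; then a singular direction between the two
    -- intervals would be nonsingular
    have heq : ∀ w ∈ puncturedDisc r₀, ∀ z ∈ disc ρ₀, f i w z = f j w z := by
      refine HolomorphicOn.eq_of_eqOn (isOpen_puncturedDisc r₀) (convex_puncturedDisc hr₀)
        ((hf i).mono (hdisc i) (hρi i)) ((hf j).mono (hdisc j) (hρi j))
        (V := {v | (α i < v.im ∧ v.im < β i) ∧ (α j < v.im + l * P ∧ v.im + l * P < β j)})
        (((isOpen_lt continuous_const continuous_im).inter
          (isOpen_lt continuous_im continuous_const)).inter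
          ((isOpen_lt continuous_const (continuous_im.add continuous_const)).inter
            (isOpen_lt (continuous_im.add continuous_const) continuous_const)))
        ⟨w, hw0, hwi.2, hl1, hl2⟩ hρ₀0 hρ₀0 fun v hv z hz => ?_
      rw [min_self] at hz
      rw [← hpull₀ i v hv.1 z hz, ← hpull₀ j v hv.1 z hz]
      exact hcon _ ⟨⟨v, ⟨hv.1, hv.2.1⟩, rfl⟩, (hVmem j v).2 ⟨hv.1, l, hv.2.2⟩⟩ z hz
    obtain ⟨ℓ₁, σ₁, hσ₁, hb₁⟩ := hexp i (α i) (β i) (by simp only [hα]; linarith)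
      (by simp only [hβ]; linarith)
    obtain ⟨ℓ₂, σ₂, hσ₂, hb₂⟩ := hexp j (α j) (β j) (by simp only [hα]; linarith)
      (by simp only [hβ]; linarith)
    have hb₃ : GevreyBound (1 / k) (f i) a
        (strip (α j - l * P) (β j - l * P) (min ℓ₂ (Real.log r₀)))
        (min (min σ₂ (min (ρ j) pb.R)) ρ₀) := by
      refine (((hb₂.mono (strip_mono le_rfl le_rfl (min_le_left ℓ₂ (Real.log r₀)))
        le_rfl).periodic ((strip_subset_puncturedDisc _ _ hr₀ (min_le_right _ _)).trans (hdisc j))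
        (hfP j) haP).mono (fun v hv => ⟨l, ?_⟩) (min_le_left _ _)).congr fun v hv z hz =>
          heq v (strip_subset_puncturedDisc _ _ hr₀ (min_le_right _ _) hv) z
            (ball_subset_ball (min_le_right _ _) hz)
      have h1 := hv.1.1
      have h2 := hv.1.2
      refine ⟨⟨?_, ?_⟩, by simpa using hv.2⟩ <;> simp <;> linarith
    have hσ₃ : 0 < min (min σ₂ (min (ρ j) pb.R)) ρ₀ :=
      lt_min (lt_min hσ₂ (lt_min (hρ j) pb.R_pos)) hρ₀0
    have hi := hgap i
    have hj := hgap j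
    have hwi1 := hwi.2.1
    have hwi2 := hwi.2.2
    simp only [hα, hβ] at hl1 hl2 hwi1 hwi2
    rcases succ_le_or_succ_le hmono hP hlast hij (-l) with h | h <;> push_cast at h
    · refine (hsing (d j.castSucc - l * P)).2 ⟨j, -l, by push_cast; ring⟩
        (isSummableIn_of_overlap hk pb.R_pos (hr i) (hρ i) hσ₁ hσ₃ ha.holo (hf i) hb₁ hb₃ ?_ ?_ ?_)
      all_goals simp only [hα, hβ]; linarith
    · refine (hsing (d i.castSucc)).2 ⟨i, 0, by simp⟩
        (isSummableIn_of_overlap hk pb.R_pos (hr i) (hρ i) hσ₃ hσ₁ ha.holo (hf i) hb₃ hb₁ ?_ ?_ ?_)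
      all_goals simp only [hα, hβ]; linarith
  · rintro ⟨β', hβ'⟩ hsol ⟨D, hD, hDs⟩
    obtain ⟨C', hC'o, hC'c, rfl⟩ : ∃ C', IsOpen C' ∧ Convex ℝ C' ∧ V' = toRoot q '' C' := by
      obtain ⟨r', hr', ⟨-, -, θ, h⟩ | ⟨-, h⟩⟩ := hβ'
      · exact ⟨_, isOpen_sector θ β' r', convex_sector θ β' hr', h⟩
      · exact ⟨_, isOpen_puncturedDisc r', convex_puncturedDisc hr', h⟩
    have hC'V : C' ⊆ toRoot q ⁻¹' (toRoot q '' C') := subset_preimage_image _ _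
    have hC'r : toRoot q ⁻¹' (toRoot q '' C') ⊆ puncturedDisc r₀ := (preimage_mono hV').trans hWr
    obtain ⟨i, l, h1, h2⟩ := exists_mem_Ico_add_int_mul hP hlast (d := d) D
    have h1' : d i.castSucc + l * P < D := by
      refine lt_of_le_of_ne h1 fun h => ?_
      exact (hsing D).2 ⟨i, l, h.symm⟩ hD
    have hfD : IsSum k pb.R a D (puncturedDisc (r i)) (f i) := by
      have := (hfsum i (D - l * P) ⟨by linarith, by linarith⟩).rotate (hρ i) (c := l * P)
        (fun w hw z hz => periodic_int (h := fun w => f i w z)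
          (fun w hw => hfP i w hw z hz) l w hw)
        (fun m z hz => mul_exp_pow_eq (fun m => haP m z hz) l m)
      rwa [sub_add_cancel] at this
    obtain ⟨η, hη, r', hr', σ, hσ, hsub, heq⟩ := hDs.eq hfD
    set w₁ : ℂ := ⟨Real.log r' - 1, D⟩ with hw₁
    have hw₁s : w₁ ∈ sector D η r' := by
      refine ⟨⟨sub_lt_self _ (half_pos hη), lt_add_of_pos_right _ (half_pos hη)⟩, ?_⟩
      rw [mem_puncturedDisc_iff hr']
      exact sub_one_lt _
    have hw₁V := (hsub hw₁s).1
    obtain ⟨m, hm⟩ := mem_preimage_toRoot_image.1 hw₁V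
    rw [← hPdef] at hm
    have key : ∀ v ∈ C', ∀ z ∈ disc ρ₀, pull u' v z = f i v z := by
      refine HolomorphicOn.eq_of_eqOn hC'o hC'c (hsol.holo.mono hC'V le_rfl)
        ((hf i).mono ((hC'V.trans hC'r).trans (hdisc i)) (hρi i))
        (V := {v | v - (m * P : ℝ) * I ∈ sector D η r'})
        ((isOpen_sector D η r').preimage (by fun_prop)) ⟨_, hm, by simpa using hw₁s⟩ hρ₀0 hσ
        fun v hv z hz => ?_
      have e1 : pull u' (v - (m * P : ℝ) * I) z = pull u' v z := by
        have : toRoot q (v - (m * P : ℝ) * I) = toRoot q v :=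
          toRoot_eq_iff.2 ⟨m, by rw [← hPdef]; ring⟩
        rw [pull, pull, this]
      have e2 := periodic_int (h := fun w => f i w z)
        (fun w hw => hfP i w hw z (ball_subset_ball ((min_le_left _ _).trans (hρi i)) hz)) m _
        (hsub hv.2).2
      rw [← e1, heq _ hv.2 z (ball_subset_ball (min_le_right _ _) hz), ← e2]
      simp
    refine ⟨i, ⟨toRoot q w₁, hw₁V, (hVmem i w₁).2 ⟨hC'r hw₁V, -l, ?_⟩⟩, ?_⟩
    · simp only [hα, hβ, hw₁]
      constructor <;> push_cast <;> linarith
    · rintro _ ⟨⟨v, hv, rfl⟩, -⟩ z hz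
      exact (key v hv z hz).trans (hpull₀ i v (hC'r (hC'V hv)) z hz).symm

end StokesPDE

theorem theorem4p3 (pb : StokesPDE.CauchyProblem) (k : ℝ) (hk : 0 < k)
    (a : ℕ → ℂ → ℂ) (ha : pb.IsFormalSolution a)
    (hsum : StokesPDE.IsSummable k pb.R a)
    (q : ℚ) (hq : IsLeast {q' : ℚ | 0 < q' ∧ StokesPDE.HasPeriod k pb.R a q'} q)
    -- `d 0, …, d (n-1)` are the singular directions modulo `2qπ`, and `d n = d 0 + 2qπ`
    (n : ℕ) (d : Fin (n + 1) → ℝ) (hmono : StrictMono d) (h0 : 0 ≤ d 0)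
    (hlt : ∀ i : Fin n, d i.castSucc < 2 * q * Real.pi)
    (hlast : d (Fin.last n) = d 0 + 2 * q * Real.pi)
    (hsing : ∀ φ : ℝ, ¬ StokesPDE.IsSummableIn k pb.R a φ ↔
      ∃ i : Fin n, ∃ l : ℤ, φ = d i.castSucc + l * (2 * q * Real.pi)) :
    (∀ L : Set ℂ, StokesPDE.IsStokesLine k pb.R a L ↔
      ∃ i : Fin n, ∃ l : ℤ, L = StokesPDE.argLine (d i.castSucc + l * (2 * q * Real.pi))) ∧
    (∀ L : Set ℂ, StokesPDE.IsAntiStokesLine k pb.R a L ↔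
      ∃ i : Fin n, ∃ l : ℤ,
        L = StokesPDE.argLine (d i.castSucc + Real.pi / (2 * k) + l * (2 * q * Real.pi)) ∨
        L = StokesPDE.argLine (d i.castSucc - Real.pi / (2 * k) + l * (2 * q * Real.pi))) ∧
    ∃ u : Fin n → StokesPDE.RootSurface q → ℂ → ℂ, ∃ ε₀ > 0, ∀ ε, 0 < ε → ε < ε₀ →
      ∃ r > 0, ∃ ρ, 0 < ρ ∧ ρ ≤ pb.R ∧
        ∃ V : Fin n → Set (StokesPDE.RootSurface q),
          (∀ i, V i = StokesPDE.toRoot q '' {w : ℂ | w ∈ StokesPDE.puncturedDisc r ∧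
            d i.castSucc - Real.pi / (2 * k) + ε / 2 < w.im ∧
            w.im < d i.succ + Real.pi / (2 * k) - ε / 2}) ∧
          (∀ i, StokesPDE.HolomorphicOn (StokesPDE.toRoot q ⁻¹' V i) ρ (StokesPDE.pull (u i))) ∧
          (∀ i, ∀ θ, d i.castSucc < θ → θ < d i.succ →
            StokesPDE.IsSum k pb.R a θ (StokesPDE.toRoot q ⁻¹' V i) (StokesPDE.pull (u i))) ∧
          StokesPDE.IsMaximalFamily pb k a q
            (StokesPDE.toRoot q '' StokesPDE.puncturedDisc r) ρ V u := by
  have hq0 : (0 : ℝ) < q := by exact_mod_cast hq.1.1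
  have hP : 0 < 2 * (q : ℝ) * Real.pi := by have := Real.pi_pos; positivity
  exact ⟨StokesPDE.isStokesLine_iff hmono hP hlast hsing,
    StokesPDE.isAntiStokesLine_iff hmono hP hlast hsing,
    StokesPDE.exists_isMaximalFamily pb hk ha hsum hq.1.1 hq.1.2 hmono hlast hsing⟩
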